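/- Let $X$ be a complex Banach space and let $(F_n)_{n\ge 1}$ be an unconditional Schauder decomposition of $X$; that is, the $F_n$ are closed linear subspaces of $X$, every $x\in X$ has a unique expansion $x=\sum_{n=1}^\infty x_n$ with $x_n\in F_n$, and all these expansions converge unconditionally. Suppose that $X$ has the maximal regularity property (MRP): whenever $-B$ is the infinitesimal generator of a bounded analytic semigroup $(e^{-tB})_{t\ge0}$ on $X$, the operator $B$ satisfies maximal regularity, i.e. for some $1<p<\infty$ and some $0<T<\infty$ (equivalently, as is well known, for all such $p$ and $T$), for every $f\in L^p([0,T);X)$ the solution $$u(t)=\int_0^t e^{-(t-s)B}f(s)\,ds$$ of $u'+Bu=f$, $u(0)=0$, satisfies $u'\in L^p([0,T);X)$. Then $X$ is isomorphic, as a Banach space, to the $\ell_2$-sum $$\Big(\sum_{n=1}^\infty\oplus F_n\Big)_{\ell_2}=\Big\{(x_n)_{n\ge1}:\ x_n\in F_n,\ \sum_{n=1}^\infty\|x_n\|^2<\infty\Big\},\qquad \|(x_n)\|=\Big(\sum_{n=1}^\infty\|x_n\|^2\Big)^{1/2}.$$ -/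

import Mathlib

open MeasureTheory Filter Topology

noncomputable section

namespace MaxReg

section Semigroups

variable {X : Type*} [NormedAddCommGroup X] [NormedSpace ℂ X]

/-- The open sector of half-angle `θ` around the positive real axis. -/
def sector (θ : ℝ) : Set ℂ := {z : ℂ | z ≠ 0 ∧ |z.arg| < θ}

/-- `S` is a bounded analytic semigroup on `X`: on some sector around the positive half-line it is
a uniformly bounded holomorphic family of operators with the semigroup law, and `S z x → x` as
`z → 0` in the sector. Only the values of `S` at `0` and on that sector matter. -/
def IsBoundedAnalyticSemigroup (S : ℂ → X →L[ℂ] X) : Prop :=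
  ∃ θ : ℝ, 0 < θ ∧ θ ≤ Real.pi / 2 ∧
    S 0 = ContinuousLinearMap.id ℂ X ∧
    (∀ z ∈ sector θ, ∀ w ∈ sector θ, S (z + w) = (S z).comp (S w)) ∧
    DifferentiableOn ℂ S (sector θ) ∧
    (∀ x : X, Tendsto (fun z => S z x) (𝓝[sector θ] 0) (𝓝 x)) ∧
    ∃ M : ℝ, ∀ z ∈ sector θ, ‖S z‖ ≤ M

/-- `y` is the derivative of `t ↦ S t x` at `0` from the right. -/
def IsGeneratorValue (S : ℂ → X →L[ℂ] X) (x y : X) : Prop :=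
  Tendsto (fun t : ℝ => (t : ℂ)⁻¹ • (S (t : ℂ) x - x)) (𝓝[>] 0) (𝓝 y)

theorem IsGeneratorValue.add {S : ℂ → X →L[ℂ] X} {x x' y y' : X}
    (h : IsGeneratorValue S x y) (h' : IsGeneratorValue S x' y') :
    IsGeneratorValue S (x + x') (y + y') := by
  unfold IsGeneratorValue at *
  refine (Tendsto.add h h').congr fun t => ?_
  rw [map_add, ← smul_add]
  congr 1
  abel

theorem IsGeneratorValue.smul {S : ℂ → X →L[ℂ] X} {x y : X} (c : ℂ)
    (h : IsGeneratorValue S x y) : IsGeneratorValue S (c • x) (c • y) := by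
  unfold IsGeneratorValue at *
  refine (Tendsto.const_smul h c).congr fun t => ?_
  rw [map_smul, ← smul_sub, smul_comm]

theorem IsGeneratorValue.unique {S : ℂ → X →L[ℂ] X} {x y y' : X}
    (h : IsGeneratorValue S x y) (h' : IsGeneratorValue S x y') : y = y' :=
  tendsto_nhds_unique h h'

/-- The infinitesimal generator of `S`, an unbounded operator with domain the set of all `x` for
which `t⁻¹ (S t x - x)` converges as `t → 0+`. -/
def generator (S : ℂ → X →L[ℂ] X) : X →ₗ.[ℂ] X where
  domain :=
    { carrier := {x | ∃ y, IsGeneratorValue S x y}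
      zero_mem' := ⟨0, by simp [IsGeneratorValue]⟩
      add_mem' := fun ⟨_, hy⟩ ⟨_, hy'⟩ => ⟨_, hy.add hy'⟩
      smul_mem' := fun c _ ⟨_, hy⟩ => ⟨_, hy.smul c⟩ }
  toFun :=
    { toFun := fun x => x.2.choose
      map_add' := fun x x' =>
        (x + x').2.choose_spec.unique (x.2.choose_spec.add x'.2.choose_spec)
      map_smul' := fun c x => (c • x).2.choose_spec.unique (x.2.choose_spec.smul c) }

/-- `-B` generates the bounded analytic semigroup `S`, that is, `S t = e^{-tB}`. -/
def IsSemigroupOf (S : ℂ → X →L[ℂ] X) (B : X →ₗ.[ℂ] X) : Prop :=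
  IsBoundedAnalyticSemigroup S ∧ generator S = -B

end Semigroups

section MaximalRegularity

variable {X : Type*} [NormedAddCommGroup X] [NormedSpace ℂ X]

/-- `u` is, on `[0,T)`, the primitive vanishing at `0` of a function in `L^p([0,T);X)`: it is
(the continuous representative of) an element of `W^{1,p}([0,T);X)` with `u(0) = 0`, and so
`u' ∈ L^p([0,T);X)`. -/
def MemSobolevZero (p T : ℝ) (u : ℝ → X) : Prop :=
  ∃ g : ℝ → X, MemLp g (ENNReal.ofReal p) (volume.restrict (Set.Ico 0 T)) ∧
    ∀ t ∈ Set.Ico 0 T, u t = ∫ s in (0 : ℝ)..t, g s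

/-- The solution `u(t) = ∫₀ᵗ e^{-(t-s)B} f(s) ds` of `u' + Bu = f`, `u(0) = 0`,
for `S t = e^{-tB}`. -/
def mildSolution (S : ℂ → X →L[ℂ] X) (f : ℝ → X) (t : ℝ) : X :=
  ∫ s in (0 : ℝ)..t, S ((t - s : ℝ) : ℂ) (f s)

/-- `L^p`-maximal regularity of `B` on `[0,T)`: for every `f ∈ L^p([0,T);X)` the solution
`u` of `u' + Bu = f`, `u(0) = 0`, satisfies `u' ∈ L^p([0,T);X)`. (The semigroup generated by `-B`
is determined on `[0,∞)` by `B`.) -/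
def HasLpMaximalRegularity (p T : ℝ) (B : X →ₗ.[ℂ] X) : Prop :=
  ∀ S : ℂ → X →L[ℂ] X, IsSemigroupOf S B →
    ∀ f : ℝ → X, MemLp f (ENNReal.ofReal p) (volume.restrict (Set.Ico 0 T)) →
      MemSobolevZero p T (mildSolution S f)

/-- Maximal regularity (MR): `L^p`-maximal regularity on `[0,T)` for some `1 < p < ∞` and some
`0 < T < ∞` (it is known that the property does not depend on `p` and `T`, so this is the
weakest form). -/
def HasMaximalRegularity (B : X →ₗ.[ℂ] X) : Prop :=
  ∃ p T : ℝ, 1 < p ∧ 0 < T ∧ HasLpMaximalRegularity p T B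

/-- The maximal regularity property (MRP) of `X`: every `B` such that `-B` generates a bounded
analytic semigroup on `X` satisfies (MR). -/
def HasMRP (X : Type*) [NormedAddCommGroup X] [NormedSpace ℂ X] : Prop :=
  ∀ B : X →ₗ.[ℂ] X, (∃ S : ℂ → X →L[ℂ] X, IsSemigroupOf S B) → HasMaximalRegularity B

end MaximalRegularity

section Decompositions

variable {X : Type*} [NormedAddCommGroup X] [NormedSpace ℂ X]

/-- The sequence of closed subspaces `F n` is a Schauder decomposition of `X`: every `x` has a
unique expansion `x = ∑ x_n` with `x_n ∈ F n`, with norm-convergent partial sums. -/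
structure IsSchauderDecomposition (F : ℕ → Submodule ℂ X) : Prop where
  isClosed : ∀ n, IsClosed (F n : Set X)
  existsUnique_expansion : ∀ x : X, ∃! a : (n : ℕ) → F n,
    Tendsto (fun N => ∑ n ∈ Finset.range N, (a n : X)) atTop (𝓝 x)

/-- A Schauder decomposition is unconditional if all the expansions converge unconditionally. -/
structure IsUnconditionalSchauderDecomposition (F : ℕ → Submodule ℂ X) : Prop
    extends IsSchauderDecomposition F where
  unconditional : ∀ (x : X) (a : (n : ℕ) → F n),
    Tendsto (fun N => ∑ n ∈ Finset.range N, (a n : X)) atTop (𝓝 x) →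
      HasSum (fun n => (a n : X)) x

end Decompositions

end MaxReg

end

/-! The decomposition provides coordinate projections `E n` with uniformly bounded multipliers. The
strength of (MRP) is that it also controls operators that are not multipliers. Let `S n` be any
increasing sequence of commuting projections converging strongly to the identity. Prescribing an
eigenvalue `a m` on the range of each difference of consecutive projections then generates a bounded
analytic semigroup. Abel summation writes it as a series in the `S m` themselves, so their
boundedness suffices, with no unconditionality.

Let the eigenvalues interlace with frequencies `β n`, both growing very fast. For the forcing term
`∑ exp(i β_n t) x_n`, the derivative of the solution is nearly `∑ exp(i β_n t) S_n x_n`: the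
multiplier `iβ/(a+iβ)` is nearly 1 when `a` is far below `β` and nearly 0 when it is far above. With
the closed graph theorem, the `p`-th mean of `‖∑ θ_n S_n x_n‖` is controlled by that of `‖∑ θ_n
x_n‖` for some orthogonal unimodular functions `θ_n` (`HasMRP.exists_chain_estimate`). Since the
exponent and the constant depend on the operator, finite chains on disjoint blocks are concatenated
into one chain, which gives them a common constant (`HasMRP.exists_blockChain_estimate`).

This estimate is used in three ways. Rank-one projections sending `y` to `y + x` show that norms of
disjoint sums depend, up to a constant, only on the norms of the summands
(`HasMRP.exists_domination`). Hence the fundamental function `‖d_0 + ... + d_{n-1}‖` of normalised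
coordinate vectors is nearly multiplicative, so it behaves like `n ^ α`, and disjoint sums behave as
in `ℓ_{1/α}`, or as in `c₀` when `α = 0` (`IsDominationBound.exists_hasPowerType`). Next, explicit
chains on `ℓ_1` and `c₀` violate the estimate. Finally, for `0 < α < 1`, `ℓ_{1/α}` contains
uniformly complemented copies of `ℓ_2^k`, spanned by Rademacher functions, beside copies of
`ℓ_{1/α}^k`; shearing one onto the other, in either direction, forces `α = 1/2`
(`HasPowerType.eq_half`). The resulting square estimate makes the coordinate map onto the `ℓ_2`-sum
an isomorphism. -/

open MeasureTheory Filter Topology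

noncomputable section

namespace MaxReg

variable {X : Type*} [NormedAddCommGroup X] [NormedSpace ℂ X]

/-! ### Continuity of the coordinate projections of a Schauder decomposition. -/

section Projections

/-- The convergent sequences of partial sums of expansions along `F`, as continuous functions on
the one-point compactification of `ℕ`. -/
def partialSumSpace (F : ℕ → Submodule ℂ X) : Submodule ℂ C(OnePoint ℕ, X) where
  carrier := {f | f ((0 : ℕ) : OnePoint ℕ) = 0 ∧
    ∀ n : ℕ, f ((n + 1 : ℕ) : OnePoint ℕ) - f (n : OnePoint ℕ) ∈ F n}
  zero_mem' := by simp
  add_mem' := by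
    rintro f g ⟨hf, hf'⟩ ⟨hg, hg'⟩
    refine ⟨by simp [hf, hg], fun n => ?_⟩
    have := (F n).add_mem (hf' n) (hg' n)
    simp only [ContinuousMap.add_apply]
    convert this using 1
    abel
  smul_mem' := by
    rintro c f ⟨hf, hf'⟩
    refine ⟨by simp [hf], fun n => ?_⟩
    have := (F n).smul_mem c (hf' n)
    simpa only [ContinuousMap.smul_apply, smul_sub] using this

theorem isClosed_partialSumSpace {F : ℕ → Submodule ℂ X} (hF : ∀ n, IsClosed (F n : Set X)) :
    IsClosed (partialSumSpace F : Set C(OnePoint ℕ, X)) := by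
  have h1 : (partialSumSpace F : Set C(OnePoint ℕ, X)) =
      {f | f ((0 : ℕ) : OnePoint ℕ) = 0} ∩
        ⋂ n : ℕ, {f | f ((n + 1 : ℕ) : OnePoint ℕ) - f (n : OnePoint ℕ) ∈ F n} := by
    ext f
    simp [partialSumSpace]
  rw [h1]
  refine IsClosed.inter ?_ (isClosed_iInter fun n => ?_)
  · exact isClosed_eq (continuous_eval_const _) continuous_const
  · exact (hF n).preimage
      ((continuous_eval_const _).sub (continuous_eval_const _))

/-- The limit of a sequence of partial sums. -/
def partialSumLim (F : ℕ → Submodule ℂ X) : partialSumSpace F →L[ℂ] X :=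
  (ContinuousMap.evalCLM ℂ OnePoint.infty).comp (partialSumSpace F).subtypeL

theorem partialSumSpace.sum_eq {F : ℕ → Submodule ℂ X} (f : partialSumSpace F) (N : ℕ) :
    ∑ n ∈ Finset.range N, (f.1 ((n + 1 : ℕ) : OnePoint ℕ) - f.1 (n : OnePoint ℕ)) =
      f.1 (N : OnePoint ℕ) := by
  rw [Finset.sum_range_sub (fun n : ℕ => f.1 (n : OnePoint ℕ)), f.2.1, sub_zero]

theorem partialSumSpace.tendsto {F : ℕ → Submodule ℂ X} (f : partialSumSpace F) :
    Tendsto (fun N : ℕ => f.1 (N : OnePoint ℕ)) atTop (𝓝 (partialSumLim F f)) :=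
  (OnePoint.continuous_iff_from_nat _).1 f.1.continuous

variable {F : ℕ → Submodule ℂ X}

/-- Injectivity is uniqueness of the expansion of `0`; surjectivity is existence of expansions,
whose partial sums extend continuously to infinity. -/
theorem partialSumLim_bijective (hF : IsSchauderDecomposition F) :
    Function.Bijective (partialSumLim F) := by
  constructor
  · rw [injective_iff_map_eq_zero]
    intro f hf
    have h1 := partialSumSpace.tendsto f
    rw [hf] at h1
    have h2 := (hF.existsUnique_expansion 0).unique
      (y₁ := fun n => ⟨_, f.2.2 n⟩) (y₂ := fun n => 0)
      (by simpa only [partialSumSpace.sum_eq] using h1) (by simp)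
    have h3 : ∀ N : ℕ, f.1 (N : OnePoint ℕ) = 0 := by
      intro N
      rw [← partialSumSpace.sum_eq]
      refine Finset.sum_eq_zero fun n _ => ?_
      exact congrArg Subtype.val (congrFun h2 n)
    ext y
    induction y using OnePoint.rec with
    | infty => exact hf
    | coe n => exact h3 n
  · intro x
    obtain ⟨a, ha, -⟩ := hF.existsUnique_expansion x
    let f : C(OnePoint ℕ, X) :=
      OnePoint.continuousMapMkNat (fun N => ∑ n ∈ Finset.range N, (a n : X)) x ha
    refine ⟨⟨f, ?_, fun n => ?_⟩, ?_⟩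
    · change ∑ n ∈ Finset.range 0, (a n : X) = 0
      simp
    · change ∑ i ∈ Finset.range (n + 1), (a i : X) - ∑ i ∈ Finset.range n, (a i : X) ∈ F n
      simp [Finset.sum_range_succ]
    · rfl

/-- A sequence of mutually annihilating projections that sum unconditionally to the identity. -/
structure IsUnconditionalResolution (E : ℕ → X →L[ℂ] X) : Prop where
  apply_apply : ∀ m n x, E m (E n x) = if m = n then E n x else 0
  hasSum : ∀ x, HasSum (fun n => E n x) x

/-- The partial sum space is closed in a Banach space, so the open mapping theorem inverts the limit
map continuously. A coordinate is then a difference of two point evaluations composed with this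
inverse. -/
theorem IsUnconditionalSchauderDecomposition.exists_resolution [CompleteSpace X]
    (hF : IsUnconditionalSchauderDecomposition F) :
    ∃ E : ℕ → X →L[ℂ] X, IsUnconditionalResolution E ∧ (∀ n x, E n x ∈ F n) ∧
      ∀ n, ∀ x ∈ F n, E n x = x := by
  have hcl := isClosed_partialSumSpace hF.isClosed
  have : CompleteSpace (partialSumSpace F) := hcl.completeSpace_coe
  have hb := partialSumLim_bijective hF.toIsSchauderDecomposition
  let e : partialSumSpace F ≃L[ℂ] X := ContinuousLinearEquiv.ofBijective (partialSumLim F)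
    (LinearMap.ker_eq_bot.2 hb.1) (LinearMap.range_eq_top.2 hb.2)
  have he : ∀ f, e f = partialSumLim F f := fun f => rfl
  let ev : OnePoint ℕ → (partialSumSpace F →L[ℂ] X) := fun y =>
    (ContinuousMap.evalCLM ℂ y).comp (partialSumSpace F).subtypeL
  let E : ℕ → X →L[ℂ] X := fun n =>
    (ev ((n + 1 : ℕ) : OnePoint ℕ) - ev (n : OnePoint ℕ)).comp (e.symm : X →L[ℂ] _)
  have hE : ∀ n x, E n x = (e.symm x).1 ((n + 1 : ℕ) : OnePoint ℕ) -
      (e.symm x).1 (n : OnePoint ℕ) := fun n x => rfl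
  have hmem : ∀ n x, E n x ∈ F n := fun n x => (e.symm x).2.2 n
  have htend : ∀ x, Tendsto (fun N => ∑ n ∈ Finset.range N, E n x) atTop (𝓝 x) := by
    intro x
    simp only [hE, partialSumSpace.sum_eq]
    have := partialSumSpace.tendsto (e.symm x)
    rwa [← he, e.apply_symm_apply] at this
  -- A vector of `F n` has the one-term expansion, which must be the one that `E` produces.
  have huniq : ∀ n, ∀ x ∈ F n, ∀ m, E m x = if m = n then x else 0 := by
    intro n x hx m
    classical
    have h2 := (hF.existsUnique_expansion x).unique
      (y₁ := fun k => ⟨E k x, hmem k x⟩)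
      (y₂ := fun k => if h : k = n then ⟨x, h ▸ hx⟩ else 0) (htend x) (by
        refine tendsto_const_nhds.congr' ?_
        filter_upwards [eventually_gt_atTop n] with N hN
        rw [Finset.sum_eq_single n]
        · simp
        · intro b _ hb
          simp [hb]
        · intro h
          exact absurd (Finset.mem_range.2 hN) h)
    have h3 := congrArg Subtype.val (congrFun h2 m)
    simp only at h3
    rw [h3]
    split_ifs <;> rfl
  refine ⟨E, ⟨fun m n x => huniq n _ (hmem n x) m, fun x => ?_⟩, hmem, fun n x hx => ?_⟩
  · exact hF.unconditional x (fun n => ⟨E n x, hmem n x⟩) (htend x)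
  · rw [huniq n x hx n, if_pos rfl]

end Projections

/-! ### Uniform boundedness of multipliers. -/

section Multipliers

/-- The projection associated with a finite set of coordinates. -/
def blockProj (E : ℕ → X →L[ℂ] X) (s : Finset ℕ) : X →L[ℂ] X := ∑ n ∈ s, E n

theorem blockProj_apply (E : ℕ → X →L[ℂ] X) (s : Finset ℕ) (x : X) :
    blockProj E s x = ∑ n ∈ s, E n x := by simp [blockProj]

variable {E : ℕ → X →L[ℂ] X}

theorem IsUnconditionalResolution.blockProj_blockProj (hE : IsUnconditionalResolution E)
    (s t : Finset ℕ) (x : X) : blockProj E s (blockProj E t x) = blockProj E (s ∩ t) x := by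
  simp only [blockProj_apply, map_sum, hE.apply_apply]
  rw [Finset.sum_comm]
  simp only [Finset.sum_ite_eq]
  rw [← Finset.sum_filter, ← Finset.filter_mem_eq_inter]

/-- A finite sum of complex numbers has a subsum that is not much smaller than the sum of the
absolute values. -/
theorem exists_subset_sum_norm_le {ι : Type*} (s : Finset ι) (c : ι → ℂ) :
    ∃ t ⊆ s, ∑ i ∈ s, ‖c i‖ ≤ 4 * ‖∑ i ∈ t, c i‖ := by
  classical
  -- For real numbers, the positive or the negative terms carry half of the absolute sum. Real and
  -- imaginary parts contribute a factor 2 each, hence the 4.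
  have key : ∀ (u : ι → ℝ), (∀ t ⊆ s, |∑ i ∈ t, u i| ≤ ‖∑ i ∈ t, c i‖) →
      ∃ t ⊆ s, ∑ i ∈ s, |u i| ≤ 2 * ‖∑ i ∈ t, c i‖ := by
    intro u hu
    have h1 : ∑ i ∈ s, |u i| = |∑ i ∈ s with 0 ≤ u i, u i| + |∑ i ∈ s with ¬ 0 ≤ u i, u i| := by
      rw [← Finset.sum_filter_add_sum_filter_not s (fun i => 0 ≤ u i)]
      congr 1
      · rw [abs_of_nonneg (Finset.sum_nonneg fun i hi => (Finset.mem_filter.1 hi).2)]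
        exact Finset.sum_congr rfl fun i hi => abs_of_nonneg (Finset.mem_filter.1 hi).2
      · rw [abs_of_nonpos (Finset.sum_nonpos fun i hi => (not_le.1 (Finset.mem_filter.1 hi).2).le),
          ← Finset.sum_neg_distrib]
        exact Finset.sum_congr rfl fun i hi =>
          abs_of_neg (not_le.1 (Finset.mem_filter.1 hi).2)
    have ha := hu _ (Finset.filter_subset (fun i => 0 ≤ u i) s)
    have hb := hu _ (Finset.filter_subset (fun i => ¬ 0 ≤ u i) s)
    rcases le_total ‖∑ i ∈ s with 0 ≤ u i, c i‖ ‖∑ i ∈ s with ¬ 0 ≤ u i, c i‖ with h | h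
    · exact ⟨_, Finset.filter_subset (fun i => ¬ 0 ≤ u i) s, by linarith⟩
    · exact ⟨_, Finset.filter_subset (fun i => 0 ≤ u i) s, by linarith⟩
  obtain ⟨t, ht, h1⟩ := key (fun i => (c i).re) fun t _ => by
    rw [← Complex.re_sum]; exact Complex.abs_re_le_norm _
  obtain ⟨t', ht', h2⟩ := key (fun i => (c i).im) fun t _ => by
    rw [← Complex.im_sum]; exact Complex.abs_im_le_norm _
  have h3 : ∑ i ∈ s, ‖c i‖ ≤ ∑ i ∈ s, |(c i).re| + ∑ i ∈ s, |(c i).im| := by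
    rw [← Finset.sum_add_distrib]
    exact Finset.sum_le_sum fun i _ => Complex.norm_le_abs_re_add_abs_im _
  rcases le_total ‖∑ i ∈ t, c i‖ ‖∑ i ∈ t', c i‖ with h | h
  · exact ⟨t', ht', by linarith⟩
  · exact ⟨t, ht, by linarith⟩

/-- A norming functional turns the sum into scalars, where coefficients of modulus at most one are
dropped and absolute values are traded for a subsum. -/
theorem norm_sum_smul_le_of_subset_sum {ι : Type*} (s : Finset ι) (x : ι → X) (c : ι → ℂ)
    {R : ℝ} (hc : ∀ i ∈ s, ‖c i‖ ≤ 1) (hR : ∀ t ⊆ s, ‖∑ i ∈ t, x i‖ ≤ R) :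
    ‖∑ i ∈ s, c i • x i‖ ≤ 4 * R := by
  obtain ⟨g, hg, hg'⟩ := exists_dual_vector'' ℂ (∑ i ∈ s, c i • x i)
  obtain ⟨t, ht, h1⟩ := exists_subset_sum_norm_le s fun i => g (x i)
  have h2 : ‖∑ i ∈ s, c i • x i‖ = ‖g (∑ i ∈ s, c i • x i)‖ := by
    rw [hg']; simp
  rw [h2, map_sum]
  calc ‖∑ i ∈ s, g (c i • x i)‖ ≤ ∑ i ∈ s, ‖g (c i • x i)‖ := norm_sum_le _ _
    _ ≤ ∑ i ∈ s, ‖g (x i)‖ := by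
        refine Finset.sum_le_sum fun i hi => ?_
        rw [map_smul, norm_smul]
        exact mul_le_of_le_one_left (norm_nonneg _) (hc i hi)
    _ ≤ 4 * ‖∑ i ∈ t, g (x i)‖ := h1
    _ ≤ 4 * R := by
        rw [← map_sum]
        have := g.le_of_opNorm_le hg (∑ i ∈ t, x i)
        have := hR t ht
        linarith

/-- Unconditional convergence bounds the finite subsums of each expansion, Banach–Steinhaus makes
the bound uniform, and general coefficients cost a factor 4. -/
theorem IsUnconditionalResolution.exists_multiplier_bound [CompleteSpace X]
    (hE : IsUnconditionalResolution E) :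
    ∃ K : ℝ, 1 ≤ K ∧ ∀ (s : Finset ℕ) (c : ℕ → ℂ), (∀ n ∈ s, ‖c n‖ ≤ 1) → ∀ x,
      ‖∑ n ∈ s, c n • E n x‖ ≤ K * ‖x‖ := by
  have h1 : ∀ x, ∃ C, ∀ s : Finset ℕ, ‖blockProj E s x‖ ≤ C := by
    intro x
    have hcs := (hE.hasSum x).summable
    obtain ⟨s₀, hs₀⟩ := summable_iff_vanishing_norm.1 hcs 1 one_pos
    refine ⟨∑ n ∈ s₀, ‖E n x‖ + 1, fun s => ?_⟩
    rw [blockProj_apply, ← Finset.sum_filter_add_sum_filter_not s (· ∈ s₀)]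
    refine (norm_add_le _ _).trans (add_le_add ?_ (hs₀ _ ?_).le)
    · refine (norm_sum_le _ _).trans ?_
      exact Finset.sum_le_sum_of_subset_of_nonneg (fun i hi => (Finset.mem_filter.1 hi).2)
        fun _ _ _ => norm_nonneg _
    · exact Finset.disjoint_left.2 fun i hi => (Finset.mem_filter.1 hi).2
  obtain ⟨C, hC⟩ := banach_steinhaus h1
  refine ⟨4 * max C 1, by linarith [le_max_right C 1], fun s c hc x => ?_⟩
  rw [mul_assoc]
  refine norm_sum_smul_le_of_subset_sum s _ c hc fun t _ => ?_
  rw [← blockProj_apply]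
  exact (blockProj E t).le_of_opNorm_le ((hC t).trans (le_max_left _ _)) x

end Multipliers

/-! ### The bounded analytic semigroup attached to a projection chain. -/

section ChainSemigroup

/-- A commuting increasing sequence of projections converging strongly to the identity. -/
structure IsProjectionChain (S : ℕ → X →L[ℂ] X) : Prop where
  apply_apply : ∀ m n x, S m (S n x) = S (min m n) x
  tendsto : ∀ x, Tendsto (fun n => S n x) atTop (𝓝 x)

/-- The successive differences of a sequence of operators. -/
def chainDiff (S : ℕ → X →L[ℂ] X) : ℕ → X →L[ℂ] X
  | 0 => S 0
  | n + 1 => S (n + 1) - S n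

theorem sum_chainDiff (S : ℕ → X →L[ℂ] X) (n : ℕ) (x : X) :
    ∑ m ∈ Finset.range (n + 1), chainDiff S m x = S n x := by
  induction n with
  | zero => simp [chainDiff]
  | succ n ih => rw [Finset.sum_range_succ, ih]; simp [chainDiff]

namespace IsProjectionChain

variable {S : ℕ → X →L[ℂ] X}

theorem apply_chainDiff (hS : IsProjectionChain S) (j m : ℕ) (x : X) :
    S j (chainDiff S m x) = if m ≤ j then chainDiff S m x else 0 := by
  cases m with
  | zero => simp [chainDiff, hS.apply_apply]
  | succ m =>
    simp only [chainDiff, sub_apply, map_sub, hS.apply_apply]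
    split_ifs with h
    · rw [min_eq_right h, min_eq_right (by omega)]
    · rw [min_eq_left (by omega), min_eq_left (by omega), sub_self]

/-- The ranges of the differences span a dense subspace, because `S n x` tends to `x`. -/
theorem ext_of_chainDiff (hS : IsProjectionChain S) {A B : X →L[ℂ] X}
    (h : ∀ m x, A (chainDiff S m x) = B (chainDiff S m x)) : A = B := by
  ext x
  have h1 : ∀ n, A (S n x) = B (S n x) := by
    intro n
    rw [← sum_chainDiff, map_sum, map_sum]
    exact Finset.sum_congr rfl fun m _ => h m x
  refine tendsto_nhds_unique ((A.continuous.tendsto x).comp (hS.tendsto x)) ?_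
  refine ((B.continuous.tendsto x).comp (hS.tendsto x)).congr fun n => ?_
  exact (h1 n).symm

theorem exists_bound (hS : IsProjectionChain S) [CompleteSpace X] : ∃ M : ℝ, 1 ≤ M ∧ ∀ n, ‖S n‖ ≤ M := by
  have h1 : ∀ x, ∃ C, ∀ n, ‖S n x‖ ≤ C := by
    intro x
    obtain ⟨C, hC⟩ := (hS.tendsto x).norm.bddAbove_range
    exact ⟨C, fun n => hC ⟨n, rfl⟩⟩
  obtain ⟨C, hC⟩ := banach_steinhaus h1
  exact ⟨max C 1, le_max_right _ _, fun n => (hC n).trans (le_max_left _ _)⟩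

end IsProjectionChain

theorem norm_chainDiff_le {S : ℕ → X →L[ℂ] X} {M : ℝ} (hM : ∀ n, ‖S n‖ ≤ M) (m : ℕ) : ‖chainDiff S m‖ ≤ 2 * M := by
  have h0 : 0 ≤ M := (norm_nonneg _).trans (hM 0)
  cases m with
  | zero => exact (hM 0).trans (by linarith)
  | succ m =>
    refine (norm_sub_le _ _).trans ?_
    linarith [hM (m + 1), hM m]

/-- The `m`-th coefficient of the Abel-summed exponential series. -/
def expDiff (a : ℕ → ℝ) (m : ℕ) (z : ℂ) : ℂ :=
  Complex.exp (-z * a m) - Complex.exp (-z * a (m + 1))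

theorem norm_exp_neg_mul (z : ℂ) (s : ℝ) :
    ‖Complex.exp (-z * s)‖ = Real.exp (-z.re * s) := by
  rw [Complex.norm_exp]; simp

/-- The derivative is integrated in norm. The bound is a difference of real exponentials, so it
telescopes along a monotone sequence, and the factor `‖z‖ / z.re` is bounded on a proper sector. -/
theorem norm_exp_sub_exp_le {z : ℂ} (hz : 0 < z.re) {s t : ℝ} (hst : s ≤ t) :
    ‖Complex.exp (-z * s) - Complex.exp (-z * t)‖ ≤
      ‖z‖ / z.re * (Real.exp (-z.re * s) - Real.exp (-z.re * t)) := by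
  have hd : ∀ r : ℝ, HasDerivAt (fun r : ℝ => Complex.exp (-z * r)) (Complex.exp (-z * r) * -z) r :=
    fun r => by
      have := ((hasDerivAt_id r).ofReal_comp.const_mul (-z)).cexp
      simpa using this
  have hd' : ∀ r : ℝ, HasDerivAt (fun r : ℝ => -(‖z‖ / z.re * Real.exp (-z.re * r)))
      (‖z‖ * Real.exp (-z.re * r)) r := fun r => by
    have := ((((hasDerivAt_id r).const_mul (-z.re)).exp).const_mul (‖z‖ / z.re)).neg
    refine this.congr_deriv ?_
    simp
    field_simp
  have h1 : ∫ r in s..t, Complex.exp (-z * r) * -z =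
      Complex.exp (-z * t) - Complex.exp (-z * s) :=
    intervalIntegral.integral_eq_sub_of_hasDerivAt (fun r _ => hd r)
      (Continuous.intervalIntegrable (by fun_prop) _ _)
  have h2 : ∫ r in s..t, ‖z‖ * Real.exp (-z.re * r) =
      -(‖z‖ / z.re * Real.exp (-z.re * t)) - -(‖z‖ / z.re * Real.exp (-z.re * s)) :=
    intervalIntegral.integral_eq_sub_of_hasDerivAt (fun r _ => hd' r)
      (Continuous.intervalIntegrable (by fun_prop) _ _)
  rw [norm_sub_rev, ← h1]
  have h3 : ‖∫ r in s..t, Complex.exp (-z * r) * -z‖ ≤ ∫ r in s..t, ‖z‖ * Real.exp (-z.re * r) := by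
    refine intervalIntegral.norm_integral_le_of_norm_le hst (Eventually.of_forall fun r _ => ?_)
      (Continuous.intervalIntegrable (by fun_prop) _ _)
    rw [norm_mul, norm_exp_neg_mul, norm_neg, mul_comm]
  refine h3.trans (le_of_eq ?_)
  rw [h2]; ring

variable {a : ℕ → ℝ}

theorem summable_exp_neg_mul (ha' : ∀ m : ℕ, (m : ℝ) ≤ a m) {ε : ℝ} (hε : 0 < ε) :
    Summable fun m : ℕ => Real.exp (-ε * a m) := by
  refine Summable.of_nonneg_of_le (fun _ => (Real.exp_pos _).le) (fun m => ?_)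
    (Real.summable_exp_nat_mul_iff.2 (neg_lt_zero.2 hε))
  apply Real.exp_le_exp.2
  nlinarith [ha' m]

theorem norm_expDiff_le (ha : Monotone a) {z : ℂ} {ε : ℝ} (hε : ε ≤ z.re) (ha0 : 0 ≤ a 0)
    (hz : 0 ≤ z.re) (m : ℕ) : ‖expDiff a m z‖ ≤ 2 * Real.exp (-ε * a m) := by
  have h0 : ∀ m, 0 ≤ a m := fun m => ha0.trans (ha (Nat.zero_le m))
  refine (norm_sub_le _ _).trans ?_
  rw [norm_exp_neg_mul, norm_exp_neg_mul]
  have h1 : Real.exp (-z.re * a m) ≤ Real.exp (-ε * a m) :=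
    Real.exp_le_exp.2 (by nlinarith [h0 m])
  have h2 : Real.exp (-z.re * a (m + 1)) ≤ Real.exp (-z.re * a m) :=
    Real.exp_le_exp.2 (by nlinarith [ha (Nat.le_succ m)])
  linarith

/-- The semigroup generated by `-∑ a m • (S m - S (m - 1))`. -/
def chainSemigroup (a : ℕ → ℝ) (S : ℕ → X →L[ℂ] X) (z : ℂ) : X →L[ℂ] X :=
  if z = 0 then ContinuousLinearMap.id ℂ X else ∑' m, expDiff a m z • S m

theorem norm_le_two_mul_re_of_mem_sector {z : ℂ} (hz : z ∈ sector (Real.pi / 3)) :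
    0 < z.re ∧ ‖z‖ ≤ 2 * z.re := by
  have h0 : 0 < ‖z‖ := norm_pos_iff.2 hz.1
  have h1 : Real.cos (Real.pi / 3) ≤ Real.cos |z.arg| :=
    Real.cos_le_cos_of_nonneg_of_le_pi (abs_nonneg _) (by linarith [Real.pi_pos]) hz.2.le
  rw [Real.cos_abs, Real.cos_pi_div_three, Complex.cos_arg hz.1, le_div_iff₀ h0] at h1
  constructor <;> linarith

section

variable [CompleteSpace X] {S : ℕ → X →L[ℂ] X}

theorem summable_norm_expDiff_smul (hS : IsProjectionChain S) (ha : Monotone a)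
    (ha' : ∀ m : ℕ, (m : ℝ) ≤ a m) {z : ℂ} (hz : 0 < z.re) :
    Summable fun m => ‖expDiff a m z • S m‖ := by
  obtain ⟨M, hM1, hM⟩ := hS.exists_bound
  refine Summable.of_nonneg_of_le (fun _ => norm_nonneg _) (fun m => ?_)
    ((summable_exp_neg_mul ha' hz).mul_left (2 * M))
  rw [norm_smul]
  have h1 := norm_expDiff_le ha (le_refl z.re) (by simpa using ha' 0) hz.le m
  calc ‖expDiff a m z‖ * ‖S m‖ ≤ (2 * Real.exp (-z.re * a m)) * M :=
        mul_le_mul h1 (hM m) (norm_nonneg _) (by positivity)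
    _ = 2 * M * Real.exp (-z.re * a m) := by ring

/-- On the range of the `m`-th difference, `S j` vanishes for `j < m` and is the identity for `j ≥
m`, so the series telescopes to `exp (-z * a m)`. -/
theorem chainSemigroup_chainDiff (hS : IsProjectionChain S) (ha : Monotone a)
    (ha' : ∀ m : ℕ, (m : ℝ) ≤ a m) {z : ℂ} (hz : 0 < z.re ∨ z = 0) (m : ℕ) (x : X) :
    chainSemigroup a S z (chainDiff S m x) = Complex.exp (-z * a m) • chainDiff S m x := by
  rcases hz with hz | hz
  swap
  · simp [chainSemigroup, hz]
  have hz0 : z ≠ 0 := by rintro rfl; simp at hz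
  have hs := (summable_norm_expDiff_smul hS ha ha' hz).of_norm
  have h1 : Tendsto (fun N => (∑ j ∈ Finset.range N, expDiff a j z • S j) (chainDiff S m x)) atTop
      (𝓝 (chainSemigroup a S z (chainDiff S m x))) := by
    rw [chainSemigroup, if_neg hz0]
    exact (((ContinuousLinearMap.apply ℂ X (chainDiff S m x)).continuous.tendsto _).comp
      hs.hasSum.tendsto_sum_nat)
  have h2 : ∀ N, (∑ j ∈ Finset.range (m + N), expDiff a j z • S j) (chainDiff S m x) =
      (Complex.exp (-z * a m) - Complex.exp (-z * a (m + N))) • chainDiff S m x := by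
    intro N
    simp only [sum_apply, smul_apply, hS.apply_chainDiff]
    rw [Finset.sum_range_add, Finset.sum_eq_zero, zero_add]
    · simp only [Nat.le_add_right, if_true, ← Finset.sum_smul]
      congr 1
      exact Finset.sum_range_sub' (fun j => Complex.exp (-z * a (m + j))) N
    · intro j hj
      rw [if_neg (by simpa using hj), smul_zero]
  have h3 : Tendsto (fun N => Complex.exp (-z * a (m + N))) atTop (𝓝 0) := by
    rw [tendsto_zero_iff_norm_tendsto_zero]
    simp only [norm_exp_neg_mul]
    have := (summable_exp_neg_mul ha' hz).tendsto_atTop_zero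
    simpa [add_comm] using (tendsto_add_atTop_iff_nat m).2 this
  have h4 : Tendsto (fun N => (∑ j ∈ Finset.range (m + N), expDiff a j z • S j) (chainDiff S m x))
      atTop (𝓝 ((Complex.exp (-z * a m) - 0) • chainDiff S m x)) := by
    simp only [h2]
    exact (tendsto_const_nhds.sub h3).smul_const _
  rw [sub_zero] at h4
  refine tendsto_nhds_unique ?_ h4
  have := (tendsto_add_atTop_iff_nat m).2 h1
  simpa [add_comm] using this

/-- The coefficient norms are dominated by twice a telescoping sum of real exponentials with total
at most 1; the 2 is `1 / cos (π / 3)`. -/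
theorem norm_chainSemigroup_le (hS : IsProjectionChain S) (ha : Monotone a)
    (ha' : ∀ m : ℕ, (m : ℝ) ≤ a m) {M : ℝ} (hM : ∀ n, ‖S n‖ ≤ M) {z : ℂ}
    (hz : z ∈ sector (Real.pi / 3)) : ‖chainSemigroup a S z‖ ≤ 2 * M := by
  obtain ⟨hre, hnorm⟩ := norm_le_two_mul_re_of_mem_sector hz
  have hM0 : 0 ≤ M := (norm_nonneg _).trans (hM 0)
  have hs := summable_norm_expDiff_smul hS ha ha' hre
  rw [chainSemigroup, if_neg hz.1]
  refine (norm_tsum_le_tsum_norm hs).trans ?_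
  refine hs.tsum_le_of_sum_range_le fun N => ?_
  have hq : ‖z‖ / z.re ≤ 2 := by rwa [div_le_iff₀ hre]
  calc ∑ m ∈ Finset.range N, ‖expDiff a m z • S m‖
      ≤ ∑ m ∈ Finset.range N,
          2 * M * (Real.exp (-z.re * a m) - Real.exp (-z.re * a (m + 1))) := by
        refine Finset.sum_le_sum fun m _ => ?_
        have h1 := norm_exp_sub_exp_le hre (ha (Nat.le_succ m))
        have h2 : 0 ≤ Real.exp (-z.re * a m) - Real.exp (-z.re * a (m + 1)) :=
          sub_nonneg.2 (Real.exp_le_exp.2 (by nlinarith [ha (Nat.le_succ m)]))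
        rw [norm_smul]
        calc ‖expDiff a m z‖ * ‖S m‖
            ≤ (2 * (Real.exp (-z.re * a m) - Real.exp (-z.re * a (m + 1)))) * M :=
              mul_le_mul (h1.trans (mul_le_mul_of_nonneg_right hq h2)) (hM m) (norm_nonneg _)
                (by positivity)
          _ = _ := by ring
    _ = 2 * M * (Real.exp (-z.re * a 0) - Real.exp (-z.re * a N)) := by
        rw [← Finset.mul_sum]
        congr 1
        exact Finset.sum_range_sub' (fun j => Real.exp (-z.re * a j)) N
    _ ≤ 2 * M := by
        have h1 : Real.exp (-z.re * a 0) ≤ 1 :=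
          Real.exp_le_one_iff.2 (by nlinarith [show 0 ≤ a 0 by simpa using ha' 0])
        nlinarith [Real.exp_pos (-z.re * a N)]

/-- The series of entire functions converges uniformly on the half-plane to the right of `z.re / 2`.
-/
theorem differentiableAt_chainSemigroup (hS : IsProjectionChain S) (ha : Monotone a)
    (ha' : ∀ m : ℕ, (m : ℝ) ≤ a m) {z : ℂ} (hz : 0 < z.re) :
    DifferentiableAt ℂ (chainSemigroup a S) z := by
  obtain ⟨M, hM1, hM⟩ := hS.exists_bound
  have hε : 0 < z.re / 2 := by linarith
  have hU : IsOpen {w : ℂ | z.re / 2 < w.re} := isOpen_lt continuous_const Complex.continuous_re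
  have hzU : {w : ℂ | z.re / 2 < w.re} ∈ 𝓝 z := hU.mem_nhds (by simp; linarith)
  have h1 : DifferentiableOn ℂ (fun w => ∑' m, expDiff a m w • S m) {w : ℂ | z.re / 2 < w.re} := by
    refine Complex.differentiableOn_tsum_of_summable_norm
      ((summable_exp_neg_mul ha' hε).mul_left (2 * M)) (fun m => ?_) hU (fun m w hw => ?_)
    · unfold expDiff
      fun_prop
    · rw [norm_smul]
      have hw' : z.re / 2 < w.re := hw
      have h1 := norm_expDiff_le ha hw'.le (by simpa using ha' 0) (by linarith) m
      calc ‖expDiff a m w‖ * ‖S m‖ ≤ (2 * Real.exp (-(z.re / 2) * a m)) * M :=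
            mul_le_mul h1 (hM m) (norm_nonneg _) (by positivity)
        _ = 2 * M * Real.exp (-(z.re / 2) * a m) := by ring
  refine (h1.differentiableAt hzU).congr_of_eventuallyEq ?_
  filter_upwards [hzU] with w hw
  have : w ≠ 0 := by rintro rfl; simp at hw; linarith
  simp [chainSemigroup, this]

/-- On the range of `S k` the semigroup is a finite sum of exponentials; the uniform bound on the
sector extends the limit to all vectors. -/
theorem tendsto_chainSemigroup (hS : IsProjectionChain S) (ha : Monotone a)
    (ha' : ∀ m : ℕ, (m : ℝ) ≤ a m) (x : X) :
    Tendsto (fun z => chainSemigroup a S z x) (𝓝[sector (Real.pi / 3)] 0) (𝓝 x) := by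
  obtain ⟨M, hM1, hM⟩ := hS.exists_bound
  have hk : ∀ k, Tendsto (fun z => chainSemigroup a S z (S k x)) (𝓝[sector (Real.pi / 3)] 0)
      (𝓝 (S k x)) := by
    intro k
    have h1 : Tendsto (fun z : ℂ => ∑ m ∈ Finset.range (k + 1),
        Complex.exp (-z * a m) • chainDiff S m x) (𝓝[sector (Real.pi / 3)] 0)
        (𝓝 (∑ m ∈ Finset.range (k + 1), Complex.exp (-0 * a m) • chainDiff S m x)) := by
      refine Tendsto.mono_left ?_ nhdsWithin_le_nhds
      refine Continuous.tendsto (f := fun z : ℂ => ∑ m ∈ Finset.range (k + 1),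
        Complex.exp (-z * a m) • chainDiff S m x) (by fun_prop) 0
    simp only [neg_zero, zero_mul, Complex.exp_zero, one_smul, sum_chainDiff] at h1
    refine h1.congr' ?_
    filter_upwards [self_mem_nhdsWithin] with z hz
    rw [← sum_chainDiff, map_sum]
    refine Finset.sum_congr rfl fun m _ => ?_
    rw [chainSemigroup_chainDiff hS ha ha' (Or.inl (norm_le_two_mul_re_of_mem_sector hz).1)]
  rw [Metric.tendsto_nhds]
  intro ε hε
  obtain ⟨k, hk1⟩ := ((Metric.tendsto_nhds.1 (hS.tendsto x)) (ε / (4 * M)) (by positivity)).exists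
  rw [dist_eq_norm] at hk1
  filter_upwards [(Metric.tendsto_nhds.1 (hk k)) (ε / 4) (by positivity), self_mem_nhdsWithin]
    with z hz1 hz2
  rw [dist_eq_norm] at hz1 ⊢
  have h1 : chainSemigroup a S z x - x = chainSemigroup a S z (x - S k x) +
      (chainSemigroup a S z (S k x) - S k x) + (S k x - x) := by
    rw [map_sub]; abel
  have h2 : ‖chainSemigroup a S z (x - S k x)‖ ≤ 2 * M * ‖x - S k x‖ :=
    (chainSemigroup a S z).le_of_opNorm_le (norm_chainSemigroup_le hS ha ha' hM hz2) _
  rw [norm_sub_rev] at hk1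
  have h3 : 2 * M * ‖x - S k x‖ ≤ ε / 2 := by
    rw [lt_div_iff₀ (by positivity)] at hk1
    nlinarith
  have h4 : ‖x - S k x‖ < ε / 4 := by
    refine hk1.trans_le ?_
    apply div_le_div_of_nonneg_left hε.le (by norm_num) (by linarith)
  rw [h1]
  refine (norm_add₃_le).trans_lt ?_
  rw [norm_sub_rev (S k x) x]
  linarith

theorem isBoundedAnalyticSemigroup_chainSemigroup (hS : IsProjectionChain S) (ha : Monotone a)
    (ha' : ∀ m : ℕ, (m : ℝ) ≤ a m) :
    IsBoundedAnalyticSemigroup (chainSemigroup a S) := by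
  obtain ⟨M, hM1, hM⟩ := hS.exists_bound
  refine ⟨Real.pi / 3, by positivity, by linarith [Real.pi_pos], by simp [chainSemigroup], ?_, ?_,
    tendsto_chainSemigroup hS ha ha', 2 * M, fun z hz => norm_chainSemigroup_le hS ha ha' hM hz⟩
  · intro z hz w hw
    have hz' := (norm_le_two_mul_re_of_mem_sector hz).1
    have hw' := (norm_le_two_mul_re_of_mem_sector hw).1
    refine hS.ext_of_chainDiff fun m x => ?_
    rw [ContinuousLinearMap.comp_apply, chainSemigroup_chainDiff hS ha ha' (Or.inl hw'), map_smul,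
      chainSemigroup_chainDiff hS ha ha' (Or.inl hz'),
      chainSemigroup_chainDiff hS ha ha' (Or.inl (by simp; linarith)), smul_smul, ← Complex.exp_add]
    congr 2
    ring
  · intro z hz
    exact (differentiableAt_chainSemigroup hS ha ha'
      (norm_le_two_mul_re_of_mem_sector hz).1).differentiableWithinAt

end

end ChainSemigroup

/-! ### Maximal regularity as a norm inequality. -/

section RegularityBound

/-- By Lebesgue differentiation, a primitive determines its density. This makes the derivative of
the solution a well-defined element of `L^p`. -/
theorem ae_eq_of_forall_intervalIntegral_eq [CompleteSpace X] {T : ℝ} {g g' : ℝ → X}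
    (hg : IntegrableOn g (Set.Ico 0 T)) (hg' : IntegrableOn g' (Set.Ico 0 T))
    (h : ∀ t ∈ Set.Ico 0 T, ∫ s in (0 : ℝ)..t, g s = ∫ s in (0 : ℝ)..t, g' s) :
    g =ᵐ[volume.restrict (Set.Ico 0 T)] g' := by
  rcases lt_or_ge 0 T with hT | hT
  swap
  · simp [Set.Ico_eq_empty (not_lt.2 hT), Filter.EventuallyEq]
  have h1 : IntervalIntegrable g volume 0 T := by
    rwa [intervalIntegrable_iff_integrableOn_Ico_of_le hT.le]
  have h2 : IntervalIntegrable g' volume 0 T := by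
    rwa [intervalIntegrable_iff_integrableOn_Ico_of_le hT.le]
  rw [Filter.EventuallyEq, ae_restrict_iff' measurableSet_Ico]
  have h0 : ∀ᵐ x : ℝ, x ≠ 0 := by simp [ae_iff, measure_singleton]
  filter_upwards [h1.ae_hasDerivAt_integral, h2.ae_hasDerivAt_integral, h0] with x hx hx' hx0 hxT
  have hmem : x ∈ Set.uIcc 0 T := by
    rw [Set.uIcc_of_le hT.le]; exact ⟨hxT.1, hxT.2.le⟩
  have d1 := hx hmem 0 Set.left_mem_uIcc
  have d2 := hx' hmem 0 Set.left_mem_uIcc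
  refine d1.unique (d2.congr_of_eventuallyEq ?_)
  have hx1 : 0 < x := lt_of_le_of_ne hxT.1 (Ne.symm hx0)
  filter_upwards [Ioo_mem_nhds hx1 hxT.2] with y hy
  exact h y ⟨hy.1.le, hy.2⟩

variable {V : ℂ → X →L[ℂ] X} {M T : ℝ}

theorem integrableOn_mild (hV : ContinuousOn (fun s : ℝ => V (s : ℂ)) (Set.Ioi 0))
    (hM : ∀ s : ℝ, 0 < s → ‖V (s : ℂ)‖ ≤ M) {f : ℝ → X} (hf : IntegrableOn f (Set.Ico 0 T))
    {t : ℝ} (ht : t ∈ Set.Ico 0 T) :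
    IntegrableOn (fun s => V ((t - s : ℝ) : ℂ) (f s)) (Set.Ioo 0 t) := by
  have hsub : Set.Ioo 0 t ⊆ Set.Ico 0 T := fun s hs => ⟨hs.1.le, hs.2.trans ht.2⟩
  have hf' : IntegrableOn f (Set.Ioo 0 t) := hf.mono_set hsub
  refine Integrable.mono' (hf'.norm.const_mul M) ?_ ?_
  · refine (ContinuousLinearMap.id ℂ (X →L[ℂ] X)).aestronglyMeasurable_comp₂ ?_
      hf'.aestronglyMeasurable
    refine ContinuousOn.aestronglyMeasurable ?_ measurableSet_Ioo
    refine hV.comp (f := fun s : ℝ => t - s) (by fun_prop) fun s hs => ?_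
    simpa using hs.2
  · rw [ae_restrict_iff' measurableSet_Ioo]
    refine Eventually.of_forall fun s hs => ?_
    exact (V ((t - s : ℝ) : ℂ)).le_of_opNorm_le (hM _ (by linarith [hs.2])) _

/-- On the open interval `V` is evaluated only at positive times, where its continuity and its bound
are assumed. -/
theorem mildSolution_eq_setIntegral (V : ℂ → X →L[ℂ] X) (f : ℝ → X) {t : ℝ} (ht : 0 ≤ t) :
    mildSolution V f t = ∫ s in Set.Ioo 0 t, V ((t - s : ℝ) : ℂ) (f s) := by
  rw [mildSolution, intervalIntegral.integral_of_le ht, integral_Ioc_eq_integral_Ioo]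

theorem mildSolution_congr_ae (V : ℂ → X →L[ℂ] X) {f f' : ℝ → X}
    (h : f =ᵐ[volume.restrict (Set.Ico 0 T)] f') {t : ℝ} (ht : t ∈ Set.Ico 0 T) :
    mildSolution V f t = mildSolution V f' t := by
  rw [mildSolution_eq_setIntegral V f ht.1, mildSolution_eq_setIntegral V f' ht.1]
  have hsub : Set.Ioo 0 t ⊆ Set.Ico 0 T := fun s hs => ⟨hs.1.le, hs.2.trans ht.2⟩
  refine integral_congr_ae ?_
  filter_upwards [ae_restrict_of_ae_restrict_of_subset hsub h] with s hs
  rw [hs]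

theorem intervalIntegral_congr_ae_of_mem {f f' : ℝ → X}
    (h : f =ᵐ[volume.restrict (Set.Ico 0 T)] f') {t : ℝ} (ht : t ∈ Set.Ico 0 T) :
    ∫ s in (0 : ℝ)..t, f s = ∫ s in (0 : ℝ)..t, f' s := by
  -- For the constant family equal to the identity, the mild solution is the primitive of `f`.
  simpa [mildSolution] using
    mildSolution_congr_ae (fun _ => ContinuousLinearMap.id ℂ X) h ht

theorem mildSolution_add (hV : ContinuousOn (fun s : ℝ => V (s : ℂ)) (Set.Ioi 0))
    (hM : ∀ s : ℝ, 0 < s → ‖V (s : ℂ)‖ ≤ M) {f f' : ℝ → X} (hf : IntegrableOn f (Set.Ico 0 T))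
    (hf' : IntegrableOn f' (Set.Ico 0 T)) {t : ℝ} (ht : t ∈ Set.Ico 0 T) :
    mildSolution V (f + f') t = mildSolution V f t + mildSolution V f' t := by
  simp only [mildSolution_eq_setIntegral V _ ht.1, Pi.add_apply, map_add]
  exact integral_add (integrableOn_mild hV hM hf ht) (integrableOn_mild hV hM hf' ht)

theorem mildSolution_smul (V : ℂ → X →L[ℂ] X) (c : ℂ) (f : ℝ → X) (t : ℝ) :
    mildSolution V (c • f) t = c • mildSolution V f t := by
  simp only [mildSolution, Pi.smul_apply, map_smul]
  exact intervalIntegral.integral_smul _ _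

theorem tendsto_mildSolution (hV : ContinuousOn (fun s : ℝ => V (s : ℂ)) (Set.Ioi 0))
    (hM : ∀ s : ℝ, 0 < s → ‖V (s : ℂ)‖ ≤ M) {u : ℕ → ℝ → X} {f : ℝ → X}
    (hu : ∀ n, IntegrableOn (u n) (Set.Ico 0 T)) (hf : IntegrableOn f (Set.Ico 0 T))
    (h : Tendsto (fun n => eLpNorm (u n - f) 1 (volume.restrict (Set.Ico 0 T))) atTop (𝓝 0))
    {t : ℝ} (ht : t ∈ Set.Ico 0 T) :
    Tendsto (fun n => mildSolution V (u n) t) atTop (𝓝 (mildSolution V f t)) := by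
  simp only [mildSolution_eq_setIntegral V _ ht.1]
  have hsub : Set.Ioo 0 t ⊆ Set.Ico 0 T := fun s hs => ⟨hs.1.le, hs.2.trans ht.2⟩
  refine tendsto_integral_of_L1' _ (integrableOn_mild hV hM hf ht).aestronglyMeasurable
    (Eventually.of_forall fun n => integrableOn_mild hV hM (hu n) ht) ?_
  have h2 : Tendsto (fun n => ENNReal.ofReal M *
      eLpNorm (u n - f) 1 (volume.restrict (Set.Ico 0 T))) atTop (𝓝 0) := by
    simpa using ENNReal.Tendsto.const_mul h (Or.inr ENNReal.ofReal_ne_top)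
  refine tendsto_of_tendsto_of_tendsto_of_le_of_le tendsto_const_nhds h2 (fun _ => zero_le)
    fun n => ?_
  refine le_trans ?_ (mul_le_mul_right (eLpNorm_mono_measure _ (Measure.restrict_mono_set _ hsub)) _)
  refine eLpNorm_le_mul_eLpNorm_of_ae_le_mul ?_ 1
  rw [ae_restrict_iff' measurableSet_Ioo]
  refine Eventually.of_forall fun s hs => ?_
  simp only [Pi.sub_apply, ← map_sub]
  exact (V ((t - s : ℝ) : ℂ)).le_of_opNorm_le (hM _ (by linarith [hs.2])) _

/-- Maximal regularity comes with a norm estimate, by the closed graph theorem. -/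
theorem exists_regularity_bound [CompleteSpace X] {p : ℝ} (hp : 1 ≤ p)
    (hV : ContinuousOn (fun s : ℝ => V (s : ℂ)) (Set.Ioi 0))
    (hM : ∀ s : ℝ, 0 < s → ‖V (s : ℂ)‖ ≤ M)
    (hreg : ∀ f : ℝ → X, MemLp f (ENNReal.ofReal p) (volume.restrict (Set.Ico 0 T)) →
      MemSobolevZero p T (mildSolution V f)) :
    ∃ C : ℝ, 0 ≤ C ∧ ∀ f g : ℝ → X,
      MemLp f (ENNReal.ofReal p) (volume.restrict (Set.Ico 0 T)) →
      MemLp g (ENNReal.ofReal p) (volume.restrict (Set.Ico 0 T)) →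
      (∀ t ∈ Set.Ico 0 T, mildSolution V f t = ∫ s in (0 : ℝ)..t, g s) →
      (eLpNorm g (ENNReal.ofReal p) (volume.restrict (Set.Ico 0 T))).toReal ≤
        C * (eLpNorm f (ENNReal.ofReal p) (volume.restrict (Set.Ico 0 T))).toReal := by
  set q := ENNReal.ofReal p with hq
  set μ : Measure ℝ := volume.restrict (Set.Ico 0 T) with hμ
  have hq1 : 1 ≤ q := by rw [hq]; simpa using ENNReal.ofReal_le_ofReal hp
  have : Fact (1 ≤ q) := ⟨hq1⟩
  have hint : ∀ {f : ℝ → X}, MemLp f q μ → IntegrableOn f (Set.Ico 0 T) := fun hf =>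
    memLp_one_iff_integrable.1 (hf.mono_exponent hq1)
  -- `g f` is the derivative of the solution; uniqueness of densities makes the choice linear in
  -- `f`.
  choose g hg hgint using fun f : Lp X q μ => hreg f (Lp.memLp f)
  have huniq : ∀ (f : Lp X q μ) (h : Lp X q μ),
      (∀ t ∈ Set.Ico 0 T, mildSolution V f t = ∫ s in (0 : ℝ)..t, h s) →
      (hg f).toLp (g f) = h := by
    intro f h hh
    refine Lp.ext ((hg f).coeFn_toLp.trans ?_)
    refine ae_eq_of_forall_intervalIntegral_eq (hint (hg f)) (hint (Lp.memLp h)) fun t ht => ?_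
    rw [← hgint f t ht, hh t ht]
  have hspec : ∀ (f : Lp X q μ), ∀ t ∈ Set.Ico 0 T,
      mildSolution V f t = ∫ s in (0 : ℝ)..t, ((hg f).toLp (g f) : ℝ → X) s := by
    intro f t ht
    rw [hgint f t ht]
    exact intervalIntegral_congr_ae_of_mem (hg f).coeFn_toLp.symm ht
  have hii : ∀ (f : Lp X q μ) {t : ℝ}, t ∈ Set.Ico 0 T → IntervalIntegrable f volume 0 t := by
    intro f t ht
    rw [intervalIntegrable_iff_integrableOn_Ico_of_le ht.1]
    exact (hint (Lp.memLp f)).mono_set (Set.Ico_subset_Ico_right ht.2.le)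
  let G : Lp X q μ →ₗ[ℂ] Lp X q μ :=
    { toFun := fun f => (hg f).toLp
      map_add' := fun f f' => by
        refine huniq _ _ fun t ht => ?_
        rw [mildSolution_congr_ae V (Lp.coeFn_add f f') ht,
          intervalIntegral_congr_ae_of_mem (Lp.coeFn_add (hg f).toLp (hg f').toLp) ht,
          mildSolution_add hV hM (hint (Lp.memLp f)) (hint (Lp.memLp f')) ht, hspec f t ht,
          hspec f' t ht]
        exact (intervalIntegral.integral_add (hii _ ht) (hii _ ht)).symm
      map_smul' := fun c f => by
        refine huniq _ _ fun t ht => ?_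
        rw [RingHom.id_apply, mildSolution_congr_ae V (Lp.coeFn_smul c f) ht,
          intervalIntegral_congr_ae_of_mem (Lp.coeFn_smul c (hg f).toLp) ht,
          mildSolution_smul, hspec f t ht]
        exact (intervalIntegral.integral_smul _ _).symm }
  -- The interval has finite measure, so convergence in `L^p` implies convergence in `L^1`.
  have hconv : ∀ (u : ℕ → Lp X q μ) (x : Lp X q μ), Tendsto u atTop (𝓝 x) →
      Tendsto (fun n => eLpNorm ((u n : ℝ → X) - (x : ℝ → X)) 1 μ) atTop (𝓝 0) := by
    intro u x hu
    rw [Lp.tendsto_Lp_iff_tendsto_eLpNorm'] at hu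
    have h2 := ENNReal.Tendsto.mul_const (b := μ Set.univ ^ (1 / (1 : ENNReal).toReal - 1 / q.toReal))
      hu (Or.inr (ENNReal.rpow_ne_top_of_nonneg (by
        rw [hq, ENNReal.toReal_ofReal (by linarith)]
        simp only [ENNReal.toReal_one, div_one, sub_nonneg, one_div]
        exact inv_le_one_of_one_le₀ hp) (measure_ne_top _ _)))
    rw [zero_mul] at h2
    refine tendsto_of_tendsto_of_tendsto_of_le_of_le tendsto_const_nhds h2 (fun _ => zero_le)
      fun n => ?_
    exact eLpNorm_le_eLpNorm_mul_rpow_measure_univ hq1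
      ((Lp.aestronglyMeasurable _).sub (Lp.aestronglyMeasurable _))
  -- Closed graph: both the solution and the primitive at a fixed time are continuous for the `L^1`
  -- norm, so the relation between them passes to the limit.
  have hG : Continuous G := by
    refine G.continuous_of_seq_closed_graph fun u x y hu hGu => ?_
    refine (huniq x y fun t ht => ?_).symm
    have h1 := tendsto_mildSolution hV hM (fun n => hint (Lp.memLp (u n))) (hint (Lp.memLp x))
      (hconv u x hu) ht
    have h2 := tendsto_mildSolution (V := fun _ => ContinuousLinearMap.id ℂ X) (M := 1)
      continuousOn_const (fun _ _ => ContinuousLinearMap.norm_id_le)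
      (fun n => hint (Lp.memLp (G (u n)))) (hint (Lp.memLp y)) (hconv _ y hGu) ht
    refine tendsto_nhds_unique h1 ?_
    have h3 : mildSolution (fun _ => ContinuousLinearMap.id ℂ X) y t = ∫ s in (0 : ℝ)..t, y s := rfl
    rw [← h3]
    refine h2.congr fun n => ?_
    rw [hspec (u n) t ht]
    rfl
  let Gc : Lp X q μ →L[ℂ] Lp X q μ := ⟨G, hG⟩
  refine ⟨‖Gc‖, norm_nonneg _, fun f g' hf hg' hfg => ?_⟩
  have h1 : Gc hf.toLp = hg'.toLp := by
    refine huniq _ _ fun t ht => ?_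
    rw [mildSolution_congr_ae V hf.coeFn_toLp ht,
      intervalIntegral_congr_ae_of_mem hg'.coeFn_toLp ht, hfg t ht]
  have h2 := Gc.le_opNorm hf.toLp
  rwa [h1, Lp.norm_toLp, Lp.norm_toLp] at h2

end RegularityBound

/-! ### Interlacing eigenvalues and frequencies, and the scalar equation. -/

section LacunaryTest

/-- A sequence of continuous unimodular functions on `[0,P]` that are mutually orthogonal. -/
structure IsOrthoUnimodular (P : ℝ) (θ : ℕ → ℝ → ℂ) : Prop where
  continuous : ∀ n, Continuous (θ n)
  norm_eq : ∀ n t, ‖θ n t‖ = 1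
  integral_eq : ∀ m n, m ≠ n → ∫ t in (0 : ℝ)..P, θ m t * starRingEnd ℂ (θ n t) = 0

/-- The eigenvalues of the test operator. -/
def eigSeq (m : ℕ) : ℝ := 2 ^ (2 * m) ^ 2

/-- The frequencies, interlacing with the eigenvalues, before normalisation. -/
def freqSeq (n : ℕ) : ℕ := 2 ^ (2 * n + 1) ^ 2

theorem eigSeq_pos (m : ℕ) : 0 < eigSeq m := by unfold eigSeq; positivity

theorem eigSeq_mono : Monotone eigSeq := by
  intro m n h
  unfold eigSeq
  gcongr
  norm_num

theorem le_eigSeq (m : ℕ) : (m : ℝ) ≤ eigSeq m := by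
  have h1 : m ≤ 2 ^ (2 * m) ^ 2 := by
    refine Nat.lt_two_pow_self.le.trans (Nat.pow_le_pow_right (by norm_num) ?_)
    nlinarith
  unfold eigSeq
  exact_mod_cast h1

theorem freqSeq_injective : Function.Injective freqSeq := by
  intro m n h
  have h1 := Nat.pow_right_injective (le_refl 2) h
  have h2 : 2 * m + 1 = 2 * n + 1 := Nat.pow_left_injective (n := 2) (by norm_num) h1
  omega

/-- The exponents are consecutive squares, whose gaps exceed `m + n`. This and the next bound make
the errors summable in both indices at once. -/
theorem eigSeq_div_freqSeq_le {m n : ℕ} (h : m ≤ n) :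
    eigSeq m / freqSeq n ≤ (1 / 2) ^ m * (1 / 2) ^ n := by
  unfold eigSeq freqSeq
  rw [← pow_add, one_div, inv_pow, div_le_iff₀ (by positivity), inv_mul_eq_div,
    le_div_iff₀ (by positivity), ← pow_add]
  push_cast
  refine pow_le_pow_right₀ (by norm_num) ?_
  nlinarith

theorem freqSeq_div_eigSeq_le {m n : ℕ} (h : n < m) :
    freqSeq n / eigSeq m ≤ (1 / 2) ^ m * (1 / 2) ^ n := by
  unfold eigSeq freqSeq
  rw [← pow_add, one_div, inv_pow, div_le_iff₀ (by positivity), inv_mul_eq_div,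
    le_div_iff₀ (by positivity)]
  push_cast
  rw [← pow_add]
  refine pow_le_pow_right₀ (by norm_num) ?_
  nlinarith

/-- The lacunary frequencies of period `P`. -/
def freq (P : ℝ) (n : ℕ) : ℝ := 2 * Real.pi * freqSeq n / P

/-- The lacunary characters of period `P`. -/
def lacunary (P : ℝ) (n : ℕ) (t : ℝ) : ℂ := Complex.exp (Complex.I * freq P n * t)

theorem continuous_lacunary (P : ℝ) (n : ℕ) : Continuous (lacunary P n) := by
  unfold lacunary; fun_prop

theorem norm_lacunary (P : ℝ) (n : ℕ) (t : ℝ) : ‖lacunary P n t‖ = 1 := by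
  rw [lacunary, show Complex.I * freq P n * t = ((freq P n * t : ℝ) : ℂ) * Complex.I by
    push_cast; ring]
  exact Complex.norm_exp_ofReal_mul_I _

theorem lacunary_periodic {P : ℝ} (hP : 0 < P) (n : ℕ) : Function.Periodic (lacunary P n) P := by
  intro t
  unfold lacunary
  rw [Complex.exp_eq_exp_iff_exists_int]
  refine ⟨freqSeq n, ?_⟩
  have : (P : ℂ) ≠ 0 := by exact_mod_cast hP.ne'
  unfold freq
  push_cast
  field_simp

theorem isOrthoUnimodular_lacunary {P : ℝ} (hP : 0 < P) :
    IsOrthoUnimodular P (lacunary P) := by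
  refine ⟨continuous_lacunary P, norm_lacunary P, fun m n hmn => ?_⟩
  have hPc : (P : ℂ) ≠ 0 := by exact_mod_cast hP.ne'
  set c : ℂ := Complex.I * (freq P m - freq P n) with hc
  have h1 : ∀ t : ℝ, lacunary P m t * starRingEnd ℂ (lacunary P n t) = Complex.exp (c * t) := by
    intro t
    unfold lacunary
    rw [← Complex.exp_conj, ← Complex.exp_add]
    congr 1
    simp only [map_mul, Complex.conj_I, Complex.conj_ofReal, hc]
    ring
  have hne : c ≠ 0 := by
    refine mul_ne_zero Complex.I_ne_zero (sub_ne_zero.2 ?_)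
    intro h
    have h2 : freq P m = freq P n := by exact_mod_cast h
    unfold freq at h2
    have hpi := Real.pi_pos
    field_simp at h2
    exact hmn (freqSeq_injective (by exact_mod_cast h2))
  simp only [h1]
  rw [integral_exp_mul_complex hne]
  have h3 : Complex.exp (c * P) = 1 := by
    rw [Complex.exp_eq_one_iff]
    refine ⟨(freqSeq m : ℤ) - freqSeq n, ?_⟩
    rw [hc]
    unfold freq
    push_cast
    field_simp
  simp [h3]

/-- The coefficient function of `u'` for the scalar equation `u' + a u = exp (i β t)`. -/
def regCoeff (a β : ℝ) (s : ℝ) : ℂ :=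
  (Complex.I * β * Complex.exp (Complex.I * β * s) + a * Complex.exp (-s * a)) /
    (a + Complex.I * β)

theorem continuous_regCoeff (a β : ℝ) : Continuous (regCoeff a β) := by
  unfold regCoeff; fun_prop

theorem le_norm_add_I_mul (a β : ℝ) :
    |a| ≤ ‖(a : ℂ) + Complex.I * β‖ ∧ |β| ≤ ‖(a : ℂ) + Complex.I * β‖ := by
  constructor
  · simpa using Complex.abs_re_le_norm ((a : ℂ) + Complex.I * β)
  · simpa using Complex.abs_im_le_norm ((a : ℂ) + Complex.I * β)

/-- Both integrands have explicit primitives, and both integrals equal `(exp (iβt) - exp (-ta)) / (a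
+ iβ)`. -/
theorem integral_exp_mul_exp_eq {a : ℝ} (ha : 0 < a) (β t : ℝ) :
    ∫ s in (0 : ℝ)..t, Complex.exp (Complex.I * β * s) * Complex.exp (-((t - s : ℝ) : ℂ) * a) =
      ∫ s in (0 : ℝ)..t, regCoeff a β s := by
  have hne : (a : ℂ) + Complex.I * β ≠ 0 := by
    intro h
    have := (le_norm_add_I_mul a β).1
    rw [h, norm_zero, abs_of_pos ha] at this
    linarith
  have hid : ∀ s : ℝ, HasDerivAt (fun s : ℝ => (s : ℂ)) 1 s := fun s =>
    (hasDerivAt_id s).ofReal_comp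
  have d1 : ∀ s : ℝ, HasDerivAt (fun s : ℝ => Complex.exp (Complex.I * β * s) *
      Complex.exp (-((t - s : ℝ) : ℂ) * a) / (a + Complex.I * β))
      (Complex.exp (Complex.I * β * s) * Complex.exp (-((t - s : ℝ) : ℂ) * a)) s := by
    intro s
    have e1 := ((hid s).const_mul (Complex.I * β)).cexp
    have e2 := (((((hasDerivAt_id s).const_sub t).ofReal_comp).neg).mul_const (a : ℂ)).cexp
    refine ((e1.mul e2).div_const _).congr_deriv ?_
    field_simp
    simp
    ring_nf
  have d2 : ∀ s : ℝ, HasDerivAt (fun s : ℝ => (Complex.exp (Complex.I * β * s) -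
      Complex.exp (-(s : ℂ) * a)) / (a + Complex.I * β)) (regCoeff a β s) s := by
    intro s
    have e1 := ((hid s).const_mul (Complex.I * β)).cexp
    have e2 := (((hid s).neg).mul_const (a : ℂ)).cexp
    refine ((e1.sub e2).div_const _).congr_deriv ?_
    unfold regCoeff
    simp only [Pi.neg_apply]
    congr 1
    ring
  rw [intervalIntegral.integral_eq_sub_of_hasDerivAt (fun s _ => d1 s)
      (Continuous.intervalIntegrable (by fun_prop) _ _),
    intervalIntegral.integral_eq_sub_of_hasDerivAt (fun s _ => d2 s)
      ((continuous_regCoeff a β).intervalIntegrable _ _)]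
  simp
  ring

/-- The stationary factor `iβ/(a+iβ)` is near 1 when `a` is far below `β` and near 0 when it is far
above. In the second case the transient `a exp (-ta)` need not be small near time 0; from time `P`
on it is at most `1 / P`. -/
theorem norm_regCoeff_sub_le {P : ℝ} (hP : 0 < P) (m n : ℕ) {t : ℝ} (ht : P ≤ t) :
    ‖regCoeff (eigSeq m) (freq P n) t - (if m ≤ n then lacunary P n t else 0)‖ ≤
      (P + 8 / P) * ((1 / 2) ^ m * (1 / 2) ^ n) := by
  set a := eigSeq m with ha
  set β := freq P n with hβ
  have ha0 : 0 < a := eigSeq_pos m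
  have hb0 : (0 : ℝ) < freqSeq n := by unfold freqSeq; positivity
  have hβ0 : 0 < β := by rw [hβ]; unfold freq; have := Real.pi_pos; positivity
  obtain ⟨h1, h2⟩ := le_norm_add_I_mul a β
  rw [abs_of_pos ha0] at h1
  rw [abs_of_pos hβ0] at h2
  have hD : 0 < ‖(a : ℂ) + Complex.I * β‖ := ha0.trans_le h1
  have hne : (a : ℂ) + Complex.I * β ≠ 0 := norm_pos_iff.1 hD
  have hl : lacunary P n t = Complex.exp (Complex.I * β * t) := rfl
  have hl1 : ‖Complex.exp (Complex.I * β * t)‖ = 1 := norm_lacunary P n t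
  have he : ‖Complex.exp (-(t : ℂ) * a)‖ = Real.exp (-t * a) := by
    rw [norm_exp_neg_mul]; simp
  have ht0 : 0 < t := hP.trans_le ht
  have hpow : (0 : ℝ) ≤ (1 / 2) ^ m * (1 / 2) ^ n := by positivity
  split_ifs with hmn
  · have h3 : regCoeff a β t - lacunary P n t =
        a * (Complex.exp (-(t : ℂ) * a) - Complex.exp (Complex.I * β * t)) /
          (a + Complex.I * β) := by
      rw [hl, regCoeff]
      field_simp
      ring
    have h4 : ‖Complex.exp (-(t : ℂ) * a) - Complex.exp (Complex.I * β * t)‖ ≤ 2 := by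
      refine (norm_sub_le _ _).trans ?_
      rw [hl1, he]
      have : Real.exp (-t * a) ≤ 1 := Real.exp_le_one_iff.2 (by nlinarith)
      linarith
    rw [h3, norm_div, norm_mul, Complex.norm_real, Real.norm_of_nonneg ha0.le]
    calc a * ‖Complex.exp (-(t : ℂ) * a) - Complex.exp (Complex.I * β * t)‖ /
          ‖(a : ℂ) + Complex.I * β‖ ≤ a * 2 / β := by gcongr
      _ = P / Real.pi * (a / freqSeq n) := by
          rw [hβ]; unfold freq; have := Real.pi_pos; field_simp
      _ ≤ P * ((1 / 2) ^ m * (1 / 2) ^ n) := by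
          refine mul_le_mul ?_ (eigSeq_div_freqSeq_le hmn) (by positivity) hP.le
          exact div_le_self hP.le (by linarith [Real.pi_gt_three])
      _ ≤ _ := by
          refine mul_le_mul_of_nonneg_right ?_ hpow
          have : 0 < 8 / P := by positivity
          linarith
  · rw [sub_zero, regCoeff, norm_div]
    have h5 : Real.exp (-t * a) ≤ 1 / (P * a) := by
      rw [show -t * a = -(t * a) by ring, Real.exp_neg, one_div]
      refine inv_anti₀ (by positivity) ?_
      have := Real.add_one_le_exp (t * a)
      nlinarith
    have h6 : ‖Complex.I * β * Complex.exp (Complex.I * β * t) + a * Complex.exp (-(t : ℂ) * a)‖ ≤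
        β + 1 / P := by
      refine (norm_add_le _ _).trans ?_
      rw [norm_mul, norm_mul, norm_mul, hl1, he, Complex.norm_I, Complex.norm_real,
        Complex.norm_real, Real.norm_of_nonneg ha0.le, Real.norm_of_nonneg hβ0.le, one_mul, mul_one]
      have : a * Real.exp (-t * a) ≤ a * (1 / (P * a)) := by gcongr
      have h7 : a * (1 / (P * a)) = 1 / P := by field_simp
      linarith
    have h8 : (1 : ℝ) ≤ freqSeq n := by exact_mod_cast Nat.one_le_two_pow
    calc _ ≤ (β + 1 / P) / a := by gcongr
      _ ≤ (8 / P * freqSeq n) / a := by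
          -- Since `β = 2π freqSeq n / P` and `freqSeq n ≥ 1`, the numerator is at most `(2π + 1)
          -- freqSeq n / P`, and `2π + 1 ≤ 8`.
          refine div_le_div_of_nonneg_right ?_ ha0.le
          rw [hβ]; unfold freq
          rw [← add_div, div_mul_eq_mul_div]
          refine div_le_div_of_nonneg_right ?_ hP.le
          nlinarith [Real.pi_lt_d2]
      _ = 8 / P * (freqSeq n / a) := by ring
      _ ≤ 8 / P * ((1 / 2) ^ m * (1 / 2) ^ n) := by
          gcongr
          exact freqSeq_div_eigSeq_le (not_le.1 hmn)
      _ ≤ _ := by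
          refine mul_le_mul_of_nonneg_right ?_ hpow
          linarith

end LacunaryTest

/-! ### The randomised estimate for a projection chain. -/

section LacunaryEstimate

/-- The vector `x n` is recovered as a Fourier coefficient, by integrating against the conjugate of
`θ n`. -/
theorem IsOrthoUnimodular.norm_coeff_le [CompleteSpace X] {P : ℝ} (hP : 0 < P) {θ : ℕ → ℝ → ℂ}
    (hθ : IsOrthoUnimodular P θ) (s : Finset ℕ) (x : ℕ → X) {n : ℕ} (hn : n ∈ s) :
    ‖x n‖ ≤ P⁻¹ * ∫ t in (0 : ℝ)..P, ‖∑ k ∈ s, θ k t • x k‖ := by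
  have hc := hθ.continuous
  have h1 : ∫ t in (0 : ℝ)..P, starRingEnd ℂ (θ n t) • ∑ k ∈ s, θ k t • x k = (P : ℂ) • x n := by
    simp only [Finset.smul_sum, smul_smul]
    rw [intervalIntegral.integral_finsetSum fun k _ => Continuous.intervalIntegrable (by
      have := hc k
      have := hc n
      fun_prop) _ _]
    rw [Finset.sum_eq_single n]
    · rw [intervalIntegral.integral_smul_const]
      congr 1
      have : ∀ t, starRingEnd ℂ (θ n t) * θ n t = 1 := fun t => by
        rw [mul_comm, Complex.mul_conj, Complex.normSq_eq_norm_sq, hθ.norm_eq]; simp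
      simp [this]
    · intro k _ hk
      rw [intervalIntegral.integral_smul_const]
      simp only [mul_comm (starRingEnd ℂ (θ n _))]
      rw [hθ.integral_eq k n hk, zero_smul]
    · exact fun h => absurd hn h
  have h2 : ‖(P : ℂ) • x n‖ ≤ ∫ t in (0 : ℝ)..P, ‖∑ k ∈ s, θ k t • x k‖ := by
    rw [← h1]
    refine intervalIntegral.norm_integral_le_of_norm_le hP.le (Eventually.of_forall fun t _ => ?_)
      (Continuous.intervalIntegrable (by fun_prop) _ _)
    rw [norm_smul, RCLike.norm_conj, hθ.norm_eq, one_mul]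
  rw [norm_smul, Complex.norm_real, Real.norm_of_nonneg hP.le] at h2
  rw [inv_mul_eq_div, le_div_iff₀ hP]
  linarith

theorem rpow_average_le {P p : ℝ} (hP : 0 < P) (hp : 1 ≤ p) {g : ℝ → ℝ} (hg : Continuous g)
    (hg0 : ∀ t, 0 ≤ g t) :
    (P⁻¹ * ∫ t in (0 : ℝ)..P, g t) ^ p ≤ P⁻¹ * ∫ t in (0 : ℝ)..P, g t ^ p := by
  have hgp : Continuous fun t => g t ^ p := hg.rpow_const fun _ => Or.inr (by linarith)
  have h := (convexOn_rpow hp).map_set_average_le (μ := volume) (t := Set.Ioc 0 P) (f := g)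
    (Real.continuous_rpow_const (by linarith)).continuousOn isClosed_Ici
    (by simp [hP]) (by simp) (Eventually.of_forall hg0)
    (hg.integrableOn_Ioc) hgp.integrableOn_Ioc
  rw [setAverage_eq, setAverage_eq] at h
  simpa [intervalIntegral.integral_of_le hP.le, hP.le] using h

theorem add_rpow_le_two_rpow_mul {x y p : ℝ} (hx : 0 ≤ x) (hy : 0 ≤ y) (hp : 0 ≤ p) :
    (x + y) ^ p ≤ 2 ^ p * (x ^ p + y ^ p) := by
  have h1 : (x + y) ^ p ≤ (2 * max x y) ^ p :=
    Real.rpow_le_rpow (by positivity) (by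
      have := le_max_left x y
      have := le_max_right x y
      linarith) hp
  rw [Real.mul_rpow (by norm_num) (hx.trans (le_max_left _ _))] at h1
  refine h1.trans (mul_le_mul_of_nonneg_left ?_ (by positivity))
  rcases le_total x y with h | h
  · rw [max_eq_right h]
    have := Real.rpow_nonneg hx p
    linarith
  · rw [max_eq_left h]
    have := Real.rpow_nonneg hy p
    linarith

theorem memLp_of_continuous {E : Type*} [NormedAddCommGroup E] {f : ℝ → E} (hf : Continuous f) (p : ENNReal) (T : ℝ) :
    MemLp f p (volume.restrict (Set.Ico 0 T)) := by
  obtain ⟨C, hC⟩ := isCompact_Icc.exists_bound_of_continuousOn (s := Set.Icc 0 T) hf.continuousOn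
  refine MemLp.of_bound hf.aestronglyMeasurable C ?_
  rw [ae_restrict_iff' measurableSet_Ico]
  exact Eventually.of_forall fun t ht => hC t ⟨ht.1, ht.2.le⟩

theorem toReal_eLpNorm_rpow {E : Type*} [NormedAddCommGroup E] {f : ℝ → E} (hf : Continuous f) {p T : ℝ} (hp : 0 < p) (hT : 0 ≤ T) :
    (eLpNorm f (ENNReal.ofReal p) (volume.restrict (Set.Ico 0 T))).toReal ^ p =
      ∫ t in (0 : ℝ)..T, ‖f t‖ ^ p := by
  have hint : 0 ≤ ∫ t in Set.Ioo 0 T, ‖f t‖ ^ p :=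
    integral_nonneg fun t => Real.rpow_nonneg (norm_nonneg _) _
  rw [(memLp_of_continuous hf _ T).eLpNorm_eq_integral_rpow_norm (by simpa using hp) (by simp),
    ENNReal.toReal_ofReal hp.le, integral_Ico_eq_integral_Ioo,
    ENNReal.toReal_ofReal (by positivity), ← Real.rpow_mul hint, inv_mul_cancel₀ hp.ne',
    Real.rpow_one, intervalIntegral.integral_of_le hT, integral_Ioc_eq_integral_Ioo]

theorem sum_half_pow_le (s : Finset ℕ) : ∑ n ∈ s, (1 / 2 : ℝ) ^ n ≤ 2 := by
  have h := summable_geometric_two.sum_le_tsum s fun _ _ => by positivity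
  rwa [tsum_geometric_two] at h

/-- Expanding `S n` into differences leaves an error for each pair `(m, n)`. The two geometric
series give `2 * 2` and the norm of a difference gives `2 * M`, hence `8 * M`. -/
theorem norm_regular_part_sub_le {S : ℕ → X →L[ℂ] X} {M : ℝ} (hM : ∀ n, ‖S n‖ ≤ M)
    {P : ℝ} (hP : 0 < P) (s : Finset ℕ) (x : ℕ → X) {K : ℕ} (hK : ∀ n ∈ s, n ≤ K)
    {R : ℝ} (hR : ∀ n ∈ s, ‖x n‖ ≤ R) (hR0 : 0 ≤ R) {t : ℝ} (ht : P ≤ t) :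
    ‖∑ n ∈ s, lacunary P n t • S n (x n) - ∑ n ∈ s, ∑ m ∈ Finset.range (K + 1),
        regCoeff (eigSeq m) (freq P n) t • chainDiff S m (x n)‖ ≤
      8 * M * (P + 8 / P) * R := by
  have hM0 : 0 ≤ M := (norm_nonneg _).trans (hM 0)
  have h1 : ∀ n ∈ s, lacunary P n t • S n (x n) = ∑ m ∈ Finset.range (K + 1),
      (if m ≤ n then lacunary P n t else 0) • chainDiff S m (x n) := by
    intro n hn
    rw [← sum_chainDiff, Finset.smul_sum]
    simp only [ite_smul, zero_smul]
    rw [← Finset.sum_filter]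
    refine Finset.sum_congr ?_ fun _ _ => rfl
    ext m
    have := hK n hn
    simp only [Finset.mem_range, Finset.mem_filter]
    omega
  rw [Finset.sum_congr rfl h1, ← Finset.sum_sub_distrib]
  have hc0 : 0 ≤ P + 8 / P := by positivity
  calc _ ≤ ∑ n ∈ s, ∑ m ∈ Finset.range (K + 1),
        (P + 8 / P) * ((1 / 2) ^ m * (1 / 2) ^ n) * (2 * M * R) := by
        refine norm_sum_le_of_le _ fun n hn => ?_
        rw [← Finset.sum_sub_distrib]
        refine norm_sum_le_of_le _ fun m _ => ?_
        rw [← sub_smul, norm_smul, norm_sub_rev]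
        refine mul_le_mul (norm_regCoeff_sub_le hP m n ht) ?_ (norm_nonneg _) (by positivity)
        refine ((chainDiff S m).le_of_opNorm_le (norm_chainDiff_le hM m) _).trans ?_
        exact mul_le_mul_of_nonneg_left (hR n hn) (by positivity)
    _ = (P + 8 / P) * (2 * M * R) * ((∑ n ∈ s, (1 / 2) ^ n) *
          ∑ m ∈ Finset.range (K + 1), (1 / 2) ^ m) := by
        rw [Finset.sum_mul_sum, Finset.mul_sum]
        refine Finset.sum_congr rfl fun n _ => ?_
        rw [Finset.mul_sum]
        refine Finset.sum_congr rfl fun m _ => ?_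
        ring
    _ ≤ (P + 8 / P) * (2 * M * R) * (2 * 2) := by
        refine mul_le_mul_of_nonneg_left ?_ (by positivity)
        exact mul_le_mul (sum_half_pow_le _) (sum_half_pow_le _)
          (Finset.sum_nonneg fun _ _ => by positivity) (by norm_num)
    _ = _ := by ring

variable [CompleteSpace X] {S : ℕ → X →L[ℂ] X}

/-- The vectors lie in the range of `S K`, where the semigroup is diagonal with finitely many
eigenvalues, so the equation splits into scalar ones. -/
theorem mildSolution_lacunary (hS : IsProjectionChain S) {P : ℝ} (s : Finset ℕ) (x : ℕ → X)
    {K : ℕ} (hx : ∀ n ∈ s, S K (x n) = x n) {t : ℝ} (ht : 0 ≤ t) :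
    mildSolution (chainSemigroup eigSeq S) (fun r => ∑ n ∈ s, lacunary P n r • x n) t =
      ∫ r in (0 : ℝ)..t, ∑ n ∈ s, ∑ m ∈ Finset.range (K + 1),
        regCoeff (eigSeq m) (freq P n) r • chainDiff S m (x n) := by
  have h1 : ∀ r ∈ Set.uIcc 0 t, chainSemigroup eigSeq S ((t - r : ℝ) : ℂ)
      (∑ n ∈ s, lacunary P n r • x n) = ∑ n ∈ s, ∑ m ∈ Finset.range (K + 1),
        (Complex.exp (Complex.I * freq P n * r) *
          Complex.exp (-((t - r : ℝ) : ℂ) * eigSeq m)) • chainDiff S m (x n) := by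
    intro r hr
    rw [Set.uIcc_of_le ht] at hr
    rw [map_sum]
    refine Finset.sum_congr rfl fun n hn => ?_
    conv_lhs => rw [← hx n hn, ← sum_chainDiff, map_smul, map_sum, Finset.smul_sum]
    refine Finset.sum_congr rfl fun m _ => ?_
    rw [chainSemigroup_chainDiff hS eigSeq_mono le_eigSeq, smul_smul]
    · rfl
    · rcases hr.2.eq_or_lt with h | h
      · right; simp [h]
      · left; simpa using h
  rw [mildSolution, intervalIntegral.integral_congr h1]
  rw [intervalIntegral.integral_finsetSum fun n _ => Continuous.intervalIntegrable (by fun_prop) _ _,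
    intervalIntegral.integral_finsetSum fun n _ => Continuous.intervalIntegrable (by
      have := fun m => continuous_regCoeff (eigSeq m) (freq P n)
      fun_prop) _ _]
  refine Finset.sum_congr rfl fun n _ => ?_
  rw [intervalIntegral.integral_finsetSum fun n _ => Continuous.intervalIntegrable (by fun_prop) _ _,
    intervalIntegral.integral_finsetSum fun m _ => Continuous.intervalIntegrable (by
      have := continuous_regCoeff (eigSeq m) (freq P n)
      fun_prop) _ _]
  refine Finset.sum_congr rfl fun m _ => ?_
  rw [intervalIntegral.integral_smul_const, intervalIntegral.integral_smul_const,
    integral_exp_mul_exp_eq (eigSeq_pos m)]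

/-- Under (MRP), the members of a projection chain satisfy a randomised boundedness estimate with
respect to some sequence of mutually orthogonal unimodular functions. -/
theorem HasMRP.exists_chain_estimate (hX : HasMRP X) (hS : IsProjectionChain S) :
    ∃ (p P C : ℝ) (θ : ℕ → ℝ → ℂ), 1 < p ∧ 0 < P ∧ 0 ≤ C ∧ IsOrthoUnimodular P θ ∧
      ∀ (s : Finset ℕ) (x : ℕ → X),
        ∫ t in (0 : ℝ)..P, ‖∑ n ∈ s, θ n t • S n (x n)‖ ^ p ≤
          C * ∫ t in (0 : ℝ)..P, ‖∑ n ∈ s, θ n t • x n‖ ^ p := by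
  obtain ⟨M, hM1, hM⟩ := hS.exists_bound
  have hM0 : 0 ≤ M := by linarith
  set V := chainSemigroup eigSeq S with hVdef
  have hsg : IsSemigroupOf V (-generator V) :=
    ⟨isBoundedAnalyticSemigroup_chainSemigroup hS eigSeq_mono le_eigSeq, (neg_neg _).symm⟩
  obtain ⟨p, T, hp, hT, hreg⟩ := hX _ ⟨V, hsg⟩
  have hp0 : 0 < p := by linarith
  have hsec : ∀ r : ℝ, 0 < r → (r : ℂ) ∈ sector (Real.pi / 3) := fun r hr => by
    refine ⟨by exact_mod_cast hr.ne', ?_⟩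
    rw [Complex.arg_ofReal_of_nonneg hr.le]
    simp [Real.pi_pos]
  obtain ⟨C, hC0, hC⟩ := exists_regularity_bound hp.le (V := V) (M := 2 * M) (T := T)
    (fun r hr => by
      have h1 := (differentiableAt_chainSemigroup hS eigSeq_mono le_eigSeq (z := (r : ℂ))
        (by simpa using hr)).continuousAt
      exact (h1.comp Complex.continuous_ofReal.continuousAt).continuousWithinAt)
    (fun r hr => norm_chainSemigroup_le hS eigSeq_mono le_eigSeq hM (hsec r hr))
    (hreg V hsg)
  -- The interval consists of two periods. The first lets the transients die out and the comparison
  -- takes place on the second; periodicity then carries it back to `[0, P]`.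
  set P := T / 2 with hPdef
  have hP : 0 < P := by positivity
  have hT2 : T = P + P := by rw [hPdef]; ring
  set D := 8 * M * (P + 8 / P) with hD
  have hD0 : 0 ≤ D := by positivity
  have hθ := isOrthoUnimodular_lacunary hP
  have hcl := continuous_lacunary P
  have main : ∀ (s : Finset ℕ) (x : ℕ → X) (K : ℕ), (∀ n ∈ s, n ≤ K) →
      (∀ n ∈ s, S K (x n) = x n) →
        ∫ t in (0 : ℝ)..P, ‖∑ n ∈ s, lacunary P n t • S n (x n)‖ ^ p ≤
          (2 ^ p * (2 * C ^ p + D ^ p)) *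
            ∫ t in (0 : ℝ)..P, ‖∑ n ∈ s, lacunary P n t • x n‖ ^ p := by
    intro s x K hK hx
    set f : ℝ → X := fun t => ∑ n ∈ s, lacunary P n t • x n with hf
    set k : ℝ → X := fun t => ∑ n ∈ s, lacunary P n t • S n (x n) with hk
    set h : ℝ → X := fun t => ∑ n ∈ s, ∑ m ∈ Finset.range (K + 1),
        regCoeff (eigSeq m) (freq P n) t • chainDiff S m (x n) with hh
    have hfc : Continuous f := by rw [hf]; fun_prop
    have hkc : Continuous k := by rw [hk]; fun_prop
    have hhc : Continuous h := by
      have := fun m n => continuous_regCoeff (eigSeq m) (freq P n)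
      rw [hh]; fun_prop
    have hpc : ∀ {g : ℝ → X}, Continuous g → Continuous fun t => ‖g t‖ ^ p := fun hg =>
      hg.norm.rpow_const fun _ => Or.inr hp0.le
    have hfper : Function.Periodic f P := fun t => by
      simp only [hf, (lacunary_periodic hP _) t]
    have hkper : Function.Periodic k P := fun t => by
      simp only [hk, (lacunary_periodic hP _) t]
    have hI : ∀ {g : ℝ → X}, Function.Periodic g P →
        ∫ t in P..(P + P), ‖g t‖ ^ p = ∫ t in (0 : ℝ)..P, ‖g t‖ ^ p := by
      intro g hg
      have : Function.Periodic (fun t => ‖g t‖ ^ p) P := fun t => by simp only [hg t]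
      simpa using this.intervalIntegral_add_eq P 0
    set A := ∫ t in (0 : ℝ)..P, ‖f t‖ ^ p with hA
    have hA0 : 0 ≤ A := intervalIntegral.integral_nonneg hP.le fun t _ => by positivity
    have hsplit : ∀ {g : ℝ → X}, Continuous g →
        (∫ t in (0 : ℝ)..P, ‖g t‖ ^ p) + ∫ t in P..(P + P), ‖g t‖ ^ p =
          ∫ t in (0 : ℝ)..T, ‖g t‖ ^ p := by
      intro g hg
      rw [hT2]
      exact intervalIntegral.integral_add_adjacent_intervals ((hpc hg).intervalIntegrable _ _)
        ((hpc hg).intervalIntegrable _ _)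
    have h1 : ∫ t in (0 : ℝ)..T, ‖h t‖ ^ p ≤ C ^ p * (2 * A) := by
      have e1 := hC f h (memLp_of_continuous hfc _ _) (memLp_of_continuous hhc _ _)
        fun t ht => mildSolution_lacunary hS s x hx ht.1
      have e2 := Real.rpow_le_rpow ENNReal.toReal_nonneg e1 hp0.le
      rw [Real.mul_rpow hC0 ENNReal.toReal_nonneg, toReal_eLpNorm_rpow hhc hp0 hT.le,
        toReal_eLpNorm_rpow hfc hp0 hT.le, ← hsplit hfc, hI hfper] at e2
      rwa [two_mul]
    have h2 : ∫ t in P..(P + P), ‖h t‖ ^ p ≤ C ^ p * (2 * A) := by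
      refine le_trans ?_ h1
      rw [← hsplit hhc]
      have : 0 ≤ ∫ t in (0 : ℝ)..P, ‖h t‖ ^ p :=
        intervalIntegral.integral_nonneg hP.le fun t _ => by positivity
      linarith
    -- The mean of `‖f‖` dominates every coefficient, and by Jensen its `p`-th power is absorbed by
    -- the `p`-th mean. So the error of the approximation is controlled by `f` itself.
    set R := P⁻¹ * ∫ t in (0 : ℝ)..P, ‖f t‖ with hR
    have hR0 : 0 ≤ R := by
      have : 0 ≤ ∫ t in (0 : ℝ)..P, ‖f t‖ :=
        intervalIntegral.integral_nonneg hP.le fun t _ => norm_nonneg _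
      positivity
    have hRp : R ^ p ≤ P⁻¹ * A := rpow_average_le hP hp.le hfc.norm fun t => norm_nonneg _
    have hRx : ∀ n ∈ s, ‖x n‖ ≤ R := fun n hn => hθ.norm_coeff_le hP s x hn
    have h3 : ∫ t in P..(P + P), ‖k t‖ ^ p ≤
        ∫ t in P..(P + P), 2 ^ p * (‖h t‖ ^ p + (D * R) ^ p) := by
      refine intervalIntegral.integral_mono_on (by linarith) ((hpc hkc).intervalIntegrable _ _)
        (Continuous.intervalIntegrable (by have := hpc hhc; fun_prop) _ _) fun t ht => ?_
      have e1 := norm_regular_part_sub_le hM hP s x hK hRx hR0 ht.1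
      have e2 : ‖k t‖ ≤ ‖h t‖ + D * R := by
        have : k t = h t + (k t - h t) := by abel
        rw [this]
        exact (norm_add_le _ _).trans (by gcongr)
      exact (Real.rpow_le_rpow (norm_nonneg _) e2 hp0.le).trans
        (add_rpow_le_two_rpow_mul (norm_nonneg _) (by positivity) hp0.le)
    rw [← hI hkper]
    refine h3.trans ?_
    rw [intervalIntegral.integral_const_mul, intervalIntegral.integral_add
      ((hpc hhc).intervalIntegrable _ _) intervalIntegrable_const, intervalIntegral.integral_const,
      Real.mul_rpow hD0 hR0, mul_assoc (2 ^ p : ℝ)]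
    refine mul_le_mul_of_nonneg_left ?_ (by positivity)
    have e3 : (P + P - P) • (D ^ p * R ^ p) ≤ D ^ p * A := by
      rw [smul_eq_mul, add_sub_cancel_right]
      calc P * (D ^ p * R ^ p) = D ^ p * (P * R ^ p) := by ring
        _ ≤ D ^ p * (P * (P⁻¹ * A)) := by gcongr
        _ = D ^ p * A := by field_simp
    nlinarith
  refine ⟨p, P, (2 ^ p * (2 * C ^ p + D ^ p)) * M ^ p, lacunary P, hp, hP, by positivity, hθ,
    fun s x => ?_⟩
  obtain ⟨K, hK⟩ : ∃ K, ∀ n ∈ s, n ≤ K := ⟨s.sup id, fun n hn => Finset.le_sup (f := id) hn⟩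
  -- General vectors are first projected by `S K`. This leaves the left side unchanged, as `S n ∘ S
  -- K = S n` for `n ≤ K`, and costs `M ^ p` on the right.
  have h1 := main s (fun n => S K (x n)) K hK fun n _ => by rw [hS.apply_apply, min_self]
  have h2 : ∀ t, ∑ n ∈ s, lacunary P n t • S n (S K (x n)) = ∑ n ∈ s, lacunary P n t • S n (x n) :=
    fun t => Finset.sum_congr rfl fun n hn => by rw [hS.apply_apply, min_eq_left (hK n hn)]
  have h3 : ∫ t in (0 : ℝ)..P, ‖∑ n ∈ s, lacunary P n t • S K (x n)‖ ^ p ≤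
      ∫ t in (0 : ℝ)..P, M ^ p * ‖∑ n ∈ s, lacunary P n t • x n‖ ^ p := by
    have hpc : ∀ {g : ℝ → X}, Continuous g → Continuous fun t => ‖g t‖ ^ p := fun hg =>
      hg.norm.rpow_const fun _ => Or.inr hp0.le
    have c1 := hpc (g := fun t => ∑ n ∈ s, lacunary P n t • x n) (by fun_prop)
    refine intervalIntegral.integral_mono_on hP.le
      ((hpc (by fun_prop)).intervalIntegrable _ _)
      (Continuous.intervalIntegrable (by fun_prop) _ _) fun t _ => ?_
    rw [← Real.mul_rpow hM0 (norm_nonneg _)]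
    refine Real.rpow_le_rpow (norm_nonneg _) ?_ hp0.le
    have : ∑ n ∈ s, lacunary P n t • S K (x n) = S K (∑ n ∈ s, lacunary P n t • x n) := by
      simp
    rw [this]
    exact (S K).le_of_opNorm_le (hM K) _
  rw [intervalIntegral.integral_const_mul] at h3
  simp only [h2] at h1
  refine h1.trans ?_
  rw [mul_assoc _ (M ^ p)]
  exact mul_le_mul_of_nonneg_left h3 (by positivity)

end LacunaryEstimate

/-! ### Concatenation of finite chains, for uniform constants. -/

section BlockChains

/-- A commuting increasing sequence of projections, bounded by `M`, that live on the coordinates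
in the finite set `B`. -/
structure IsBlockChain (E : ℕ → X →L[ℂ] X) (M : ℝ) (B : Finset ℕ) (T : ℕ → X →L[ℂ] X) : Prop where
  apply_apply : ∀ i j x, T i (T j x) = T (min i j) x
  block_left : ∀ j x, blockProj E B (T j x) = T j x
  block_right : ∀ j x, T j (blockProj E B x) = T j x
  norm_le : ∀ j x, ‖T j x‖ ≤ M * ‖x‖

variable {E : ℕ → X →L[ℂ] X}

namespace IsUnconditionalResolution

theorem blockProj_of_subset (hE : IsUnconditionalResolution E) {U B : Finset ℕ} (h : B ⊆ U) {x : X}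
    (hx : blockProj E B x = x) : blockProj E U x = x := by
  rw [← hx, hE.blockProj_blockProj, Finset.inter_eq_right.2 h]

theorem blockProj_of_disjoint (hE : IsUnconditionalResolution E) {U B : Finset ℕ}
    (h : Disjoint U B) {x : X} (hx : blockProj E B x = x) : blockProj E U x = 0 := by
  rw [← hx, hE.blockProj_blockProj, Finset.disjoint_iff_inter_eq_empty.1 h]
  simp [blockProj]

end IsUnconditionalResolution

namespace IsBlockChain

variable {M : ℝ} {B : Finset ℕ} {T : ℕ → X →L[ℂ] X}

theorem apply_blockProj_of_subset (hT : IsBlockChain E M B T) (hE : IsUnconditionalResolution E)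
    {U : Finset ℕ} (h : B ⊆ U) (j : ℕ) (x : X) : T j (blockProj E U x) = T j x := by
  rw [← hT.block_right, hE.blockProj_blockProj, Finset.inter_eq_left.2 h, hT.block_right]

theorem apply_of_disjoint (hT : IsBlockChain E M B T) (hE : IsUnconditionalResolution E)
    {U : Finset ℕ} (h : Disjoint U B) (j : ℕ) {x : X} (hx : blockProj E U x = x) : T j x = 0 := by
  rw [← hT.block_right, hE.blockProj_of_disjoint h.symm hx, map_zero]

end IsBlockChain

/-- The coordinates used by the blocks before the `k`-th one, with the small coordinates that no
block uses. -/
def usedCoords (B : ℕ → Finset ℕ) (k : ℕ) : Finset ℕ := by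
  classical
  exact (Finset.range k).biUnion B ∪ {i ∈ Finset.range k | ∀ j, i ∉ B j}

theorem mem_usedCoords {B : ℕ → Finset ℕ} {k i : ℕ} :
    i ∈ usedCoords B k ↔ (∃ j < k, i ∈ B j) ∨ (i < k ∧ ∀ j, i ∉ B j) := by
  simp [usedCoords]

theorem usedCoords_mono (B : ℕ → Finset ℕ) : Monotone (usedCoords B) := by
  intro k l h i hi
  rw [mem_usedCoords] at hi ⊢
  rcases hi with ⟨j, hj, hi⟩ | ⟨hj, hi⟩
  · exact Or.inl ⟨j, hj.trans_le h, hi⟩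
  · exact Or.inr ⟨hj.trans_le h, hi⟩

theorem block_subset_usedCoords (B : ℕ → Finset ℕ) {j k : ℕ} (h : j < k) : B j ⊆ usedCoords B k :=
  fun _ hi => mem_usedCoords.2 (Or.inl ⟨j, h, hi⟩)

theorem disjoint_usedCoords {B : ℕ → Finset ℕ} (hB : Pairwise fun i j => Disjoint (B i) (B j))
    {j k : ℕ} (h : k ≤ j) : Disjoint (usedCoords B k) (B j) := by
  rw [Finset.disjoint_left]
  intro i hi hij
  rcases mem_usedCoords.1 hi with ⟨l, hl, hi⟩ | ⟨-, hi⟩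
  · exact Finset.disjoint_left.1 (hB (by omega : l ≠ j)) hi hij
  · exact hi j hij

theorem tendsto_usedCoords (B : ℕ → Finset ℕ) : Tendsto (usedCoords B) atTop atTop := by
  refine tendsto_atTop_finset_of_monotone (usedCoords_mono B) fun i => ?_
  by_cases h : ∃ j, i ∈ B j
  · obtain ⟨j, hj⟩ := h
    exact ⟨j + 1, mem_usedCoords.2 (Or.inl ⟨j, Nat.lt_succ_self j, hj⟩)⟩
  · push Not at h
    exact ⟨i + 1, mem_usedCoords.2 (Or.inr ⟨Nat.lt_succ_self i, h⟩)⟩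

theorem IsUnconditionalResolution.tendsto_usedCoords (hE : IsUnconditionalResolution E)
    (B : ℕ → Finset ℕ) (x : X) :
    Tendsto (fun k => blockProj E (usedCoords B k) x) atTop (𝓝 x) := by
  simp only [blockProj_apply]
  exact (hE.hasSum x).comp (MaxReg.tendsto_usedCoords B)

/-- The `k`-th block component of `x` is a component of the increment between two consecutive
partial sums over the used coordinates, and these increments tend to zero. -/
theorem IsUnconditionalResolution.tendsto_block_zero [CompleteSpace X]
    (hE : IsUnconditionalResolution E)
    {B : ℕ → Finset ℕ} (hB : Pairwise fun i j => Disjoint (B i) (B j)) (x : X) :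
    Tendsto (fun k => ‖blockProj E (B k) x‖) atTop (𝓝 0) := by
  obtain ⟨K, -, hK⟩ := hE.exists_multiplier_bound
  have h1 := hE.tendsto_usedCoords B x
  have h2 : Tendsto (fun k => K * ‖blockProj E (usedCoords B (k + 1)) x -
      blockProj E (usedCoords B k) x‖) atTop (𝓝 0) := by
    have := ((((tendsto_add_atTop_iff_nat 1).2 h1).sub h1).norm).const_mul K
    simpa using this
  refine squeeze_zero (fun _ => norm_nonneg _) (fun k => ?_) h2
  have h3 : blockProj E (B k) x = blockProj E (B k) (blockProj E (usedCoords B (k + 1)) x -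
      blockProj E (usedCoords B k) x) := by
    rw [map_sub, hE.blockProj_blockProj, hE.blockProj_blockProj,
      Finset.inter_eq_left.2 (block_subset_usedCoords B (Nat.lt_succ_self k)),
      Finset.disjoint_iff_inter_eq_empty.1 (disjoint_usedCoords hB (le_refl k)).symm]
    simp [blockProj]
  rw [h3, blockProj_apply]
  simpa using hK (B k) (fun _ => 1) (by simp) (blockProj E (usedCoords B (k + 1)) x -
    blockProj E (usedCoords B k) x)

/-- The starting position of the `k`-th interval when consecutive intervals have `L i + 1`
elements. -/
def blockStart (L : ℕ → ℕ) (k : ℕ) : ℕ := ∑ i ∈ Finset.range k, (L i + 1)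

/-- The extra element keeps every interval nonempty even when `L k = 0`. -/
theorem blockStart_strictMono (L : ℕ → ℕ) : StrictMono (blockStart L) :=
  strictMono_nat_of_lt_succ fun k => by rw [blockStart, blockStart, Finset.sum_range_succ]; omega

/-- The interval to which `n` belongs. -/
def blockIndex (L : ℕ → ℕ) (n : ℕ) : ℕ := Nat.findGreatest (fun k => blockStart L k ≤ n) n

theorem blockStart_blockIndex_le (L : ℕ → ℕ) (n : ℕ) : blockStart L (blockIndex L n) ≤ n :=
  Nat.findGreatest_spec (P := fun k => blockStart L k ≤ n) (Nat.zero_le n) (by simp [blockStart])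

theorem le_blockIndex {L : ℕ → ℕ} {n k : ℕ} (h : blockStart L k ≤ n) : k ≤ blockIndex L n :=
  Nat.le_findGreatest ((blockStart_strictMono L).le_apply.trans h) h

theorem blockIndex_mono (L : ℕ → ℕ) : Monotone (blockIndex L) := fun m _ h =>
  le_blockIndex ((blockStart_blockIndex_le L m).trans h)

theorem blockIndex_add (L : ℕ → ℕ) {k j : ℕ} (hj : j ≤ L k) :
    blockIndex L (blockStart L k + j) = k := by
  refine le_antisymm ?_ (le_blockIndex (Nat.le_add_right _ _))
  by_contra h
  have h1 := blockStart_blockIndex_le L (blockStart L k + j)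
  have h2 := (blockStart_strictMono L).monotone (Nat.succ_le_of_lt (not_le.1 h))
  have h3 : blockStart L (k + 1) = blockStart L k + (L k + 1) := by
    rw [blockStart, blockStart, Finset.sum_range_succ]
  simp only [Nat.succ_eq_add_one] at h2
  omega

theorem tendsto_blockIndex (L : ℕ → ℕ) : Tendsto (blockIndex L) atTop atTop :=
  tendsto_atTop_atTop.2 fun k => ⟨blockStart L k, fun _ hn => le_blockIndex hn⟩

/-- The concatenation of a sequence of block chains into one projection chain. -/
def concatChain (E : ℕ → X →L[ℂ] X) (B : ℕ → Finset ℕ) (L : ℕ → ℕ) (T : ℕ → ℕ → X →L[ℂ] X)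
    (n : ℕ) : X →L[ℂ] X :=
  blockProj E (usedCoords B (blockIndex L n)) +
    T (blockIndex L n) (n - blockStart L (blockIndex L n))

/-- The used coordinates contain all earlier blocks and avoid the current and later ones, so a
product across two intervals collapses to the earlier factor; inside an interval the chain law of
the block applies. For convergence, the used coordinates exhaust `ℕ` and the block term is at most
`M` times a block component of `x`. -/
theorem isProjectionChain_concatChain [CompleteSpace X] (hE : IsUnconditionalResolution E)
    {B : ℕ → Finset ℕ} (hB : Pairwise fun i j => Disjoint (B i) (B j)) (L : ℕ → ℕ) {M : ℝ}
    {T : ℕ → ℕ → X →L[ℂ] X} (hT : ∀ k, IsBlockChain E M (B k) (T k)) :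
    IsProjectionChain (concatChain E B L T) := by
  have hidem : ∀ (U : Finset ℕ) (x : X), blockProj E U (blockProj E U x) = blockProj E U x :=
    fun U x => by rw [hE.blockProj_blockProj, Finset.inter_self]
  constructor
  · intro m n x
    simp only [concatChain, add_apply, map_add]
    rcases lt_trichotomy (blockIndex L m) (blockIndex L n) with h | h | h
    · have hmn : m ≤ n := by
        by_contra hc
        exact absurd (blockIndex_mono L (not_le.1 hc).le) (not_le.2 h)
      rw [min_eq_left hmn, hE.blockProj_blockProj, Finset.inter_eq_left.2 (usedCoords_mono B h.le),
        hE.blockProj_of_disjoint (disjoint_usedCoords hB h.le) ((hT _).block_left _ _),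
        (hT _).apply_blockProj_of_subset hE (block_subset_usedCoords B h),
        (hT (blockIndex L m)).apply_of_disjoint hE (hB h.ne') _ ((hT _).block_left _ _)]
      simp
    · have hmin : blockIndex L (min m n) = blockIndex L n := by
        rcases le_total m n with h' | h'
        · rw [min_eq_left h', h]
        · rw [min_eq_right h']
      rw [h, hmin, hidem, hE.blockProj_of_disjoint (disjoint_usedCoords hB le_rfl)
        ((hT _).block_left _ _),
        (hT _).apply_of_disjoint hE (disjoint_usedCoords hB le_rfl) _ (hidem _ _),
        (hT _).apply_apply]
      simp [Nat.sub_min_sub_right]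
    · have hmn : n ≤ m := by
        by_contra hc
        exact absurd (blockIndex_mono L (not_le.1 hc).le) (not_le.2 h)
      rw [min_eq_right hmn, hE.blockProj_blockProj,
        Finset.inter_eq_right.2 (usedCoords_mono B h.le),
        hE.blockProj_of_subset (block_subset_usedCoords B h) ((hT _).block_left _ _),
        (hT _).apply_of_disjoint hE (disjoint_usedCoords hB h.le) _ (hidem _ _),
        (hT (blockIndex L m)).apply_of_disjoint hE (hB h.ne) _ ((hT _).block_left _ _)]
      simp
  · intro x
    have h1 := (hE.tendsto_usedCoords B x).comp (tendsto_blockIndex L)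
    have h2 : Tendsto (fun n => T (blockIndex L n) (n - blockStart L (blockIndex L n)) x) atTop
        (𝓝 0) := by
      rw [tendsto_zero_iff_norm_tendsto_zero]
      have h3 := ((hE.tendsto_block_zero hB x).comp (tendsto_blockIndex L)).const_mul M
      rw [mul_zero] at h3
      refine squeeze_zero (fun _ => norm_nonneg _) (fun n => ?_) h3
      rw [← (hT _).block_right]
      exact (hT _).norm_le _ _
    have h3 := h1.add h2
    rw [add_zero] at h3
    exact h3

/-- Under (MRP), the randomised boundedness estimate holds with one constant for all the members
of a uniformly bounded sequence of disjoint block chains. -/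
theorem HasMRP.exists_blockChain_estimate [CompleteSpace X] (hX : HasMRP X)
    (hE : IsUnconditionalResolution E)
    {B : ℕ → Finset ℕ} (hB : Pairwise fun i j => Disjoint (B i) (B j)) (L : ℕ → ℕ) {M : ℝ}
    {T : ℕ → ℕ → X →L[ℂ] X} (hT : ∀ k, IsBlockChain E M (B k) (T k)) :
    ∃ (p P C : ℝ) (θ : ℕ → ℕ → ℝ → ℂ), 1 < p ∧ 0 < P ∧ 0 ≤ C ∧
      (∀ k, IsOrthoUnimodular P (θ k)) ∧
      ∀ (k : ℕ) (x : ℕ → X), (∀ j, blockProj E (B k) (x j) = x j) →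
        ∫ t in (0 : ℝ)..P, ‖∑ j ∈ Finset.range (L k), θ k j t • T k j (x j)‖ ^ p ≤
          C * ∫ t in (0 : ℝ)..P, ‖∑ j ∈ Finset.range (L k), θ k j t • x j‖ ^ p := by
  obtain ⟨p, P, C, θ, hp, hP, hC, hθ, h⟩ :=
    hX.exists_chain_estimate (isProjectionChain_concatChain hE hB L hT)
  refine ⟨p, P, C, fun k j => θ (blockStart L k + j), hp, hP, hC, fun k => ⟨fun n => hθ.continuous _,
    fun n => hθ.norm_eq _, fun m n hmn => hθ.integral_eq _ _ (by omega)⟩, fun k x hx => ?_⟩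
  -- Only the indices of the `k`-th interval are used. On vectors of the block the used coordinates
  -- vanish, which leaves `T k j`.
  have h1 := h ((Finset.range (L k)).map (addLeftEmbedding (blockStart L k)))
    (fun n => x (n - blockStart L k))
  simp only [Finset.sum_map, addLeftEmbedding_apply, Nat.add_sub_cancel_left] at h1
  have h2 : ∀ j ∈ Finset.range (L k), concatChain E B L T (blockStart L k + j) (x j) =
      T k j (x j) := by
    intro j hj
    rw [concatChain, blockIndex_add L (Finset.mem_range.1 hj).le, Nat.add_sub_cancel_left,
      add_apply, hE.blockProj_of_disjoint (disjoint_usedCoords hB le_rfl) (hx j), zero_add]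
  have h3 : ∀ t, ∑ j ∈ Finset.range (L k), θ (blockStart L k + j) t •
      concatChain E B L T (blockStart L k + j) (x j) =
        ∑ j ∈ Finset.range (L k), θ (blockStart L k + j) t • T k j (x j) := fun t =>
    Finset.sum_congr rfl fun j hj => by rw [h2 j hj]
  simpa only [h3] using h1

/-- Under (MRP), a uniform estimate for block chains on far-out coordinates tested on vectors whose
sums are insensitive to unimodular factors. -/
theorem HasMRP.exists_uniform_chain_bound [CompleteSpace X] (hX : HasMRP X)
    (hE : IsUnconditionalResolution E) (M : ℝ) :
    ∃ (m : ℕ) (C : ℝ), 0 ≤ C ∧ ∀ (B : Finset ℕ) (L : ℕ) (T : ℕ → X →L[ℂ] X) (x : ℕ → X) (a b : ℝ),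
      (∀ i ∈ B, m ≤ i) → IsBlockChain E M B T → (∀ j, blockProj E B (x j) = x j) → 0 ≤ b →
      (∀ c : ℕ → ℂ, (∀ j, ‖c j‖ = 1) → ‖∑ j ∈ Finset.range L, c j • x j‖ ≤ a) →
      (∀ c : ℕ → ℂ, (∀ j, ‖c j‖ = 1) → b ≤ ‖∑ j ∈ Finset.range L, c j • T j (x j)‖) →
      b ≤ C * a := by
  -- Gliding hump: failure for every `m` and `C` supplies ever worse examples, far enough out to
  -- occupy disjoint blocks, and the common constant of the blocks contradicts them. Insensitivity
  -- to unimodular factors removes `θ` and `p` from the conclusion.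
  by_contra hcon
  push Not at hcon
  have hbad : ∀ m C : ℕ, ∃ (B : Finset ℕ) (L : ℕ) (T : ℕ → X →L[ℂ] X) (x : ℕ → X) (a b : ℝ),
      (∀ i ∈ B, m ≤ i) ∧ IsBlockChain E M B T ∧ (∀ j, blockProj E B (x j) = x j) ∧ 0 ≤ b ∧
      (∀ c : ℕ → ℂ, (∀ j, ‖c j‖ = 1) → ‖∑ j ∈ Finset.range L, c j • x j‖ ≤ a) ∧
      (∀ c : ℕ → ℂ, (∀ j, ‖c j‖ = 1) → b ≤ ‖∑ j ∈ Finset.range L, c j • T j (x j)‖) ∧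
      (C : ℝ) * a < b := fun m C => hcon m C (Nat.cast_nonneg C)
  choose B L T x a b hBm hT hx hb0 ha hb hab using hbad
  -- The next start exceeds every coordinate of the block chosen at stage `k`, where the tested
  -- constant is `k` itself.
  let start : ℕ → ℕ := fun k => Nat.rec 0 (fun k m => max m ((B m k).sup id + 1)) k
  have hstart : ∀ k, start (k + 1) = max (start k) ((B (start k) k).sup id + 1) := fun k => rfl
  have hmono : Monotone start := monotone_nat_of_le_succ fun k => by
    rw [hstart]; exact le_max_left _ _
  have hdisj : Pairwise fun i j => Disjoint (B (start i) i) (B (start j) j) := by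
    have key : ∀ i j, i < j → Disjoint (B (start i) i) (B (start j) j) := by
      intro i j hij
      rw [Finset.disjoint_left]
      intro n hn hn'
      have h1 : n ≤ (B (start i) i).sup id := Finset.le_sup (f := id) hn
      have h2 := hBm _ _ n hn'
      have h3 := hmono (Nat.succ_le_of_lt hij)
      simp only [Nat.succ_eq_add_one, hstart] at h3
      have h4 := le_max_right (start i) ((B (start i) i).sup id + 1)
      omega
    intro i j hij
    rcases lt_or_gt_of_ne hij with h | h
    · exact key i j h
    · exact (key j i h).symm
  obtain ⟨p, P, C, θ, hp, hP, hC, hθ, hest⟩ := hX.exists_blockChain_estimate hE hdisj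
    (fun k => L (start k) k) (fun k => hT (start k) k)
  have hp0 : 0 < p := by linarith
  obtain ⟨k, hk⟩ := exists_nat_gt (C ^ p⁻¹)
  have h1 := hest k (x (start k) k) (hx (start k) k)
  set a' := a (start k) k
  set b' := b (start k) k
  have ha0 : 0 ≤ a' := (norm_nonneg _).trans (ha (start k) k (fun _ => 1) (by simp))
  have hcont : ∀ y : ℕ → X, Continuous fun t =>
      ‖∑ j ∈ Finset.range (L (start k) k), θ k j t • y j‖ ^ p := fun y => by
    have := (hθ k).continuous
    exact (Continuous.norm (by fun_prop)).rpow_const fun _ => Or.inr hp0.le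
  have h2 : ∫ t in (0 : ℝ)..P, b' ^ p ≤
      ∫ t in (0 : ℝ)..P, ‖∑ j ∈ Finset.range (L (start k) k), θ k j t •
        T (start k) k j (x (start k) k j)‖ ^ p := by
    refine intervalIntegral.integral_mono_on hP.le intervalIntegrable_const
      ((hcont _).intervalIntegrable _ _) fun t _ => ?_
    exact Real.rpow_le_rpow (hb0 _ _) (hb _ _ (fun j => θ k j t) fun j => (hθ k).norm_eq j t) hp0.le
  have h3 : ∫ t in (0 : ℝ)..P, ‖∑ j ∈ Finset.range (L (start k) k), θ k j t •
        x (start k) k j‖ ^ p ≤ ∫ t in (0 : ℝ)..P, a' ^ p := by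
    refine intervalIntegral.integral_mono_on hP.le
      ((hcont _).intervalIntegrable _ _) intervalIntegrable_const fun t _ => ?_
    exact Real.rpow_le_rpow (norm_nonneg _)
      (ha _ _ (fun j => θ k j t) fun j => (hθ k).norm_eq j t) hp0.le
  rw [intervalIntegral.integral_const, smul_eq_mul, sub_zero] at h2 h3
  have h4 : P * b' ^ p ≤ P * (C * a' ^ p) := by
    have := mul_le_mul_of_nonneg_left h3 hC
    nlinarith
  have h5 : b' ^ p ≤ (C ^ p⁻¹ * a') ^ p := by
    rw [Real.mul_rpow (by positivity) ha0, Real.rpow_inv_rpow hC hp0.ne']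
    exact le_of_mul_le_mul_left h4 hP
  have h6 : b' ≤ C ^ p⁻¹ * a' :=
    (Real.rpow_le_rpow_iff (hb0 _ _) (by positivity) hp0).1 h5
  have h7 := hab (start k) k
  have h8 : C ^ p⁻¹ * a' ≤ k * a' := mul_le_mul_of_nonneg_right hk.le ha0
  linarith

end BlockChains

/-! ### Norms of disjoint sums are determined by the norms of the summands. -/

section Domination

variable {E : ℕ → X →L[ℂ] X}

/-- The vectors `x 0, …, x (n-1)` are supported by mutually disjoint finite sets `A i` of
coordinates. -/
structure IsDisjointlySupported (E : ℕ → X →L[ℂ] X) (n : ℕ) (A : ℕ → Finset ℕ) (x : ℕ → X) :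
    Prop where
  disjoint : ∀ i < n, ∀ j < n, i ≠ j → Disjoint (A i) (A j)
  supported : ∀ i < n, blockProj E (A i) (x i) = x i

/-- `K` bounds all the multipliers with coefficients of modulus at most one. -/
def IsMultiplierBound (E : ℕ → X →L[ℂ] X) (K : ℝ) : Prop :=
  ∀ (s : Finset ℕ) (c : ℕ → ℂ), (∀ n ∈ s, ‖c n‖ ≤ 1) → ∀ x, ‖∑ n ∈ s, c n • E n x‖ ≤ K * ‖x‖

theorem IsMultiplierBound.norm_blockProj_le {K : ℝ} (hK : IsMultiplierBound E K) (s : Finset ℕ)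
    (x : X) : ‖blockProj E s x‖ ≤ K * ‖x‖ := by
  rw [blockProj_apply]
  simpa using hK s (fun _ => 1) (by simp) x

namespace IsDisjointlySupported

variable {n : ℕ} {A : ℕ → Finset ℕ} {x : ℕ → X}

theorem blockProj_sum (hx : IsDisjointlySupported E n A x) (hE : IsUnconditionalResolution E)
    {j : ℕ} (hj : j < n) : blockProj E (A j) (∑ i ∈ Finset.range n, x i) = x j := by
  rw [map_sum, Finset.sum_eq_single j]
  · exact hx.supported j hj
  · intro i hi hij
    exact hE.blockProj_of_disjoint (hx.disjoint j hj i (Finset.mem_range.1 hi) hij.symm)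
      (hx.supported i (Finset.mem_range.1 hi))
  · exact fun h => absurd (Finset.mem_range.2 hj) h

/-- The multiplier is constant, equal to `c j`, on the coordinates in `A j`. -/
theorem norm_sum_smul_le (hx : IsDisjointlySupported E n A x) (hE : IsUnconditionalResolution E)
    {K : ℝ} (hK : IsMultiplierBound E K) (c : ℕ → ℂ) (hc : ∀ i < n, ‖c i‖ ≤ 1) :
    ‖∑ i ∈ Finset.range n, c i • x i‖ ≤ K * ‖∑ i ∈ Finset.range n, x i‖ := by
  classical
  let c' : ℕ → ℂ := fun k => ∑ j ∈ Finset.range n, if k ∈ A j then c j else 0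
  have hc' : ∀ j < n, ∀ k ∈ A j, c' k = c j := by
    intro j hj k hk
    simp only [c']
    rw [Finset.sum_eq_single j, if_pos hk]
    · intro i hi hij
      rw [if_neg]
      exact fun h => Finset.disjoint_left.1
        (hx.disjoint i (Finset.mem_range.1 hi) j hj hij) h hk
    · exact fun h => absurd (Finset.mem_range.2 hj) h
  have h1 := hK ((Finset.range n).biUnion A) c' (by
    intro k hk
    obtain ⟨j, hj, hk⟩ := Finset.mem_biUnion.1 hk
    rw [hc' j (Finset.mem_range.1 hj) k hk]
    exact hc j (Finset.mem_range.1 hj)) (∑ i ∈ Finset.range n, x i)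
  rw [Finset.sum_biUnion fun i hi j hj hij => hx.disjoint i (by simpa using hi) j
    (by simpa using hj) hij] at h1
  convert h1 using 3 with j hj
  have hj' := Finset.mem_range.1 hj
  rw [← hx.blockProj_sum hE hj', blockProj_apply, Finset.smul_sum]
  exact Finset.sum_congr rfl fun k hk => by rw [hc' j hj' k hk]

theorem norm_le (hx : IsDisjointlySupported E n A x) (hE : IsUnconditionalResolution E)
    {K : ℝ} (hK : IsMultiplierBound E K) {j : ℕ} (hj : j < n) :
    ‖x j‖ ≤ K * ‖∑ i ∈ Finset.range n, x i‖ := by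
  rw [← hx.blockProj_sum hE hj]
  exact hK.norm_blockProj_le _ _

end IsDisjointlySupported

/-- The rank-one operator sending `y` to `y + x`, where `g` is a norming functional of `y`. -/
def shearOp (E : ℕ → X →L[ℂ] X) (B : Finset ℕ) (g : StrongDual ℂ X) (x y : X) : X →L[ℂ] X :=
  ((((‖y‖ : ℂ)⁻¹) • g).comp (blockProj E B)).smulRight (y + x)

theorem shearOp_apply (B : Finset ℕ) (g : StrongDual ℂ X) (x y z : X) :
    shearOp E B g x y z = ((‖y‖ : ℂ)⁻¹ * g (blockProj E B z)) • (y + x) := rfl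

theorem isBlockChain_shearOp (hE : IsUnconditionalResolution E) {K : ℝ}
    (hK : IsMultiplierBound E K) (hK0 : 0 ≤ K)
    {A B : Finset ℕ} (hAB : Disjoint A B) {x y : X} (hx : blockProj E A x = x)
    (hy : blockProj E B y = y) (hxy : ‖x‖ ≤ ‖y‖) {g : StrongDual ℂ X} (hg : ‖g‖ ≤ 1)
    (hgy : g y = ‖y‖) : IsBlockChain E (2 * K) (A ∪ B) (fun _ => shearOp E B g x y) := by
  have hBx : blockProj E B x = 0 := hE.blockProj_of_disjoint hAB.symm hx
  refine ⟨fun _ _ z => ?_, fun _ z => ?_, fun _ z => ?_, fun _ z => ?_⟩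
  · have hB : blockProj E B (y + x) = y := by rw [map_add, hy, hBx, add_zero]
    have hgy' : g y = (‖y‖ : ℂ) := hgy
    simp only [shearOp_apply, map_smul, hB, hgy']
    congr 1
    by_cases h : y = 0
    · have hx0 : x = 0 := by simpa [h] using hxy
      simp [h, hx0]
    · rw [inv_mul_cancel₀ (by simpa using h), one_smul]
  · simp only [shearOp_apply, map_smul, map_add]
    rw [hE.blockProj_of_subset Finset.subset_union_left hx,
      hE.blockProj_of_subset Finset.subset_union_right hy]
  · simp only [shearOp_apply]
    rw [hE.blockProj_blockProj, Finset.inter_eq_left.2 Finset.subset_union_right]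
  · rw [shearOp_apply, norm_smul, norm_mul, norm_inv, Complex.norm_real, norm_norm]
    have h1 : ‖g (blockProj E B z)‖ ≤ K * ‖z‖ := by
      have := g.le_of_opNorm_le hg (blockProj E B z)
      have := hK.norm_blockProj_le B z
      linarith
    have h2 : ‖y + x‖ ≤ 2 * ‖y‖ := (norm_add_le _ _).trans (by linarith)
    rcases (norm_nonneg y).eq_or_lt with h | h
    · rw [← h]; simp; positivity
    · calc ‖y‖⁻¹ * ‖g (blockProj E B z)‖ * ‖y + x‖ ≤ ‖y‖⁻¹ * (K * ‖z‖) * (2 * ‖y‖) := by gcongr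
        _ = 2 * K * ‖z‖ := by field_simp

/-- The `j`-th projection contains the whole of the earlier blocks `D i`, and hence the range of
every earlier step `R i`; disjointness kills the remaining products. Emptiness beyond `n` keeps all
indices inside the same finite block. -/
theorem isBlockChain_of_steps (hE : IsUnconditionalResolution E) {K M : ℝ}
    (hK : IsMultiplierBound E K) {n : ℕ} {D : ℕ → Finset ℕ}
    (hD : Pairwise fun i j => Disjoint (D i) (D j)) (hDn : ∀ i, n ≤ i → D i = ∅)
    {R : ℕ → X →L[ℂ] X} (hR : ∀ j, IsBlockChain E M (D j) (fun _ => R j)) :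
    IsBlockChain E (K + M) ((Finset.range n).biUnion D)
      (fun j => blockProj E ((Finset.range j).biUnion D) + R j) := by
  have hsub : ∀ {i j}, i < j → D i ⊆ (Finset.range j).biUnion D := fun h =>
    Finset.subset_biUnion_of_mem D (Finset.mem_range.2 h)
  have hmono : ∀ {i j}, i ≤ j → (Finset.range i).biUnion D ⊆ (Finset.range j).biUnion D := fun h =>
    Finset.biUnion_subset_biUnion_of_subset_left D (Finset.range_subset_range.2 h)
  have hdisj : ∀ {i j}, i ≤ j → Disjoint ((Finset.range i).biUnion D) (D j) := by
    intro i j hij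
    rw [Finset.disjoint_biUnion_left]
    intro k hk
    exact hD (by have := Finset.mem_range.1 hk; omega)
  have hmono' : ∀ j, (Finset.range j).biUnion D ⊆ (Finset.range n).biUnion D := by
    intro j k hk
    obtain ⟨i, -, hk⟩ := Finset.mem_biUnion.1 hk
    refine Finset.mem_biUnion.2 ⟨i, Finset.mem_range.2 ?_, hk⟩
    by_contra h
    rw [hDn i (not_lt.1 h)] at hk
    simp at hk
  have hsub' : ∀ j, D j ⊆ (Finset.range n).biUnion D := fun j =>
    (hsub (Nat.lt_succ_self j)).trans (hmono' _)
  have hidem : ∀ (U : Finset ℕ) (x : X), blockProj E U (blockProj E U x) = blockProj E U x :=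
    fun U x => by rw [hE.blockProj_blockProj, Finset.inter_self]
  refine ⟨fun i j x => ?_, fun j x => ?_, fun j x => ?_, fun j x => ?_⟩
  · simp only [add_apply, map_add]
    rcases lt_trichotomy i j with h | h | h
    · rw [min_eq_left h.le, hE.blockProj_blockProj, Finset.inter_eq_left.2 (hmono h.le),
        hE.blockProj_of_disjoint (hdisj h.le) ((hR j).block_left 0 x),
        (hR i).apply_blockProj_of_subset hE (hsub h) 0,
        (hR i).apply_of_disjoint hE (hD h.ne') 0 ((hR j).block_left 0 x)]
      simp
    · subst h
      rw [min_self, hidem, hE.blockProj_of_disjoint (hdisj le_rfl) ((hR i).block_left 0 x),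
        (hR i).apply_of_disjoint hE (hdisj le_rfl) 0 (hidem _ _), (hR i).apply_apply 0 0]
      simp
    · rw [min_eq_right h.le, hE.blockProj_blockProj, Finset.inter_eq_right.2 (hmono h.le),
        hE.blockProj_of_subset (hsub h) ((hR j).block_left 0 x),
        (hR i).apply_of_disjoint hE (hdisj h.le) 0 (hidem _ _),
        (hR i).apply_of_disjoint hE (hD h.ne) 0 ((hR j).block_left 0 x)]
      simp
  · simp only [add_apply, map_add]
    rw [hE.blockProj_of_subset (hmono' j) (hidem _ _),
      hE.blockProj_of_subset (hsub' j) ((hR j).block_left 0 x)]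
  · simp only [add_apply]
    rw [hE.blockProj_blockProj, Finset.inter_eq_left.2 (hmono' j),
      (hR j).apply_blockProj_of_subset hE (hsub' j) 0]
  · simp only [add_apply]
    refine (norm_add_le _ _).trans ?_
    rw [add_mul]
    exact add_le_add (hK.norm_blockProj_le _ _) ((hR j).norm_le 0 x)

/-- The chain built from shear projections sends `y j` to `y j + x j`. The uniform bound thus
compares sums of `y j + x j` with sums of `y j`, and projecting onto the supports of the `x j`
leaves the desired inequality. -/
theorem HasMRP.exists_domination_far [CompleteSpace X] (hX : HasMRP X)
    (hE : IsUnconditionalResolution E) :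
    ∃ (m : ℕ) (C : ℝ), 0 ≤ C ∧ ∀ (n : ℕ) (A B : ℕ → Finset ℕ) (x y : ℕ → X),
      (∀ i, n ≤ i → A i = ∅ ∧ B i = ∅) →
      (Pairwise fun i j => Disjoint (A i ∪ B i) (A j ∪ B j)) → (∀ i, Disjoint (A i) (B i)) →
      (∀ i, blockProj E (A i) (x i) = x i) → (∀ i, blockProj E (B i) (y i) = y i) →
      (∀ i, ∀ k ∈ A i ∪ B i, m ≤ k) → (∀ i, ‖x i‖ ≤ ‖y i‖) →
      ‖∑ i ∈ Finset.range n, x i‖ ≤ C * ‖∑ i ∈ Finset.range n, y i‖ := by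
  obtain ⟨K, hK1, hK⟩ := hE.exists_multiplier_bound
  have hK : IsMultiplierBound E K := hK
  have hK0 : 0 < K := by linarith
  obtain ⟨m, C, hC0, h⟩ := hX.exists_uniform_chain_bound hE (K + 2 * K)
  -- One `K` inserts unimodular factors before the `y i`, one removes them before the `x i`, and one
  -- projects onto the coordinates of the `x i`.
  refine ⟨m, K * K * (C * K), by positivity, fun n A B x y hn hD hAB hx hy hm hxy => ?_⟩
  choose g hg hgy using fun i => exists_dual_vector'' ℂ (y i)
  have hch := isBlockChain_of_steps hE hK hD (n := n) (fun i hi => by simp [hn i hi]) (fun j =>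
    isBlockChain_shearOp hE hK hK0.le (hAB j) (hx j) (hy j) (hxy j) (hg j) (hgy j))
  have hxs : IsDisjointlySupported E n A x := ⟨fun i _ j _ hij =>
    Finset.disjoint_of_subset_left Finset.subset_union_left
      (Finset.disjoint_of_subset_right Finset.subset_union_left (hD hij)), fun i _ => hx i⟩
  have hys : IsDisjointlySupported E n B y := ⟨fun i _ j _ hij =>
    Finset.disjoint_of_subset_left Finset.subset_union_right
      (Finset.disjoint_of_subset_right Finset.subset_union_right (hD hij)), fun i _ => hy i⟩
  have hAB' : ∀ i j, Disjoint (A i) (B j) := by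
    intro i j
    by_cases hij : i = j
    · exact hij ▸ hAB i
    · exact Finset.disjoint_of_subset_left Finset.subset_union_left
        (Finset.disjoint_of_subset_right Finset.subset_union_right (hD hij))
  have hTy : ∀ j, (blockProj E ((Finset.range j).biUnion fun i => A i ∪ B i) +
      shearOp E (B j) (g j) (x j) (y j)) (y j) = y j + x j := by
    intro j
    rw [add_apply, hE.blockProj_of_disjoint (B := B j) ?_ (hy j), zero_add, shearOp_apply, hy, hgy]
    · by_cases h0 : y j = 0
      · have h1 : ‖x j‖ ≤ 0 := by simpa [h0] using hxy j
        simp [h0, norm_le_zero_iff.1 h1]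
      · have : (‖y j‖ : ℂ) ≠ 0 := by exact_mod_cast (norm_pos_iff.2 h0).ne'
        rw [show (‖y j‖ : ℂ)⁻¹ * (RCLike.ofReal ‖y j‖ : ℂ) = 1 from inv_mul_cancel₀ this, one_smul]
    · rw [Finset.disjoint_biUnion_left]
      intro i hi
      have : i ≠ j := by have := Finset.mem_range.1 hi; omega
      exact Finset.disjoint_of_subset_right Finset.subset_union_right (hD this)
  have h1 := h _ n _ y (K * ‖∑ i ∈ Finset.range n, y i‖)
    ((K * K)⁻¹ * ‖∑ i ∈ Finset.range n, x i‖)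
    (fun i hi => by
      obtain ⟨j, -, hj⟩ := Finset.mem_biUnion.1 hi
      exact hm j i hj) hch
    (fun j => by
      by_cases hj : j < n
      · exact hE.blockProj_of_subset (Finset.subset_union_right.trans
          (Finset.subset_biUnion_of_mem (fun i => A i ∪ B i) (Finset.mem_range.2 hj))) (hy j)
      · have : y j = 0 := by rw [← hy j, (hn j (not_lt.1 hj)).2]; simp [blockProj]
        simp [this]) (by positivity)
    (fun c hc => hys.norm_sum_smul_le hE hK c fun i _ => (hc i).le)
    (fun c hc => by
      simp only [hTy]
      have hcx : IsDisjointlySupported E n A (fun i => c i • x i) :=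
        ⟨hxs.disjoint, fun i hi => by rw [map_smul, hxs.supported i hi]⟩
      have e1 := hcx.norm_sum_smul_le hE hK (fun i => (c i)⁻¹) fun i _ => by
        rw [norm_inv, hc i, inv_one]
      have e2 : ∀ i, (c i)⁻¹ • c i • x i = x i := fun i =>
        inv_smul_smul₀ (norm_pos_iff.1 (by rw [hc i]; exact one_pos)) _
      simp only [e2] at e1
      have e3 : blockProj E ((Finset.range n).biUnion A)
          (∑ j ∈ Finset.range n, c j • (y j + x j)) = ∑ j ∈ Finset.range n, c j • x j := by
        rw [map_sum]
        refine Finset.sum_congr rfl fun j hj => ?_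
        rw [map_smul, map_add, hE.blockProj_of_disjoint (B := B j) ?_ (hy j), zero_add,
          hE.blockProj_of_subset (Finset.subset_biUnion_of_mem A hj) (hx j)]
        rw [Finset.disjoint_biUnion_left]
        exact fun i _ => hAB' i j
      have e4 := hK.norm_blockProj_le ((Finset.range n).biUnion A)
        (∑ j ∈ Finset.range n, c j • (y j + x j))
      rw [e3] at e4
      rw [inv_mul_le_iff₀ (by positivity)]
      nlinarith)
  rw [inv_mul_le_iff₀ (by positivity)] at h1
  calc _ ≤ _ := h1
    _ = _ := by ring

/-- By disjointness at most `m` indices meet coordinates below `m`. Each of these contributes at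
most `K` times the norm of the full sum of the `y i`; the other indices are far out. -/
theorem HasMRP.exists_domination_of_disjoint [CompleteSpace X] (hX : HasMRP X)
    (hE : IsUnconditionalResolution E) :
    ∃ C : ℝ, 0 ≤ C ∧ ∀ (n : ℕ) (A B : ℕ → Finset ℕ) (x y : ℕ → X),
      IsDisjointlySupported E n A x → IsDisjointlySupported E n B y →
      (∀ i < n, ∀ j < n, Disjoint (A i) (B j)) → (∀ i < n, ‖x i‖ ≤ ‖y i‖) →
      ‖∑ i ∈ Finset.range n, x i‖ ≤ C * ‖∑ i ∈ Finset.range n, y i‖ := by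
  classical
  obtain ⟨K, hK1, hK⟩ := hE.exists_multiplier_bound
  have hK : IsMultiplierBound E K := hK
  have hK0 : 0 < K := by linarith
  obtain ⟨m, C, hC0, h⟩ := hX.exists_domination_far hE
  refine ⟨C * K + m * K, by positivity, fun n A B x y hx hy hAB hxy => ?_⟩
  set Y := ‖∑ i ∈ Finset.range n, y i‖
  let good : ℕ → Prop := fun i => i < n ∧ ∀ k ∈ A i ∪ B i, m ≤ k
  have hdj : ∀ i < n, ∀ j < n, i ≠ j → Disjoint (A i ∪ B i) (A j ∪ B j) := by
    intro i hi j hj hij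
    rw [Finset.disjoint_union_left, Finset.disjoint_union_right, Finset.disjoint_union_right]
    exact ⟨⟨hx.disjoint i hi j hj hij, hAB i hi j hj⟩, (hAB j hj i hi).symm,
      hy.disjoint i hi j hj hij⟩
  have h1 := h n (fun i => if good i then A i else ∅) (fun i => if good i then B i else ∅)
    (fun i => if good i then x i else 0) (fun i => if good i then y i else 0)
    (fun i hi => by
      have : ¬ good i := fun hg => absurd hg.1 (not_lt.2 hi)
      simp [this])
    (fun i j hij => by
      by_cases hi : good i <;> by_cases hj : good j <;> simp only [hi, hj, if_true, if_false] <;>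
        try simp
      simpa using hdj i hi.1 j hj.1 hij)
    (fun i => by
      by_cases hi : good i
      · simpa [hi] using hAB i hi.1 i hi.1
      · simp [hi])
    (fun i => by
      by_cases hi : good i
      · simpa [hi] using hx.supported i hi.1
      · simp [hi])
    (fun i => by
      by_cases hi : good i
      · simpa [hi] using hy.supported i hi.1
      · simp [hi])
    (fun i k hk => by
      by_cases hi : good i
      · simp only [hi, if_true] at hk
        exact hi.2 k hk
      · simp [hi] at hk)
    (fun i => by
      by_cases hi : good i
      · simpa [hi] using hxy i hi.1
      · simp [hi])
  have h2 : ‖∑ i ∈ Finset.range n, if good i then y i else 0‖ ≤ K * Y := by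
    have := hy.norm_sum_smul_le hE hK (fun i => if good i then 1 else 0) fun i _ => by
      split_ifs <;> simp
    simpa only [ite_smul, one_smul, zero_smul] using this
  have hcard : (Finset.filter (fun i => ¬ good i) (Finset.range n)).card ≤ m := by
    have hex : ∀ i ∈ Finset.filter (fun i => ¬ good i) (Finset.range n),
        ∃ k ∈ A i ∪ B i, k < m := by
      intro i hi
      obtain ⟨hi, hg⟩ := Finset.mem_filter.1 hi
      by_contra hc
      push Not at hc
      exact hg ⟨Finset.mem_range.1 hi, hc⟩
    choose! k hk hkm using hex
    refine le_of_le_of_eq ?_ (Finset.card_range m)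
    refine Finset.card_le_card_of_injOn k (fun i hi => ?_) fun i hi j hj hij => ?_
    · simpa using hkm i hi
    · by_contra hne
      have hi' := Finset.mem_range.1 (Finset.mem_filter.1 hi).1
      have hj' := Finset.mem_range.1 (Finset.mem_filter.1 hj).1
      exact Finset.disjoint_left.1 (hdj i hi' j hj' hne) (hk i hi) (hij ▸ hk j hj)
  have h3 : ‖∑ i ∈ Finset.range n with ¬ good i, x i‖ ≤ m * K * Y := by
    refine (norm_sum_le_of_le _ (f := x) (n := fun _ => K * Y) fun i hi => ?_).trans ?_
    · have hi' := Finset.mem_range.1 (Finset.mem_filter.1 hi).1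
      exact (hxy i hi').trans (hy.norm_le hE hK hi')
    · rw [Finset.sum_const, nsmul_eq_mul, mul_assoc]
      gcongr
  rw [← Finset.sum_filter_add_sum_filter_not (Finset.range n) good]
  refine (norm_add_le _ _).trans ?_
  rw [Finset.sum_filter]
  have h4 : C * ‖∑ i ∈ Finset.range n, if good i then y i else 0‖ ≤ C * (K * Y) := by gcongr
  nlinarith

/-- A sequence of unit vectors, each in a coordinate space of its own. -/
structure IsUnitSequence (E : ℕ → X →L[ℂ] X) (ν : ℕ → ℕ) (d : ℕ → X) : Prop where
  strictMono : StrictMono ν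
  norm_eq : ∀ i, ‖d i‖ = 1
  supported : ∀ i, blockProj E {ν i} (d i) = d i

/-- Norms of disjoint sums are determined, up to the constant `C`, by the norms of the summands. -/
def IsDominationBound (E : ℕ → X →L[ℂ] X) (C : ℝ) : Prop :=
  ∀ (n : ℕ) (A B : ℕ → Finset ℕ) (x y : ℕ → X),
    IsDisjointlySupported E n A x → IsDisjointlySupported E n B y →
    (∀ i < n, ‖x i‖ ≤ ‖y i‖) →
    ‖∑ i ∈ Finset.range n, x i‖ ≤ C * ‖∑ i ∈ Finset.range n, y i‖

/-- When the supports of `x` and `y` overlap, multiples of unit vectors beyond both supports serve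
as intermediate vectors, so the disjoint case is applied twice. -/
theorem HasMRP.exists_domination [CompleteSpace X] (hX : HasMRP X)
    (hE : IsUnconditionalResolution E) {ν : ℕ → ℕ} {d : ℕ → X} (hd : IsUnitSequence E ν d) :
    ∃ C : ℝ, 1 ≤ C ∧ IsDominationBound E C := by
  obtain ⟨C, hC0, h⟩ := hX.exists_domination_of_disjoint hE
  refine ⟨C * C + 1, by nlinarith, fun n A B x y hx hy hxy => ?_⟩
  obtain ⟨N, hN⟩ : ∃ N, ∀ i < n, (∀ k ∈ A i, k < N) ∧ ∀ k ∈ B i, k < N := by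
    refine ⟨((Finset.range n).biUnion fun i => A i ∪ B i).sup id + 1, fun i hi => ?_⟩
    have key : ∀ k ∈ A i ∪ B i, k < ((Finset.range n).biUnion fun i => A i ∪ B i).sup id + 1 :=
      fun k hk => Nat.lt_succ_of_le (Finset.le_sup (f := id)
        (Finset.mem_biUnion.2 ⟨i, Finset.mem_range.2 hi, hk⟩))
    exact ⟨fun k hk => key k (Finset.mem_union_left _ hk),
      fun k hk => key k (Finset.mem_union_right _ hk)⟩
  have hz : IsDisjointlySupported E n (fun i => {ν (N + i)})
      (fun i => (‖x i‖ : ℂ) • d (N + i)) := by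
    refine ⟨fun i _ j _ hij => ?_, fun i _ => by rw [map_smul, hd.supported]⟩
    rw [Finset.disjoint_singleton]
    exact fun h => hij (by have := hd.strictMono.injective h; omega)
  have hnz : ∀ i, ‖(‖x i‖ : ℂ) • d (N + i)‖ = ‖x i‖ := fun i => by
    rw [norm_smul, hd.norm_eq, mul_one, Complex.norm_real, norm_norm]
  have hfar : ∀ j, N ≤ ν (N + j) := fun j => (Nat.le_add_right N j).trans (hd.strictMono.le_apply)
  have h1 := h n A (fun i => {ν (N + i)}) x _ hx hz (fun i hi j _ => by
    rw [Finset.disjoint_singleton_right]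
    intro hk
    have := (hN i hi).1 _ hk
    have := hfar j
    omega) fun i _ => (hnz i).ge
  have h2 := h n (fun i => {ν (N + i)}) B _ y hz hy (fun i _ j hj => by
    rw [Finset.disjoint_singleton_left]
    intro hk
    have := (hN j hj).2 _ hk
    have := hfar i
    omega) fun i hi => (hnz i).le.trans (hxy i hi)
  have h3 := mul_le_mul_of_nonneg_left h2 hC0
  nlinarith [norm_nonneg (∑ i ∈ Finset.range n, y i)]

end Domination

/-! ### The fundamental function is a power, and disjoint sums behave as in an `ℓ_p` space or in
`c₀`. -/

section PowerType

/-- A sequence with bounded defect of additivity is at bounded distance from a linear one. -/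
theorem exists_linear_approx {g : ℕ → ℝ} {c l : ℝ} (hc : 0 ≤ c)
    (h1 : ∀ j k, g (j + k) ≤ g j + g k + c) (h2 : ∀ j k, g j + g k ≤ g (j + k) + c)
    (hlow : ∀ k, 0 ≤ g k + c) (hup : ∀ k, g k ≤ l * k) (hl : 0 ≤ l) :
    ∃ L, 0 ≤ L ∧ L ≤ l ∧ ∀ k, |g k - L * k| ≤ c := by
  -- Both `g + c` and `c - g` are subadditive. Fekete's lemma gives their slopes, which are
  -- opposite, and each slope bounds its sequence from below.
  have s1 : Subadditive fun k => g k + c := fun j k => by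
    have := h1 j k
    simp only
    linarith
  have s2 : Subadditive fun k => c - g k := fun j k => by
    have := h2 j k
    simp only
    linarith
  have b1 : BddBelow (Set.range fun n : ℕ => (g n + c) / n) :=
    ⟨0, by rintro _ ⟨n, rfl⟩; exact div_nonneg (hlow n) (Nat.cast_nonneg n)⟩
  have b2 : BddBelow (Set.range fun n : ℕ => (c - g n) / n) := by
    refine ⟨-l, ?_⟩
    rintro _ ⟨n, rfl⟩
    rcases n.eq_zero_or_pos with rfl | hn
    · simpa using hl
    · have : (0 : ℝ) < n := by exact_mod_cast hn
      simp only
      rw [le_div_iff₀ this]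
      have := hup n
      linarith
  have t1 := s1.tendsto_lim b1
  have t2 := s2.tendsto_lim b2
  have hsum : s1.lim + s2.lim = 0 := by
    refine tendsto_nhds_unique (t1.add t2) ?_
    have : Tendsto (fun n : ℕ => 2 * c / (n : ℝ)) atTop (𝓝 0) :=
      tendsto_const_div_atTop_nhds_zero_nat _
    refine this.congr fun n => ?_
    rw [← add_div]
    congr 1
    ring
  have key : ∀ k : ℕ, |g k - s1.lim * k| ≤ c := by
    intro k
    rcases k.eq_zero_or_pos with rfl | hk
    · have := h1 0 0
      have := h2 0 0
      simp only [add_zero] at *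
      rw [abs_le]
      constructor <;> simp <;> linarith
    · have hk' : (0 : ℝ) < k := by exact_mod_cast hk
      have e1 := s1.lim_le_div b1 hk.ne'
      have e2 := s2.lim_le_div b2 hk.ne'
      rw [le_div_iff₀ hk'] at e1 e2
      have e3 : s2.lim = -s1.lim := by linarith
      rw [e3] at e2
      rw [abs_le]
      constructor <;> linarith
  refine ⟨s1.lim, ?_, ?_, key⟩
  · exact ge_of_tendsto' t1 fun n => div_nonneg (hlow n) (Nat.cast_nonneg n)
  · have : Tendsto (fun n : ℕ => l + c / (n : ℝ)) atTop (𝓝 (l + 0)) :=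
      tendsto_const_nhds.add (tendsto_const_div_atTop_nhds_zero_nat _)
    rw [add_zero] at this
    refine le_of_tendsto_of_tendsto t1 this ?_
    filter_upwards [eventually_gt_atTop 0] with n hn
    have hn' : (0 : ℝ) < n := by exact_mod_cast hn
    rw [div_le_iff₀ hn', add_mul, div_mul_cancel₀ _ hn'.ne']
    have := hup n
    linarith

variable {E : ℕ → X →L[ℂ] X} {ν : ℕ → ℕ} {d : ℕ → X} {C : ℝ}

theorem IsUnitSequence.isDisjointlySupported (hd : IsUnitSequence E ν d) {σ : ℕ → ℕ}
    (hσ : Function.Injective σ) (n : ℕ) (a : ℕ → ℂ) :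
    IsDisjointlySupported E n (fun i => {ν (σ i)}) (fun i => a i • d (σ i)) := by
  refine ⟨fun i _ j _ hij => ?_, fun i _ => by rw [map_smul, hd.supported]⟩
  rw [Finset.disjoint_singleton]
  exact fun h => hij (hσ (hd.strictMono.injective h))

/-- The norm of the sum of the first `n` unit vectors. -/
def fundNorm {Y : Type*} [NormedAddCommGroup Y] (d : ℕ → Y) (n : ℕ) : ℝ := ‖∑ i ∈ Finset.range n, d i‖

theorem fundNorm_nonneg {Y : Type*} [NormedAddCommGroup Y] (d : ℕ → Y) (n : ℕ) :
    0 ≤ fundNorm d n := norm_nonneg _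

theorem IsUnitSequence.norm_smul_eq (hd : IsUnitSequence E ν d) (a : ℝ) (i : ℕ) :
    ‖(a : ℂ) • d i‖ = |a| := by
  rw [norm_smul, hd.norm_eq, mul_one, Complex.norm_real, Real.norm_eq_abs]

theorem IsUnitSequence.fundNorm_le (hd : IsUnitSequence E ν d) (n : ℕ) : fundNorm d n ≤ n := by
  refine (norm_sum_le _ _).trans ?_
  simp [hd.norm_eq]

theorem IsUnitSequence.fundNorm_one (hd : IsUnitSequence E ν d) : fundNorm d 1 = 1 := by
  simp [fundNorm, hd.norm_eq]

theorem IsDominationBound.compare_shift (hC : IsDominationBound E C) (hd : IsUnitSequence E ν d)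
    (s n : ℕ) : ‖∑ l ∈ Finset.range n, d (s + l)‖ ≤ C * fundNorm d n ∧
      fundNorm d n ≤ C * ‖∑ l ∈ Finset.range n, d (s + l)‖ := by
  have h1 := hd.isDisjointlySupported (σ := fun l => s + l) (add_right_injective s) n fun _ => 1
  have h2 := hd.isDisjointlySupported Function.injective_id n fun _ => 1
  simp only [one_smul] at h1 h2
  exact ⟨hC n _ _ _ _ h1 h2 fun i _ => by simp [hd.norm_eq],
    hC n _ _ _ _ h2 h1 fun i _ => by simp [hd.norm_eq]⟩

theorem IsDominationBound.fundNorm_mono (hC : IsDominationBound E C) (hd : IsUnitSequence E ν d)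
    {m n : ℕ} (hmn : m ≤ n) : fundNorm d m ≤ C * fundNorm d n := by
  have h1 := hd.isDisjointlySupported Function.injective_id n fun i => if i < m then 1 else 0
  have h2 := hd.isDisjointlySupported Function.injective_id n fun _ => 1
  have h3 := hC n _ _ _ _ h1 h2 fun i _ => by split_ifs <;> simp
  simp only [ite_smul, one_smul, zero_smul, id] at h3
  rw [← Finset.sum_filter] at h3
  have h4 : (Finset.range n).filter (fun i => i < m) = Finset.range m := by
    ext i
    simp only [Finset.mem_range, Finset.mem_filter]
    omega
  rwa [h4] at h3

theorem sum_blocks {Y : Type*} [AddCommMonoid Y] (d : ℕ → Y) (k : ℕ → ℕ) (n : ℕ) :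
    ∑ i ∈ Finset.range n, ∑ l ∈ Finset.range (k i), d ((∑ j ∈ Finset.range i, k j) + l) =
      ∑ i ∈ Finset.range (∑ j ∈ Finset.range n, k j), d i := by
  induction n with
  | zero => simp
  | succ n ih => rw [Finset.sum_range_succ, ih, Finset.sum_range_succ _ n, Finset.sum_range_add]

theorem IsUnitSequence.isDisjointlySupported_blocks (hd : IsUnitSequence E ν d)
    (hE : IsUnconditionalResolution E) (k : ℕ → ℕ) (n : ℕ) :
    IsDisjointlySupported E n
      (fun i => (Finset.range (k i)).image fun l => ν ((∑ j ∈ Finset.range i, k j) + l))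
      (fun i => ∑ l ∈ Finset.range (k i), d ((∑ j ∈ Finset.range i, k j) + l)) := by
  have key : ∀ i j, i < j → Disjoint
      ((Finset.range (k i)).image fun l => ν ((∑ m ∈ Finset.range i, k m) + l))
      ((Finset.range (k j)).image fun l => ν ((∑ m ∈ Finset.range j, k m) + l)) := by
    intro i j hij
    rw [Finset.disjoint_left]
    intro a ha hb
    obtain ⟨l, hl, rfl⟩ := Finset.mem_image.1 ha
    obtain ⟨l', hl', h⟩ := Finset.mem_image.1 hb
    have h1 := hd.strictMono.injective h
    have h2 : ∑ m ∈ Finset.range (i + 1), k m ≤ ∑ m ∈ Finset.range j, k m :=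
      Finset.sum_le_sum_of_subset (Finset.range_subset_range.2 hij)
    rw [Finset.sum_range_succ] at h2
    have := Finset.mem_range.1 hl
    omega
  refine ⟨fun i _ j _ hij => ?_, fun i _ => ?_⟩
  · rcases lt_or_gt_of_ne hij with h | h
    · exact key i j h
    · exact (key j i h).symm
  · rw [map_sum]
    refine Finset.sum_congr rfl fun l hl => ?_
    refine hE.blockProj_of_subset ?_ (hd.supported _)
    rw [Finset.singleton_subset_iff]
    exact Finset.mem_image_of_mem _ hl

/-- A run of `k i` consecutive unit vectors is exchanged for a single one scaled by `fundNorm d (k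
i)`. One `C` moves the run to its position and one performs the exchange. -/
theorem IsDominationBound.fundNorm_sum (hC : IsDominationBound E C) (hC1 : 1 ≤ C)
    (hE : IsUnconditionalResolution E) (hd : IsUnitSequence E ν d) (k : ℕ → ℕ) (n : ℕ) :
    fundNorm d (∑ i ∈ Finset.range n, k i) ≤
        C ^ 2 * ‖∑ i ∈ Finset.range n, (fundNorm d (k i) : ℂ) • d i‖ ∧
      ‖∑ i ∈ Finset.range n, (fundNorm d (k i) : ℂ) • d i‖ ≤
        C ^ 2 * fundNorm d (∑ i ∈ Finset.range n, k i) := by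
  have hC0 : 0 ≤ C := by linarith
  have hb := hd.isDisjointlySupported_blocks hE k n
  have hf0 : ∀ m, 0 ≤ fundNorm d m := fun m => norm_nonneg _
  constructor
  · have h1 := hd.isDisjointlySupported Function.injective_id n fun i => ((C * fundNorm d (k i) : ℝ) : ℂ)
    have h2 := hC n _ _ _ _ hb h1 fun i _ => by
      rw [hd.norm_smul_eq, abs_of_nonneg (mul_nonneg hC0 (hf0 _))]
      exact (hC.compare_shift hd _ _).1
    rw [sum_blocks] at h2
    simp only [Complex.ofReal_mul, mul_smul, ← Finset.smul_sum, norm_smul, Complex.norm_real,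
      Real.norm_of_nonneg hC0, id] at h2
    rw [pow_two, mul_assoc]
    exact h2
  · have h1 := hd.isDisjointlySupported Function.injective_id n
      fun i => ((C⁻¹ * fundNorm d (k i) : ℝ) : ℂ)
    have h2 := hC n _ _ _ _ h1 hb fun i _ => by
      rw [hd.norm_smul_eq, abs_of_nonneg (mul_nonneg (inv_nonneg.2 hC0) (hf0 _)),
        inv_mul_le_iff₀ (by linarith)]
      exact (hC.compare_shift hd _ _).2
    rw [sum_blocks] at h2
    simp only [Complex.ofReal_mul, mul_smul, ← Finset.smul_sum, norm_smul, Complex.norm_real,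
      Real.norm_of_nonneg (inv_nonneg.2 hC0), id] at h2
    rw [inv_mul_le_iff₀ (by linarith)] at h2
    rw [pow_two, mul_assoc]
    exact h2

theorem IsDominationBound.fundNorm_mul (hC : IsDominationBound E C) (hC1 : 1 ≤ C)
    (hE : IsUnconditionalResolution E) (hd : IsUnitSequence E ν d) (n m : ℕ) :
    fundNorm d (n * m) ≤ C ^ 2 * (fundNorm d n * fundNorm d m) ∧
      fundNorm d n * fundNorm d m ≤ C ^ 2 * fundNorm d (n * m) := by
  have h := hC.fundNorm_sum hC1 hE hd (fun _ => m) n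
  have h1 : ‖∑ i ∈ Finset.range n, (fundNorm d m : ℂ) • d i‖ = fundNorm d n * fundNorm d m := by
    rw [← Finset.smul_sum, norm_smul, Complex.norm_real, Real.norm_of_nonneg (fundNorm_nonneg d m),
      mul_comm]
    rfl
  simpa only [h1, Finset.sum_const, Finset.card_range, smul_eq_mul] using h

/-- Near multiplicativity makes the logarithm of the fundamental function at powers of two nearly
additive, hence nearly linear. Near monotonicity fills in the other integers, and `α` lies in `[0,
1]` because for `n ≥ 1` the function lies between `C⁻¹` and `n`. -/
theorem IsDominationBound.exists_exponent (hC : IsDominationBound E C) (hC1 : 1 ≤ C)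
    (hE : IsUnconditionalResolution E) (hd : IsUnitSequence E ν d) :
    ∃ α c : ℝ, 0 ≤ α ∧ α ≤ 1 ∧ 1 ≤ c ∧ ∀ n : ℕ,
      fundNorm d n ≤ c * (n : ℝ) ^ α ∧ (1 ≤ n → (n : ℝ) ^ α ≤ c * fundNorm d n) := by
  have hC0 : 0 < C := by linarith
  have hlog : 0 ≤ Real.log C := Real.log_nonneg hC1
  have hge : ∀ n, 1 ≤ n → C⁻¹ ≤ fundNorm d n := fun n hn => by
    have := hC.fundNorm_mono hd hn
    rw [hd.fundNorm_one] at this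
    rwa [inv_le_iff_one_le_mul₀' hC0]
  have hpos : ∀ n, 1 ≤ n → 0 < fundNorm d n := fun n hn => (inv_pos.2 hC0).trans_le (hge n hn)
  have hpow : ∀ k : ℕ, 1 ≤ 2 ^ k := fun k => Nat.one_le_two_pow
  set g : ℕ → ℝ := fun k => Real.log (fundNorm d (2 ^ k)) with hg
  have hlogC : Real.log (C ^ 2) = 2 * Real.log C := by rw [Real.log_pow]; norm_num
  obtain ⟨L, hL0, hL1, hL⟩ := exists_linear_approx (g := g) (c := 2 * Real.log C) (l := Real.log 2)
    (by positivity)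
    (fun j k => by
      have h := (hC.fundNorm_mul hC1 hE hd (2 ^ j) (2 ^ k)).1
      rw [← pow_add] at h
      have h2 := Real.log_le_log (hpos _ (hpow _)) h
      rw [Real.log_mul (by positivity)
        (mul_pos (hpos _ (hpow _)) (hpos _ (hpow _))).ne', Real.log_mul (hpos _ (hpow _)).ne'
        (hpos _ (hpow _)).ne', hlogC] at h2
      simp only [hg]
      linarith)
    (fun j k => by
      have h := (hC.fundNorm_mul hC1 hE hd (2 ^ j) (2 ^ k)).2
      rw [← pow_add] at h
      have h2 := Real.log_le_log (mul_pos (hpos _ (hpow _)) (hpos _ (hpow _))) h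
      rw [Real.log_mul (hpos _ (hpow _)).ne' (hpos _ (hpow _)).ne', Real.log_mul (by positivity)
        (hpos _ (hpow _)).ne', hlogC] at h2
      simp only [hg]
      linarith)
    (fun k => by
      have := Real.log_le_log (by positivity) (hge _ (hpow k))
      rw [Real.log_inv] at this
      simp only [hg]
      linarith)
    (fun k => by
      have := Real.log_le_log (hpos _ (hpow k)) (hd.fundNorm_le (2 ^ k))
      push_cast at this
      rw [Real.log_pow] at this
      simp only [hg]
      linarith)
    (Real.log_nonneg (by norm_num))
  have hl2 : 0 < Real.log 2 := Real.log_pos (by norm_num)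
  set α := L / Real.log 2 with hα
  have hα0 : 0 ≤ α := by positivity
  have hα1 : α ≤ 1 := by rw [hα, div_le_one hl2]; exact hL1
  have hexp : ∀ k : ℕ, Real.exp (L * k) = ((2 : ℝ) ^ k) ^ α := by
    intro k
    rw [Real.rpow_def_of_pos (by positivity), Real.log_pow, hα]
    congr 1
    field_simp
  have hC2 : Real.exp (2 * Real.log C) = C ^ 2 := by
    rw [← hlogC, Real.exp_log (by positivity)]
  have hup : ∀ k : ℕ, fundNorm d (2 ^ k) ≤ C ^ 2 * ((2 : ℝ) ^ k) ^ α := by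
    intro k
    have h := (abs_le.1 (hL k)).2
    rw [← Real.exp_log (hpos _ (hpow k)), ← hexp, ← hC2, ← Real.exp_add]
    exact Real.exp_le_exp.2 (by simp only [hg] at h; linarith)
  have hlow : ∀ k : ℕ, ((2 : ℝ) ^ k) ^ α ≤ C ^ 2 * fundNorm d (2 ^ k) := by
    intro k
    have h := (abs_le.1 (hL k)).1
    rw [← Real.exp_log (hpos _ (hpow k)), ← hexp, ← hC2, ← Real.exp_add]
    exact Real.exp_le_exp.2 (by simp only [hg] at h; linarith)
  have h2α : (2 : ℝ) ^ α ≤ 2 := by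
    simpa using Real.rpow_le_rpow_of_exponent_le (by norm_num : (1 : ℝ) ≤ 2) hα1
  -- `C ^ 2` comes from powers of two, one more `C` from passing to a neighbouring power, and 2
  -- bounds `2 ^ α`.
  refine ⟨α, 2 * C ^ 3, hα0, hα1, by nlinarith [one_le_pow₀ hC1 (n := 3)], fun n => ⟨?_, fun hn => ?_⟩⟩
  · rcases n.eq_zero_or_pos with rfl | hn
    · simp only [fundNorm, Finset.range_zero, Finset.sum_empty, norm_zero]
      positivity
    · set k := Nat.log 2 n
      have hk1 : 2 ^ k ≤ n := Nat.pow_log_le_self 2 hn.ne'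
      have hk2 : n ≤ 2 ^ (k + 1) := (Nat.lt_pow_succ_log_self (by norm_num) n).le
      have h1 : ((2 : ℝ) ^ k) ^ α ≤ (n : ℝ) ^ α :=
        Real.rpow_le_rpow (by positivity) (by exact_mod_cast hk1) hα0
      calc fundNorm d n ≤ C * fundNorm d (2 ^ (k + 1)) := hC.fundNorm_mono hd hk2
        _ ≤ C * (C ^ 2 * ((2 : ℝ) ^ (k + 1)) ^ α) := by gcongr; exact hup _
        _ = C ^ 3 * (2 ^ α * ((2 : ℝ) ^ k) ^ α) := by
            rw [pow_succ (2 : ℝ) k, Real.mul_rpow (by positivity) (by norm_num)]; ring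
        _ ≤ C ^ 3 * (2 * (n : ℝ) ^ α) := by gcongr
        _ = _ := by ring
  · set k := Nat.log 2 n
    have hk1 : 2 ^ k ≤ n := Nat.pow_log_le_self 2 (by omega)
    have hk2 : n ≤ 2 ^ (k + 1) := (Nat.lt_pow_succ_log_self (by norm_num) n).le
    calc (n : ℝ) ^ α ≤ ((2 : ℝ) ^ (k + 1)) ^ α :=
          Real.rpow_le_rpow (by positivity) (by exact_mod_cast hk2) hα0
      _ = 2 ^ α * ((2 : ℝ) ^ k) ^ α := by
          rw [pow_succ (2 : ℝ) k, Real.mul_rpow (by positivity) (by norm_num)]; ring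
      _ ≤ 2 * (C ^ 2 * (C * fundNorm d n)) := by
          refine mul_le_mul h2α ((hlow k).trans ?_) (by positivity) (by norm_num)
          gcongr
          exact hC.fundNorm_mono hd hk1
      _ = _ := by ring

theorem IsDominationBound.norm_sum_le_of_le (hC : IsDominationBound E C)
    (hd : IsUnitSequence E ν d) {n : ℕ} {a b : ℕ → ℝ} {c : ℝ} (hc : 0 ≤ c)
    (h : ∀ i < n, |a i| ≤ c * |b i|) :
    ‖∑ i ∈ Finset.range n, (a i : ℂ) • d i‖ ≤ C * (c * ‖∑ i ∈ Finset.range n, (b i : ℂ) • d i‖) := by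
  have h1 := hd.isDisjointlySupported Function.injective_id n fun i => (a i : ℂ)
  have h2 := hd.isDisjointlySupported Function.injective_id n fun i => ((c * b i : ℝ) : ℂ)
  have h3 := hC n _ _ _ _ h1 h2 fun i hi => by
    rw [hd.norm_smul_eq, hd.norm_smul_eq, abs_mul, abs_of_nonneg hc]
    exact h i hi
  simpa only [Complex.ofReal_mul, mul_smul, ← Finset.smul_sum, norm_smul, Complex.norm_real,
      Real.norm_of_nonneg hc, id] using h3

/-- A coefficient `a i`, scaled by `H ^ α`, is exchanged for a run of about `H * a i ^ α⁻¹` unit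
vectors. The total length is about `H * W`, so the norm is about `(H * W) ^ α`, and the scale `H`
cancels. -/
theorem IsDominationBound.norm_sum_le_rpow (hC : IsDominationBound E C) (hC1 : 1 ≤ C)
    (hE : IsUnconditionalResolution E) (hd : IsUnitSequence E ν d) {α c : ℝ} (hα : 0 < α)
    (hα1 : α ≤ 1) (hc : 1 ≤ c)
    (hφ : ∀ n : ℕ, fundNorm d n ≤ c * (n : ℝ) ^ α ∧ (1 ≤ n → (n : ℝ) ^ α ≤ c * fundNorm d n))
    (n : ℕ) (a : ℕ → ℝ) (ha : ∀ i, 0 ≤ a i) :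
    ‖∑ i ∈ Finset.range n, (a i : ℂ) • d i‖ ≤
      2 * C ^ 3 * c ^ 2 * (∑ i ∈ Finset.range n, a i ^ α⁻¹) ^ α := by
  set W := ∑ i ∈ Finset.range n, a i ^ α⁻¹ with hW
  have hW0 : 0 ≤ W := Finset.sum_nonneg fun i _ => Real.rpow_nonneg (ha i) _
  rcases hW0.eq_or_lt with h0 | h0
  · have : ∀ i ∈ Finset.range n, a i = 0 := fun i hi => by
      have := (Finset.sum_eq_zero_iff_of_nonneg fun i _ => Real.rpow_nonneg (ha i) _).1 h0.symm i hi
      exact (Real.rpow_eq_zero (ha i) (inv_ne_zero hα.ne')).1 this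
    rw [Finset.sum_eq_zero fun i hi => by rw [this i hi]; simp, norm_zero]
    positivity
  -- Rounding up adds at most `n` to the total length, which is less than `H * W`.
  obtain ⟨H, hH⟩ := exists_nat_gt (n / W)
  rw [div_lt_iff₀ h0] at hH
  have hH0 : (0 : ℝ) < H := by
    by_contra hcon
    have : (n : ℝ) < 0 := hH.trans_le (mul_nonpos_of_nonpos_of_nonneg (not_lt.1 hcon) h0.le)
    exact absurd (Nat.cast_nonneg (α := ℝ) n) (not_le.2 this)
  have hHα : 0 < (H : ℝ) ^ α := Real.rpow_pos_of_pos hH0 α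
  let k : ℕ → ℕ := fun i => ⌈H * a i ^ α⁻¹⌉₊
  have hk : ∀ i, (H : ℝ) ^ α * a i ≤ c * fundNorm d (k i) := by
    intro i
    rcases (ha i).eq_or_lt with h | h
    · rw [← h, mul_zero]
      exact mul_nonneg (by linarith) (norm_nonneg _)
    · have h1 : 0 < H * a i ^ α⁻¹ := mul_pos hH0 (Real.rpow_pos_of_pos h _)
      refine le_trans ?_ ((hφ (k i)).2 (Nat.ceil_pos.2 h1))
      have h2 := Real.rpow_le_rpow h1.le (Nat.le_ceil (H * a i ^ α⁻¹)) hα.le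
      rwa [Real.mul_rpow hH0.le (Real.rpow_nonneg (ha i) _), Real.rpow_inv_rpow (ha i) hα.ne'] at h2
  have hsum : ((∑ i ∈ Finset.range n, k i : ℕ) : ℝ) ≤ 2 * (H * W) := by
    push_cast
    calc ∑ i ∈ Finset.range n, (k i : ℝ) ≤ ∑ i ∈ Finset.range n, (H * a i ^ α⁻¹ + 1) :=
          Finset.sum_le_sum fun i _ => (Nat.ceil_lt_add_one
            (mul_nonneg hH0.le (Real.rpow_nonneg (ha i) _))).le
      _ = H * W + n := by rw [Finset.sum_add_distrib, ← Finset.mul_sum]; simp [hW]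
      _ ≤ 2 * (H * W) := by linarith
  have h1 := hC.norm_sum_le_of_le hd (n := n) (a := fun i => (H : ℝ) ^ α * a i)
    (b := fun i => fundNorm d (k i)) (c := c) (by linarith) fun i _ => by
      rw [abs_of_nonneg (mul_nonneg hHα.le (ha i)), abs_of_nonneg (fundNorm_nonneg d _)]
      exact hk i
  simp only [Complex.ofReal_mul, mul_smul, ← Finset.smul_sum, norm_smul, Complex.norm_real,
    Real.norm_of_nonneg hHα.le] at h1
  have h2 := (hC.fundNorm_sum hC1 hE hd k n).2
  have h3 := (hφ (∑ i ∈ Finset.range n, k i)).1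
  have h4 : ((∑ i ∈ Finset.range n, k i : ℕ) : ℝ) ^ α ≤ 2 * ((H : ℝ) ^ α * W ^ α) := by
    refine (Real.rpow_le_rpow (Nat.cast_nonneg _) hsum hα.le).trans ?_
    rw [Real.mul_rpow (by norm_num) (by positivity), Real.mul_rpow hH0.le hW0]
    have h2α : (2 : ℝ) ^ α ≤ 2 := by
      simpa using Real.rpow_le_rpow_of_exponent_le (by norm_num : (1 : ℝ) ≤ 2) hα1
    gcongr
  have h5 : (H : ℝ) ^ α * ‖∑ i ∈ Finset.range n, (a i : ℂ) • d i‖ ≤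
      (H : ℝ) ^ α * (2 * C ^ 3 * c ^ 2 * W ^ α) := by
    calc _ ≤ _ := h1
      _ ≤ C * (c * (C ^ 2 * (c * (2 * ((H : ℝ) ^ α * W ^ α))))) := by
          gcongr
          refine h2.trans ?_
          gcongr
          exact h3.trans (by gcongr)
      _ = _ := by ring
  exact le_of_mul_le_mul_left h5 hHα

theorem IsDominationBound.rpow_le_norm_sum (hC : IsDominationBound E C) (hC1 : 1 ≤ C)
    (hE : IsUnconditionalResolution E) (hd : IsUnitSequence E ν d) {α c : ℝ} (hα : 0 < α)
    (hα1 : α ≤ 1) (hc : 1 ≤ c)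
    (hφ : ∀ n : ℕ, fundNorm d n ≤ c * (n : ℝ) ^ α ∧ (1 ≤ n → (n : ℝ) ^ α ≤ c * fundNorm d n))
    (n : ℕ) (a : ℕ → ℝ) (ha : ∀ i, 0 ≤ a i) :
    (∑ i ∈ Finset.range n, a i ^ α⁻¹) ^ α ≤
      2 * C ^ 3 * c ^ 2 * ‖∑ i ∈ Finset.range n, (a i : ℂ) • d i‖ := by
  set W := ∑ i ∈ Finset.range n, a i ^ α⁻¹ with hW
  have hW0 : 0 ≤ W := Finset.sum_nonneg fun i _ => Real.rpow_nonneg (ha i) _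
  rcases hW0.eq_or_lt with h0 | h0
  · rw [← h0, Real.zero_rpow hα.ne']
    positivity
  -- Rounding down loses at most `n`, less than half of `H * W`; in particular the total length is
  -- positive.
  obtain ⟨H, hH⟩ := exists_nat_gt (2 * n / W)
  rw [div_lt_iff₀ h0] at hH
  have hH0 : (0 : ℝ) < H := by
    by_contra hcon
    have : (2 * n : ℝ) < 0 := hH.trans_le (mul_nonpos_of_nonpos_of_nonneg (not_lt.1 hcon) h0.le)
    have := Nat.cast_nonneg (α := ℝ) n
    linarith
  have hHα : 0 < (H : ℝ) ^ α := Real.rpow_pos_of_pos hH0 α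
  let k : ℕ → ℕ := fun i => ⌊H * a i ^ α⁻¹⌋₊
  have hk : ∀ i, fundNorm d (k i) ≤ c * ((H : ℝ) ^ α * a i) := by
    intro i
    have h1 : 0 ≤ H * a i ^ α⁻¹ := mul_nonneg hH0.le (Real.rpow_nonneg (ha i) _)
    refine (hφ (k i)).1.trans ?_
    have h2 := Real.rpow_le_rpow (Nat.cast_nonneg _) (Nat.floor_le h1) hα.le
    rw [Real.mul_rpow hH0.le (Real.rpow_nonneg (ha i) _), Real.rpow_inv_rpow (ha i) hα.ne'] at h2
    gcongr
  have hsum : H * W ≤ 2 * ((∑ i ∈ Finset.range n, k i : ℕ) : ℝ) := by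
    push_cast
    have : H * W - n ≤ ∑ i ∈ Finset.range n, (k i : ℝ) := by
      calc H * W - n = ∑ i ∈ Finset.range n, (H * a i ^ α⁻¹ - 1) := by
            rw [Finset.sum_sub_distrib, ← Finset.mul_sum]; simp [hW]
        _ ≤ ∑ i ∈ Finset.range n, (k i : ℝ) :=
            Finset.sum_le_sum fun i _ => (Nat.sub_one_lt_floor _).le
    linarith
  have hsum1 : 1 ≤ ∑ i ∈ Finset.range n, k i := by
    have h1 : 0 < H * W := mul_pos hH0 h0
    have h2 : (0 : ℝ) < ((∑ i ∈ Finset.range n, k i : ℕ) : ℝ) := by linarith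
    exact_mod_cast h2
  have h1 := hC.norm_sum_le_of_le hd (n := n) (a := fun i => fundNorm d (k i))
    (b := fun i => (H : ℝ) ^ α * a i) (c := c) (by linarith) fun i _ => by
      rw [abs_of_nonneg (mul_nonneg hHα.le (ha i)), abs_of_nonneg (fundNorm_nonneg d _)]
      exact hk i
  simp only [Complex.ofReal_mul, mul_smul, ← Finset.smul_sum, norm_smul, Complex.norm_real,
    Real.norm_of_nonneg hHα.le] at h1
  have h2 := (hC.fundNorm_sum hC1 hE hd k n).1
  have h3 := (hφ (∑ i ∈ Finset.range n, k i)).2 hsum1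
  have h4 : (H : ℝ) ^ α * W ^ α ≤ 2 * ((∑ i ∈ Finset.range n, k i : ℕ) : ℝ) ^ α := by
    rw [← Real.mul_rpow hH0.le hW0]
    refine (Real.rpow_le_rpow (by positivity) hsum hα.le).trans ?_
    rw [Real.mul_rpow (by norm_num) (by positivity)]
    have h2α : (2 : ℝ) ^ α ≤ 2 := by
      simpa using Real.rpow_le_rpow_of_exponent_le (by norm_num : (1 : ℝ) ≤ 2) hα1
    gcongr
  have h5 : (H : ℝ) ^ α * W ^ α ≤
      (H : ℝ) ^ α * (2 * C ^ 3 * c ^ 2 * ‖∑ i ∈ Finset.range n, (a i : ℂ) • d i‖) := by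
    calc _ ≤ _ := h4
      _ ≤ 2 * (c * (C ^ 2 * (C * (c * ((H : ℝ) ^ α *
            ‖∑ i ∈ Finset.range n, (a i : ℂ) • d i‖))))) := by
          gcongr
          refine h3.trans ?_
          gcongr
          exact h2.trans (by gcongr)
      _ = _ := by ring
  exact le_of_mul_le_mul_left h5 hHα

/-- Disjoint sums behave like sums in `ℓ_{1/α}` (if `α > 0`) or in `c₀` (if `α = 0`). -/
structure HasPowerType (E : ℕ → X →L[ℂ] X) (α c : ℝ) : Prop where
  nonneg : 0 ≤ α
  le_one : α ≤ 1
  one_le : 1 ≤ c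
  upper : 0 < α → ∀ (n : ℕ) (A : ℕ → Finset ℕ) (x : ℕ → X), IsDisjointlySupported E n A x →
    ‖∑ i ∈ Finset.range n, x i‖ ≤ c * (∑ i ∈ Finset.range n, ‖x i‖ ^ α⁻¹) ^ α
  lower : 0 < α → ∀ (n : ℕ) (A : ℕ → Finset ℕ) (x : ℕ → X), IsDisjointlySupported E n A x →
    (∑ i ∈ Finset.range n, ‖x i‖ ^ α⁻¹) ^ α ≤ c * ‖∑ i ∈ Finset.range n, x i‖
  upper_zero : α = 0 → ∀ (n : ℕ) (A : ℕ → Finset ℕ) (x : ℕ → X) (R : ℝ), 0 ≤ R →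
    IsDisjointlySupported E n A x → (∀ i < n, ‖x i‖ ≤ R) → ‖∑ i ∈ Finset.range n, x i‖ ≤ c * R

/-- Domination exchanges each `x i` for `‖x i‖ • d i`, to which the estimates for positive
coefficients apply. For `α = 0` the bounded fundamental function gives the `c₀` estimate. -/
theorem IsDominationBound.exists_hasPowerType (hC : IsDominationBound E C) (hC1 : 1 ≤ C)
    (hE : IsUnconditionalResolution E) (hd : IsUnitSequence E ν d) :
    ∃ α c : ℝ, HasPowerType E α c := by
  obtain ⟨α, c, hα0, hα1, hc, hφ⟩ := hC.exists_exponent hC1 hE hd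
  have hC0 : 0 ≤ C := by linarith
  have hc0 : 0 ≤ c := by linarith
  have hcomp : ∀ (n : ℕ) (A : ℕ → Finset ℕ) (x : ℕ → X), IsDisjointlySupported E n A x →
      ‖∑ i ∈ Finset.range n, x i‖ ≤ C * ‖∑ i ∈ Finset.range n, (‖x i‖ : ℂ) • d i‖ ∧
      ‖∑ i ∈ Finset.range n, (‖x i‖ : ℂ) • d i‖ ≤ C * ‖∑ i ∈ Finset.range n, x i‖ := by
    intro n A x hx
    have h1 := hd.isDisjointlySupported Function.injective_id n fun i => (‖x i‖ : ℂ)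
    exact ⟨hC n _ _ _ _ hx h1 fun i _ => by rw [hd.norm_smul_eq, abs_norm],
      hC n _ _ _ _ h1 hx fun i _ => by rw [hd.norm_smul_eq, abs_norm]⟩
  have hle : 1 ≤ C * (2 * C ^ 3 * c ^ 2) := by
    have h1 := one_le_pow₀ hC1 (n := 3)
    have h2 := one_le_pow₀ hc (n := 2)
    have h3 : 1 ≤ C ^ 3 * c ^ 2 := one_le_mul_of_one_le_of_one_le h1 h2
    nlinarith
  refine ⟨α, C * (2 * C ^ 3 * c ^ 2), hα0, hα1, hle, fun hα n A x hx => ?_, fun hα n A x hx => ?_,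
    fun hα n A x R hR hx hxR => ?_⟩
  · refine (hcomp n A x hx).1.trans ?_
    rw [mul_assoc C]
    gcongr
    exact hC.norm_sum_le_rpow hC1 hE hd hα hα1 hc hφ n (fun i => ‖x i‖) fun i => norm_nonneg _
  · refine (hC.rpow_le_norm_sum hC1 hE hd hα hα1 hc hφ n (fun i => ‖x i‖)
      fun i => norm_nonneg _).trans ?_
    calc _ ≤ 2 * C ^ 3 * c ^ 2 * (C * ‖∑ i ∈ Finset.range n, x i‖) := by
          gcongr
          exact (hcomp n A x hx).2
      _ = _ := by ring
  · have h1 := hd.isDisjointlySupported Function.injective_id n fun _ => (R : ℂ)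
    have h2 := hC n _ _ _ _ hx h1 fun i hi => by
      rw [hd.norm_smul_eq, abs_of_nonneg hR]; exact hxR i hi
    rw [← Finset.smul_sum, norm_smul, Complex.norm_real, Real.norm_of_nonneg hR] at h2
    have h3 := (hφ n).1
    rw [hα, Real.rpow_zero, mul_one] at h3
    have h4 : ‖∑ i ∈ Finset.range n, d (id i)‖ ≤ 2 * C ^ 3 * c ^ 2 := by
      refine h3.trans ?_
      have h5 := one_le_pow₀ hC1 (n := 3)
      have h6 : c ≤ c ^ 2 := by nlinarith
      have h7 : c ^ 2 ≤ C ^ 3 * c ^ 2 := le_mul_of_one_le_left (by positivity) h5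
      have h8 : 0 ≤ C ^ 3 * c ^ 2 := by positivity
      linarith
    calc _ ≤ _ := h2
      _ ≤ C * (R * (2 * C ^ 3 * c ^ 2)) := by gcongr
      _ = _ := by ring

end PowerType

/-! ### Finite-dimensional `ℓ_{1/α}` norms. -/

section EllNorm

variable {Ω Ξ : Type*} [Fintype Ω] [Fintype Ξ]

/-- The norm of `ℓ_{1/α}` on a finite index set. -/
def ellNorm (α : ℝ) (a : Ω → ℂ) : ℝ := (∑ ω, ‖a ω‖ ^ α⁻¹) ^ α

theorem ellNorm_nonneg (α : ℝ) (a : Ω → ℂ) : 0 ≤ ellNorm α a := by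
  unfold ellNorm; positivity

theorem ellNorm_mono {α : ℝ} (hα : 0 < α) {a b : Ω → ℂ} (h : ∀ ω, ‖a ω‖ ≤ ‖b ω‖) :
    ellNorm α a ≤ ellNorm α b := by
  unfold ellNorm
  refine Real.rpow_le_rpow (by positivity) (Finset.sum_le_sum fun ω _ => ?_) hα.le
  exact Real.rpow_le_rpow (norm_nonneg _) (h ω) (inv_nonneg.2 hα.le)

theorem ellNorm_add_le {α : ℝ} (hα : 0 < α) (hα1 : α ≤ 1) (a b : Ω → ℂ) :
    ellNorm α (a + b) ≤ ellNorm α a + ellNorm α b := by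
  have h := Real.Lp_add_le Finset.univ (fun ω => ‖a ω‖) (fun ω => ‖b ω‖) (p := α⁻¹)
    ((one_le_inv₀ hα).2 hα1)
  simp only [one_div, inv_inv, abs_norm] at h
  refine le_trans ?_ h
  unfold ellNorm
  refine Real.rpow_le_rpow (by positivity) (Finset.sum_le_sum fun ω _ => ?_) hα.le
  refine Real.rpow_le_rpow (norm_nonneg _) ?_ (inv_nonneg.2 hα.le)
  exact (norm_add_le _ _).trans (le_abs_self _)

theorem norm_apply_le_ellNorm {α : ℝ} (hα : 0 < α) (a : Ω → ℂ) (ω : Ω) : ‖a ω‖ ≤ ellNorm α a := by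
  have h : ‖a ω‖ ^ α⁻¹ ≤ ∑ ω, ‖a ω‖ ^ α⁻¹ :=
    Finset.single_le_sum (f := fun ω => ‖a ω‖ ^ α⁻¹) (fun ω _ => by positivity)
      (Finset.mem_univ ω)
  have := Real.rpow_le_rpow (by positivity) h hα.le
  rwa [Real.rpow_inv_rpow (norm_nonneg _) hα.ne'] at this

theorem ellNorm_single [DecidableEq Ω] {α : ℝ} (hα : 0 < α) (ω : Ω) (z : ℂ) :
    ellNorm α (Pi.single ω z) = ‖z‖ := by
  unfold ellNorm
  rw [Finset.sum_eq_single ω]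
  · rw [Pi.single_eq_same, Real.rpow_inv_rpow (norm_nonneg _) hα.ne']
  · intro ω' _ h
    rw [Pi.single_eq_of_ne h, norm_zero, Real.zero_rpow (inv_ne_zero hα.ne')]
  · exact fun h => absurd (Finset.mem_univ ω) h

theorem ellNorm_of_unimodular (α : ℝ) {a : Ω → ℂ} (h : ∀ ω, ‖a ω‖ = 1) :
    ellNorm α a = (Fintype.card Ω : ℝ) ^ α := by
  simp [ellNorm, h]

theorem ellNorm_smul {α : ℝ} (hα : 0 < α) (z : ℂ) (a : Ω → ℂ) :
    ellNorm α (z • a) = ‖z‖ * ellNorm α a := by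
  unfold ellNorm
  simp only [Pi.smul_apply, norm_smul]
  rw [← Real.rpow_inv_rpow (norm_nonneg z) hα.ne', ← Real.mul_rpow (by positivity) (by positivity),
    Finset.mul_sum]
  congr 1
  refine Finset.sum_congr rfl fun ω _ => ?_
  rw [Real.rpow_inv_rpow (norm_nonneg z) hα.ne', Real.mul_rpow (norm_nonneg _) (norm_nonneg _)]

theorem ellNorm_comp_inl_le {α : ℝ} (hα : 0 < α) (a : Ω ⊕ Ξ → ℂ) :
    ellNorm α (fun i => a (Sum.inl i)) ≤ ellNorm α a := by
  unfold ellNorm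
  refine Real.rpow_le_rpow (by positivity) ?_ hα.le
  rw [Fintype.sum_sum_type]
  exact le_add_of_nonneg_right (by positivity)

theorem ellNorm_comp_inr_le {α : ℝ} (hα : 0 < α) (a : Ω ⊕ Ξ → ℂ) :
    ellNorm α (fun i => a (Sum.inr i)) ≤ ellNorm α a := by
  unfold ellNorm
  refine Real.rpow_le_rpow (by positivity) ?_ hα.le
  rw [Fintype.sum_sum_type]
  exact le_add_of_nonneg_left (by positivity)

theorem ellNorm_sum_le {α : ℝ} (hα : 0 < α) (hα1 : α ≤ 1) (a : Ω ⊕ Ξ → ℂ) :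
    ellNorm α a ≤ ellNorm α (fun i => a (Sum.inl i)) + ellNorm α (fun i => a (Sum.inr i)) := by
  have h : a = Sum.elim (fun i => a (Sum.inl i)) (fun _ => 0) +
      Sum.elim (fun _ => 0) (fun i => a (Sum.inr i)) := by
    ext (i | i) <;> simp
  conv_lhs => rw [h]
  refine (ellNorm_add_le hα hα1 _ _).trans (le_of_eq ?_)
  simp [ellNorm, Real.zero_rpow (inv_ne_zero hα.ne')]

/-- The Hölder inequality. -/
theorem norm_sum_mul_le_ellNorm {α : ℝ} (hα : 0 < α) (hα1 : α < 1) (a b : Ω → ℂ) :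
    ‖∑ ω, a ω * b ω‖ ≤ ellNorm (1 - α) a * ellNorm α b := by
  have hpq : ((1 - α)⁻¹).HolderConjugate α⁻¹ := by
    rw [Real.holderConjugate_iff]
    refine ⟨(one_lt_inv₀ (by linarith)).2 (by linarith), ?_⟩
    rw [inv_inv, inv_inv]; ring
  have h := Real.inner_le_Lp_mul_Lq Finset.univ (fun ω => ‖a ω‖) (fun ω => ‖b ω‖) hpq
  simp only [one_div, inv_inv, abs_norm] at h
  refine le_trans ?_ h
  refine (norm_sum_le _ _).trans (le_of_eq ?_)
  simp only [norm_mul]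

end EllNorm

/-! ### Khinchine inequalities on the discrete cube. -/

section Khinchine

/-- The sign attached to a Boolean. -/
def boolSign (b : Bool) : ℝ := if b then 1 else -1

/-- The Rademacher sum with the given coefficients. -/
def radSum {k : ℕ} (ρ : Fin k → ℂ) (ω : Fin k → Bool) : ℂ := ∑ i, ρ i * boolSign (ω i)

/-- Independence factors the sum, and each factor obeys `cosh x ≤ exp (x ^ 2 / 2)`. -/
theorem sum_exp_boolSign_le {k : ℕ} (σ : Fin k → ℝ) :
    ∑ ω : Fin k → Bool, Real.exp (∑ i, σ i * boolSign (ω i)) ≤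
      2 ^ k * Real.exp ((∑ i, σ i ^ 2) / 2) := by
  have h1 : ∑ ω : Fin k → Bool, Real.exp (∑ i, σ i * boolSign (ω i)) =
      ∏ i, ∑ b : Bool, Real.exp (σ i * boolSign b) := by
    rw [Finset.prod_univ_sum, Fintype.piFinset_univ]
    exact Finset.sum_congr rfl fun ω _ => Real.exp_sum _ _
  rw [h1]
  have h2 : ∀ i, ∑ b : Bool, Real.exp (σ i * boolSign b) ≤ 2 * Real.exp (σ i ^ 2 / 2) := by
    intro i
    have := Real.cosh_le_exp_half_sq (σ i)
    rw [Real.cosh_eq] at this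
    simp only [Fintype.sum_bool, boolSign, if_true, mul_one]
    simp
    linarith
  refine (Finset.prod_le_prod (fun i _ => by positivity) fun i _ => h2 i).trans (le_of_eq ?_)
  rw [Finset.prod_mul_distrib, ← Real.exp_sum, Finset.sum_div]
  simp

theorem abs_rpow_le_exp {q : ℝ} (hq : 0 ≤ q) (x : ℝ) :
    |x| ^ q ≤ (1 + (⌈q⌉₊.factorial : ℝ)) * (Real.exp x + Real.exp (-x)) := by
  have h1 : |x| ^ q ≤ 1 + |x| ^ ⌈q⌉₊ := by
    rcases le_total |x| 1 with h | h
    · have := Real.rpow_le_one (abs_nonneg x) h hq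
      have : 0 ≤ |x| ^ ⌈q⌉₊ := by positivity
      linarith
    · have := Real.rpow_le_rpow_of_exponent_le h (Nat.le_ceil q)
      rw [Real.rpow_natCast] at this
      linarith
  have h2 := Real.pow_div_factorial_le_exp |x| (abs_nonneg x) ⌈q⌉₊
  rw [div_le_iff₀ (by positivity)] at h2
  have h3 : Real.exp |x| ≤ Real.exp x + Real.exp (-x) := Real.exp_abs_le x
  have h4 : 1 ≤ Real.exp |x| := Real.one_le_exp (abs_nonneg x)
  calc |x| ^ q ≤ 1 + |x| ^ ⌈q⌉₊ := h1
    _ ≤ (1 + (⌈q⌉₊.factorial : ℝ)) * Real.exp |x| := by nlinarith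
    _ ≤ _ := by gcongr

theorem ellNorm_half_sq {Ω : Type*} [Fintype Ω] (a : Ω → ℂ) :
    ellNorm (1 / 2) a ^ 2 = ∑ ω, ‖a ω‖ ^ 2 := by
  unfold ellNorm
  rw [← Real.rpow_natCast, ← Real.rpow_mul (by positivity)]
  norm_num

/-- After normalising the coefficients in `ℓ_2`, the subgaussian bound at parameters 1 and -1
controls every moment, since a power is dominated by exponentials. -/
theorem exists_khinchine_real {α : ℝ} (hα : 0 < α) :
    ∃ κ : ℝ, 0 ≤ κ ∧ ∀ (k : ℕ) (σ : Fin k → ℝ),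
      ellNorm α (radSum fun i => (σ i : ℂ)) ≤
        κ * ((2 : ℝ) ^ k) ^ α * ellNorm (1 / 2) fun i => (σ i : ℂ) := by
  set Q := 1 + (⌈α⁻¹⌉₊.factorial : ℝ) with hQ
  have hQ0 : 0 ≤ Q := by positivity
  refine ⟨(Q * (2 * Real.exp (1 / 2))) ^ α, by positivity, fun k σ => ?_⟩
  set l := ellNorm (1 / 2) (fun i => (σ i : ℂ)) with hl
  have hl0 : 0 ≤ l := ellNorm_nonneg _ _
  have hsq : l ^ 2 = ∑ i, σ i ^ 2 := by
    rw [hl, ellNorm_half_sq]; simp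
  rcases hl0.eq_or_lt with h0 | h0
  · have hσ : ∀ i, σ i = 0 := by
      intro i
      have h1 : ∑ i, σ i ^ 2 = 0 := by rw [← hsq, ← h0]; norm_num
      have := (Finset.sum_eq_zero_iff_of_nonneg fun i _ => sq_nonneg (σ i)).1 h1 i (Finset.mem_univ i)
      simpa using this
    have : (radSum fun i => (σ i : ℂ)) = 0 := by
      ext ω; simp [radSum, hσ]
    rw [this]
    have h2 : ellNorm α (0 : (Fin k → Bool) → ℂ) = 0 := by
      simp [ellNorm, Real.zero_rpow (inv_ne_zero hα.ne'), Real.zero_rpow hα.ne']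
    rw [h2]
    positivity
  have hσ' : ∑ i, (σ i / l) ^ 2 = 1 := by
    simp only [div_pow]
    rw [← Finset.sum_div, ← hsq, div_self (by positivity)]
  set x : (Fin k → Bool) → ℝ := fun ω => ∑ i, σ i / l * boolSign (ω i) with hx
  have h1 : (radSum fun i => (σ i : ℂ)) = (l : ℂ) • fun ω => ((x ω : ℝ) : ℂ) := by
    ext ω
    simp only [radSum, hx, Pi.smul_apply, smul_eq_mul]
    push_cast
    rw [Finset.mul_sum]
    refine Finset.sum_congr rfl fun i _ => ?_
    have : (l : ℂ) ≠ 0 := by exact_mod_cast h0.ne'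
    field_simp
  have h2 : ∑ ω, |x ω| ^ α⁻¹ ≤ Q * (2 * Real.exp (1 / 2)) * 2 ^ k := by
    have e1 := sum_exp_boolSign_le fun i => σ i / l
    have e2 := sum_exp_boolSign_le fun i => -(σ i / l)
    simp only [neg_sq, hσ', neg_mul, Finset.sum_neg_distrib] at e1 e2
    calc ∑ ω, |x ω| ^ α⁻¹ ≤ ∑ ω, Q * (Real.exp (x ω) + Real.exp (-x ω)) :=
          Finset.sum_le_sum fun ω _ => abs_rpow_le_exp (inv_nonneg.2 hα.le) _
      _ = Q * (∑ ω, Real.exp (x ω) + ∑ ω, Real.exp (-x ω)) := by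
          rw [← Finset.mul_sum, Finset.sum_add_distrib]
      _ ≤ Q * (2 ^ k * Real.exp (1 / 2) + 2 ^ k * Real.exp (1 / 2)) := by gcongr
      _ = _ := by ring
  rw [h1, ellNorm_smul hα, Complex.norm_real, Real.norm_of_nonneg hl0, mul_comm]
  refine mul_le_mul_of_nonneg_right ?_ hl0
  rw [← Real.mul_rpow (by positivity) (by positivity)]
  unfold ellNorm
  simp only [Complex.norm_real, Real.norm_eq_abs]
  exact Real.rpow_le_rpow (by positivity) h2 hα.le

/-- The upper Khinchine inequality. -/
theorem exists_khinchine {α : ℝ} (hα : 0 < α) (hα1 : α ≤ 1) :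
    ∃ κ : ℝ, 0 ≤ κ ∧ ∀ (k : ℕ) (ρ : Fin k → ℂ),
      ellNorm α (radSum ρ) ≤ κ * ((2 : ℝ) ^ k) ^ α * ellNorm (1 / 2) ρ := by
  obtain ⟨κ, hκ, h⟩ := exists_khinchine_real hα
  refine ⟨2 * κ, by positivity, fun k ρ => ?_⟩
  have h1 : radSum ρ = (radSum fun i => ((ρ i).re : ℂ)) +
      Complex.I • radSum fun i => ((ρ i).im : ℂ) := by
    ext ω
    simp only [radSum, Pi.add_apply, Pi.smul_apply, smul_eq_mul, Finset.mul_sum]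
    rw [← Finset.sum_add_distrib]
    refine Finset.sum_congr rfl fun i _ => ?_
    conv_lhs => rw [← Complex.re_add_im (ρ i)]
    ring
  have h2 : ellNorm (1 / 2) (fun i => ((ρ i).re : ℂ)) ≤ ellNorm (1 / 2) ρ :=
    ellNorm_mono (by norm_num) fun i => by
      rw [Complex.norm_real]; exact Complex.abs_re_le_norm _
  have h3 : ellNorm (1 / 2) (fun i => ((ρ i).im : ℂ)) ≤ ellNorm (1 / 2) ρ :=
    ellNorm_mono (by norm_num) fun i => by
      rw [Complex.norm_real]; exact Complex.abs_im_le_norm _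
  rw [h1]
  refine (ellNorm_add_le hα hα1 _ _).trans ?_
  rw [ellNorm_smul hα, Complex.norm_I, one_mul]
  have h4 := (h k fun i => (ρ i).re).trans
    (mul_le_mul_of_nonneg_left h2 (by positivity))
  have h5 := (h k fun i => (ρ i).im).trans
    (mul_le_mul_of_nonneg_left h3 (by positivity))
  calc _ ≤ _ := add_le_add h4 h5
    _ = _ := by ring

/-- The (unnormalised) Rademacher coefficients of a function on the discrete cube. -/
def radCoeff {k : ℕ} (a : (Fin k → Bool) → ℂ) (i : Fin k) : ℂ := ∑ ω, boolSign (ω i) * a ω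

/-- The dual Khinchine inequality. -/
theorem exists_khinchine_dual {α : ℝ} (hα : 0 < α) (hα1 : α < 1) :
    ∃ κ : ℝ, 0 ≤ κ ∧ ∀ (k : ℕ) (a : (Fin k → Bool) → ℂ),
      ellNorm (1 / 2) (radCoeff a) ≤ κ * ((2 : ℝ) ^ k) ^ (1 - α) * ellNorm α a := by
  obtain ⟨κ, hκ, h⟩ := exists_khinchine (α := 1 - α) (by linarith) (by linarith)
  refine ⟨κ, hκ, fun k a => ?_⟩
  set l := ellNorm (1 / 2) (radCoeff a) with hl
  have hl0 : 0 ≤ l := ellNorm_nonneg _ _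
  set ρ : Fin k → ℂ := fun i => starRingEnd ℂ (radCoeff a i) with hρ
  have hρl : ellNorm (1 / 2) ρ = l := by
    rw [hl]; unfold ellNorm; simp [hρ]
  -- Duality: `a` is tested against the Rademacher sum of its own conjugated coefficients, and
  -- Hölder reduces the claim to the upper inequality in the conjugate space.
  have h1 : ((l ^ 2 : ℝ) : ℂ) = ∑ ω, radSum ρ ω * a ω := by
    rw [hl, ellNorm_half_sq]
    push_cast
    simp only [radSum, Finset.sum_mul]
    rw [Finset.sum_comm]
    refine Finset.sum_congr rfl fun i _ => ?_
    rw [← Complex.ofReal_pow, ← Complex.normSq_eq_norm_sq, Complex.normSq_eq_conj_mul_self]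
    conv_lhs => rw [show radCoeff a i = ∑ ω, boolSign (ω i) * a ω from rfl, Finset.mul_sum]
    refine Finset.sum_congr rfl fun ω _ => ?_
    simp only [hρ, radCoeff]
    ring
  have h2 := norm_sum_mul_le_ellNorm hα hα1 (radSum ρ) a
  rw [← h1, Complex.norm_real, Real.norm_of_nonneg (sq_nonneg l)] at h2
  have h3 := h k ρ
  rw [hρl] at h3
  rcases hl0.eq_or_lt with h0 | h0
  · rw [← h0]
    have := ellNorm_nonneg α a
    positivity
  · have h4 : l * l ≤ l * (κ * ((2 : ℝ) ^ k) ^ (1 - α) * ellNorm α a) := by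
      calc l * l = l ^ 2 := by ring
        _ ≤ _ := h2
        _ ≤ (κ * ((2 : ℝ) ^ k) ^ (1 - α) * l) * ellNorm α a :=
            mul_le_mul_of_nonneg_right h3 (ellNorm_nonneg _ _)
        _ = _ := by ring
    exact le_of_mul_le_mul_left h4 h0

theorem radCoeff_radSum {k : ℕ} (ρ : Fin k → ℂ) (i : Fin k) :
    radCoeff (radSum ρ) i = 2 ^ k * ρ i := by
  have horth : ∀ j, ∑ ω : Fin k → Bool, ((boolSign (ω i) : ℂ) * boolSign (ω j)) =
      if j = i then 2 ^ k else 0 := by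
    intro j
    split_ifs with h
    · subst h
      have : ∀ ω : Fin k → Bool, ((boolSign (ω j) : ℂ) * boolSign (ω j)) = 1 := by
        intro ω
        unfold boolSign
        split_ifs <;> simp
      simp [this]
    -- Flipping the `i`-th sign reverses the sign of the summand when `j ≠ i`.
    · refine Finset.sum_involution (fun ω _ => Function.update ω i (!ω i)) ?_ ?_ ?_ ?_
      · intro ω _
        rw [Function.update_self, Function.update_of_ne h]
        cases ω i <;> simp [boolSign]
      · intro ω _ _ hc
        have := congrFun hc i
        simp at this
      · intro ω _
        exact Finset.mem_univ _
      · intro ω _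
        simp
  unfold radCoeff radSum
  simp only [Finset.mul_sum]
  rw [Finset.sum_comm]
  calc ∑ j, ∑ ω : Fin k → Bool, (boolSign (ω i) : ℂ) * (ρ j * boolSign (ω j))
      = ∑ j, ρ j * ∑ ω : Fin k → Bool, (boolSign (ω i) : ℂ) * boolSign (ω j) := by
        refine Finset.sum_congr rfl fun j _ => ?_
        rw [Finset.mul_sum]
        exact Finset.sum_congr rfl fun ω _ => by ring
    _ = 2 ^ k * ρ i := by
        simp only [horth]
        simp [mul_comm]

end Khinchine

/-! ### Growth of `L^p` means of sums of orthogonal unimodular functions. -/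

section TrigSums

variable {P : ℝ} {θ : ℕ → ℝ → ℂ}

theorem IsOrthoUnimodular.integral_sq (hθ : IsOrthoUnimodular P θ) (n : ℕ) :
    ∫ t in (0 : ℝ)..P, ‖∑ j ∈ Finset.range n, θ j t‖ ^ 2 = n * P := by
  have hc := hθ.continuous
  have h1 : ∀ t, ((‖∑ j ∈ Finset.range n, θ j t‖ ^ 2 : ℝ) : ℂ) =
      ∑ i ∈ Finset.range n, ∑ j ∈ Finset.range n, θ i t * starRingEnd ℂ (θ j t) := by
    intro t
    rw [← Complex.normSq_eq_norm_sq, Complex.normSq_eq_conj_mul_self, mul_comm, map_sum,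
      Finset.sum_mul_sum]
  have h2 : ∀ i, ∫ t in (0 : ℝ)..P, θ i t * starRingEnd ℂ (θ i t) = P := by
    intro i
    have : ∀ t, θ i t * starRingEnd ℂ (θ i t) = 1 := fun t => by
      rw [Complex.mul_conj, Complex.normSq_eq_norm_sq, hθ.norm_eq]; simp
    simp [this]
  have h3 : ((∫ t in (0 : ℝ)..P, ‖∑ j ∈ Finset.range n, θ j t‖ ^ 2 : ℝ) : ℂ) = ((n * P : ℝ) : ℂ) := by
    rw [← intervalIntegral.integral_ofReal]
    simp only [h1]
    rw [intervalIntegral.integral_finsetSum fun i _ => Continuous.intervalIntegrable (by fun_prop) _ _]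
    have h4 : ∀ i ∈ Finset.range n, ∫ t in (0 : ℝ)..P, ∑ j ∈ Finset.range n,
        θ i t * starRingEnd ℂ (θ j t) = P := by
      intro i hi
      rw [intervalIntegral.integral_finsetSum fun j _ =>
        Continuous.intervalIntegrable (by fun_prop) _ _, Finset.sum_eq_single i]
      · exact h2 i
      · intro j _ hj
        exact hθ.integral_eq i j hj.symm
      · exact fun h => absurd hi h
    rw [Finset.sum_congr rfl h4]
    simp
  exact_mod_cast h3

theorem IsOrthoUnimodular.norm_sum_le (hθ : IsOrthoUnimodular P θ) (n : ℕ) (t : ℝ) :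
    ‖∑ j ∈ Finset.range n, θ j t‖ ≤ n := by
  refine (_root_.norm_sum_le _ _).trans ?_
  simp [hθ.norm_eq]

theorem IsOrthoUnimodular.continuous_rpow (hθ : IsOrthoUnimodular P θ) {p : ℝ} (hp : 0 ≤ p)
    (n : ℕ) : Continuous fun t => ‖∑ j ∈ Finset.range n, θ j t‖ ^ p := by
  have hc := hθ.continuous
  exact (Continuous.norm (by fun_prop)).rpow_const fun _ => Or.inr hp

/-- Interpolation between the square mean `n` and the trivial bound `n`. The point is growth
strictly slower than `n ^ p`, which excludes `ℓ_1`. -/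
theorem IsOrthoUnimodular.integral_rpow_le (hθ : IsOrthoUnimodular P θ) (hP : 0 < P) {p : ℝ}
    (hp : 1 < p) {n : ℕ} (hn : 1 ≤ n) :
    ∫ t in (0 : ℝ)..P, ‖∑ j ∈ Finset.range n, θ j t‖ ^ p ≤ P * (1 + n + (n : ℝ) ^ (p - 1)) := by
  have hc := hθ.continuous
  have hn0 : (0 : ℝ) < n := by exact_mod_cast hn
  have hsq := hθ.integral_sq n
  have hcp := hθ.continuous_rpow (by linarith : 0 ≤ p) n
  rcases le_total p 2 with h | h
  · have h1 : ∫ t in (0 : ℝ)..P, ‖∑ j ∈ Finset.range n, θ j t‖ ^ p ≤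
        ∫ t in (0 : ℝ)..P, (1 + ‖∑ j ∈ Finset.range n, θ j t‖ ^ 2) := by
      refine intervalIntegral.integral_mono_on hP.le (hcp.intervalIntegrable _ _)
        (Continuous.intervalIntegrable (by fun_prop) _ _) fun t _ => ?_
      set g := ‖∑ j ∈ Finset.range n, θ j t‖
      rcases le_total g 1 with hg | hg
      · have := Real.rpow_le_one (norm_nonneg _) hg (by linarith : 0 ≤ p)
        nlinarith [sq_nonneg g]
      · have := Real.rpow_le_rpow_of_exponent_le hg h
        rw [Real.rpow_two] at this
        linarith
    rw [intervalIntegral.integral_add intervalIntegrable_const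
      (Continuous.intervalIntegrable (by fun_prop) _ _), hsq] at h1
    simp only [intervalIntegral.integral_const, sub_zero, smul_eq_mul, mul_one] at h1
    have : 0 ≤ P * (n : ℝ) ^ (p - 1) := by positivity
    nlinarith
  · have h1 : ∫ t in (0 : ℝ)..P, ‖∑ j ∈ Finset.range n, θ j t‖ ^ p ≤
        ∫ t in (0 : ℝ)..P, (n : ℝ) ^ (p - 2) * ‖∑ j ∈ Finset.range n, θ j t‖ ^ 2 := by
      refine intervalIntegral.integral_mono_on hP.le (hcp.intervalIntegrable _ _)
        (Continuous.intervalIntegrable (by fun_prop) _ _) fun t _ => ?_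
      have hg := hθ.norm_sum_le n t
      set g := ‖∑ j ∈ Finset.range n, θ j t‖ with hgdef
      have hg0 : 0 ≤ g := norm_nonneg _
      have e1 : g ^ p = g ^ (p - 2) * g ^ 2 := by
        rw [← Real.rpow_natCast, ← Real.rpow_add_of_nonneg hg0 (by linarith) (by norm_num)]
        norm_num
      rw [e1]
      exact mul_le_mul_of_nonneg_right (Real.rpow_le_rpow hg0 hg (by linarith)) (sq_nonneg _)
    rw [intervalIntegral.integral_const_mul, hsq] at h1
    have e2 : (n : ℝ) ^ (p - 2) * (n * P) = P * (n : ℝ) ^ (p - 1) := by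
      rw [← mul_assoc, ← Real.rpow_add_one hn0.ne']
      ring_nf
    rw [e2] at h1
    have : 0 ≤ P * (n : ℝ) := by positivity
    nlinarith

/-- The same interpolation from below. The point is unboundedness in `n`, which excludes `c₀`. -/
theorem IsOrthoUnimodular.le_integral_rpow (hθ : IsOrthoUnimodular P θ) (hP : 0 < P) {p : ℝ}
    (hp : 1 < p) {n : ℕ} (hn : 1 ≤ n) :
    P * min ((n : ℝ) ^ (p - 1)) (n - 1) ≤
      ∫ t in (0 : ℝ)..P, ‖∑ j ∈ Finset.range n, θ j t‖ ^ p := by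
  have hc := hθ.continuous
  have hn0 : (0 : ℝ) < n := by exact_mod_cast hn
  have hsq := hθ.integral_sq n
  have hcp := hθ.continuous_rpow (by linarith : 0 ≤ p) n
  rcases le_total p 2 with h | h
  · have h1 : ∫ t in (0 : ℝ)..P, ‖∑ j ∈ Finset.range n, θ j t‖ ^ 2 ≤
        ∫ t in (0 : ℝ)..P, (n : ℝ) ^ (2 - p) * ‖∑ j ∈ Finset.range n, θ j t‖ ^ p := by
      refine intervalIntegral.integral_mono_on hP.le
        (Continuous.intervalIntegrable (by fun_prop) _ _)
        (Continuous.intervalIntegrable (by fun_prop) _ _) fun t _ => ?_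
      have hg := hθ.norm_sum_le n t
      set g := ‖∑ j ∈ Finset.range n, θ j t‖ with hgdef
      have hg0 : 0 ≤ g := norm_nonneg _
      have e1 : g ^ 2 = g ^ (2 - p) * g ^ p := by
        rw [← Real.rpow_natCast, ← Real.rpow_add_of_nonneg hg0 (by linarith) (by linarith)]
        norm_num
      rw [e1]
      exact mul_le_mul_of_nonneg_right (Real.rpow_le_rpow hg0 hg (by linarith)) (by positivity)
    rw [intervalIntegral.integral_const_mul, hsq] at h1
    have e2 : (n : ℝ) = (n : ℝ) ^ (2 - p) * (n : ℝ) ^ (p - 1) := by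
      rw [← Real.rpow_add hn0]
      norm_num
    have e3 : (n : ℝ) ^ (2 - p) * ((n : ℝ) ^ (p - 1) * P) ≤
        (n : ℝ) ^ (2 - p) * ∫ t in (0 : ℝ)..P, ‖∑ j ∈ Finset.range n, θ j t‖ ^ p := by
      rw [← mul_assoc, ← e2]; exact h1
    have e4 := le_of_mul_le_mul_left e3 (by positivity)
    refine le_trans ?_ e4
    rw [mul_comm]
    exact mul_le_mul_of_nonneg_right (min_le_left _ _) hP.le
  · have h1 : ∫ t in (0 : ℝ)..P, ‖∑ j ∈ Finset.range n, θ j t‖ ^ 2 ≤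
        ∫ t in (0 : ℝ)..P, (1 + ‖∑ j ∈ Finset.range n, θ j t‖ ^ p) := by
      refine intervalIntegral.integral_mono_on hP.le
        (Continuous.intervalIntegrable (by fun_prop) _ _)
        (Continuous.intervalIntegrable (by fun_prop) _ _) fun t _ => ?_
      set g := ‖∑ j ∈ Finset.range n, θ j t‖
      have hg0 : 0 ≤ g := norm_nonneg _
      rcases le_total g 1 with hg | hg
      · have : 0 ≤ g ^ p := by positivity
        nlinarith
      · have := Real.rpow_le_rpow_of_exponent_le hg h
        rw [Real.rpow_two] at this
        linarith
    rw [intervalIntegral.integral_add intervalIntegrable_const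
      (hcp.intervalIntegrable _ _), hsq] at h1
    simp only [intervalIntegral.integral_const, sub_zero, smul_eq_mul, mul_one] at h1
    have : P * min ((n : ℝ) ^ (p - 1)) (n - 1) ≤ P * (n - 1) :=
      mul_le_mul_of_nonneg_left (min_le_right _ _) hP.le
    linarith

end TrigSums

/-! ### Transfer of finite matrix chains to operators on `X`. -/

section Models

variable {E : ℕ → X →L[ℂ] X} {ν : ℕ → ℕ} {d : ℕ → X}

theorem IsUnitSequence.blockProj_of_ne (hd : IsUnitSequence E ν d) (hE : IsUnconditionalResolution E)
    {i j : ℕ} (h : i ≠ j) : blockProj E {ν i} (d j) = 0 :=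
  hE.blockProj_of_disjoint (by simpa using fun e => h (hd.strictMono.injective e)) (hd.supported j)

/-- The functionals biorthogonal to a unit sequence. -/
theorem IsUnitSequence.exists_dual (hd : IsUnitSequence E ν d) (hE : IsUnconditionalResolution E) :
    ∃ f : ℕ → StrongDual ℂ X, (∀ i j, f i (d j) = if i = j then 1 else 0) ∧
      ∀ i x, ‖f i x‖ ≤ ‖blockProj E {ν i} x‖ := by
  have h : ∀ i, ∃ g : StrongDual ℂ X, ‖g‖ ≤ 1 ∧ g (d i) = 1 := fun i => by
    obtain ⟨g, hg, hgd⟩ := exists_dual_vector'' ℂ (d i)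
    exact ⟨g, hg, by rw [hgd, hd.norm_eq]; simp⟩
  choose g hg hgd using h
  refine ⟨fun i => (g i).comp (blockProj E {ν i}), fun i j => ?_, fun i x => ?_⟩
  · rw [ContinuousLinearMap.comp_apply]
    split_ifs with h
    · rw [← h, hd.supported, hgd]
    · rw [hd.blockProj_of_ne hE h, map_zero]
  · exact ((g i).le_of_opNorm_le (hg i) _).trans_eq (one_mul _)

variable {Ω : Type} [Fintype Ω]

/-- The index of the coordinate `ω` in the `k`-th of a sequence of disjoint finite models. -/
def modelIndex (k : ℕ) (ω : Ω) : ℕ := Nat.pair k (Fintype.equivFin Ω ω)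

theorem modelIndex_injective (k : ℕ) : Function.Injective (modelIndex k : Ω → ℕ) := by
  intro ω ω' h
  have := (Nat.pair_eq_pair.1 h).2
  exact (Fintype.equivFin Ω).injective (Fin.ext this)

/-- The linear combination of the vectors of `d` in the `k`-th model. -/
def synthesis (d : ℕ → X) (k : ℕ) : (Ω → ℂ) →ₗ[ℂ] X :=
  Fintype.linearCombination ℂ fun ω => d (modelIndex k ω)

theorem synthesis_apply (d : ℕ → X) (k : ℕ) (a : Ω → ℂ) :
    synthesis d k a = ∑ ω, a ω • d (modelIndex k ω) := by
  simp [synthesis, Fintype.linearCombination_apply]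

/-- The coordinates of a vector in the `k`-th model. -/
def analysis (f : ℕ → StrongDual ℂ X) (k : ℕ) : X →L[ℂ] (Ω → ℂ) :=
  ContinuousLinearMap.pi fun ω => f (modelIndex k ω)

theorem analysis_apply (f : ℕ → StrongDual ℂ X) (k : ℕ) (x : X) (ω : Ω) :
    analysis f k x ω = f (modelIndex k ω) x := rfl

theorem analysis_synthesis {f : ℕ → StrongDual ℂ X}
    (hf : ∀ i j, f i (d j) = if i = j then 1 else 0) (k : ℕ) (a : Ω → ℂ) :
    analysis f k (synthesis d k a) = a := by
  classical
  ext ω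
  rw [analysis_apply, synthesis_apply, map_sum, Finset.sum_eq_single ω]
  · simp [hf]
  · intro ω' _ h
    simp [hf, (modelIndex_injective k).ne h.symm]
  · exact fun h => absurd (Finset.mem_univ _) h

/-- The coordinates of the decomposition used by the `k`-th model. -/
def modelBlock (ν : ℕ → ℕ) (Ω : Type) [Fintype Ω] (k : ℕ) : Finset ℕ := by
  classical
  exact Finset.univ.image fun ω : Ω => ν (modelIndex k ω)

theorem mem_modelBlock {k i : ℕ} :
    i ∈ modelBlock ν Ω k ↔ ∃ ω : Ω, ν (modelIndex k ω) = i := by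
  simp [modelBlock]

theorem disjoint_modelBlock (hν : StrictMono ν) (Ω : ℕ → Type) [∀ k, Fintype (Ω k)] :
    Pairwise fun k l => Disjoint (modelBlock ν (Ω k) k) (modelBlock ν (Ω l) l) := by
  intro k l h
  rw [Finset.disjoint_left]
  intro i hi hi'
  obtain ⟨ω, hω⟩ := mem_modelBlock.1 hi
  obtain ⟨ω', hω'⟩ := mem_modelBlock.1 hi'
  exact h (Nat.pair_eq_pair.1 (hν.injective (hω.trans hω'.symm))).1

theorem IsUnitSequence.blockProj_synthesis (hd : IsUnitSequence E ν d)
    (hE : IsUnconditionalResolution E) (k : ℕ) (a : Ω → ℂ) :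
    blockProj E (modelBlock ν Ω k) (synthesis d k a) = synthesis d k a := by
  rw [synthesis_apply, map_sum]
  refine Finset.sum_congr rfl fun ω _ => ?_
  rw [map_smul, hE.blockProj_of_subset _ (hd.supported _)]
  exact Finset.singleton_subset_iff.2 (mem_modelBlock.2 ⟨ω, rfl⟩)

theorem analysis_blockProj (hE : IsUnconditionalResolution E) {f : ℕ → StrongDual ℂ X}
    (hf : ∀ i x, ‖f i x‖ ≤ ‖blockProj E {ν i} x‖) (k : ℕ) (x : X) :
    (analysis f k (blockProj E (modelBlock ν Ω k) x) : Ω → ℂ) = analysis f k x := by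
  ext ω
  rw [analysis_apply, analysis_apply, ← sub_eq_zero, ← map_sub, ← norm_le_zero_iff]
  refine (hf _ _).trans (le_of_eq ?_)
  rw [map_sub, hE.blockProj_blockProj, Finset.inter_eq_left.2, sub_self, norm_zero]
  exact Finset.singleton_subset_iff.2 (mem_modelBlock.2 ⟨ω, rfl⟩)

/-- The estimate that the maximal regularity property imposes on increasing chains of commuting
matrix projections, uniformly bounded for a sequence of gauges `N k` comparable to the norm of
`X`. -/
theorem HasMRP.exists_matrix_estimate [CompleteSpace X] (hX : HasMRP X)
    (hE : IsUnconditionalResolution E) (hd : IsUnitSequence E ν d) {f : ℕ → StrongDual ℂ X}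
    (hfd : ∀ i j, f i (d j) = if i = j then 1 else 0)
    (hf : ∀ i x, ‖f i x‖ ≤ ‖blockProj E {ν i} x‖)
    (Ω : ℕ → Type) [∀ k, Fintype (Ω k)] (L : ℕ → ℕ) (N : ∀ k, (Ω k → ℂ) → ℝ) {b c M : ℝ}
    (hb : 0 ≤ b) (hM : 0 ≤ M) (hJ : ∀ k a, ‖synthesis d k a‖ ≤ b * N k a)
    (hD : ∀ k x, N k (analysis f k x) ≤ c * ‖x‖) (A : ∀ k, ℕ → (Ω k → ℂ) →ₗ[ℂ] (Ω k → ℂ))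
    (hA : ∀ k i j a, A k i (A k j a) = A k (min i j) a) (hAN : ∀ k j a, N k (A k j a) ≤ M * N k a) :
    ∃ (p P C : ℝ) (θ : ℕ → ℕ → ℝ → ℂ), 1 < p ∧ 0 < P ∧ 0 ≤ C ∧
      (∀ k, IsOrthoUnimodular P (θ k)) ∧ ∀ k (a : ℕ → Ω k → ℂ),
      ∫ t in (0 : ℝ)..P, ‖synthesis d k (∑ j ∈ Finset.range (L k), θ k j t • A k j (a j))‖ ^ p ≤
        C * ∫ t in (0 : ℝ)..P, ‖synthesis d k (∑ j ∈ Finset.range (L k), θ k j t • a j)‖ ^ p := by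
  -- Analysis is a left inverse of synthesis, so conjugating by them preserves the chain law; the
  -- pairing in `modelIndex` keeps different models on disjoint coordinates.
  let T : ℕ → ℕ → X →L[ℂ] X := fun k j =>
    (LinearMap.toContinuousLinearMap ((synthesis d k).comp (A k j))).comp (analysis f k)
  have hTa : ∀ k j x, T k j x = synthesis d k (A k j (analysis f k x)) := fun _ _ _ => rfl
  have hT : ∀ k, IsBlockChain E (b * (M * c)) (modelBlock ν (Ω k) k) (T k) := by
    intro k
    refine ⟨fun i j x => ?_, fun j x => ?_, fun j x => ?_, fun j x => ?_⟩
    · rw [hTa, hTa, hTa, analysis_synthesis hfd, hA]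
    · rw [hTa, hd.blockProj_synthesis hE]
    · rw [hTa, hTa, analysis_blockProj hE hf]
    · rw [hTa, mul_assoc, mul_assoc]
      refine (hJ k _).trans (mul_le_mul_of_nonneg_left ?_ hb)
      exact (hAN k j _).trans (mul_le_mul_of_nonneg_left (hD k x) hM)
  obtain ⟨p, P, C, θ, hp, hP, hC, hθ, h⟩ :=
    hX.exists_blockChain_estimate hE (disjoint_modelBlock hd.strictMono Ω) L hT
  refine ⟨p, P, C, θ, hp, hP, hC, hθ, fun k a => ?_⟩
  have := h k (fun j => synthesis d k (a j)) fun j => hd.blockProj_synthesis hE k _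
  simpa only [hTa, analysis_synthesis hfd, ← map_smul, ← map_sum] using this

/-- The extension by zero to `ℕ` of a function on a finite type. -/
def natExtend (a : Ω → ℂ) (i : ℕ) : ℂ :=
  if h : i < Fintype.card Ω then a ((Fintype.equivFin Ω).symm ⟨i, h⟩) else 0

theorem sum_natExtend {M : Type*} [AddCommMonoid M] (a : Ω → ℂ) (G : ℕ → ℂ → M) :
    ∑ i ∈ Finset.range (Fintype.card Ω), G i (natExtend a i) =
      ∑ ω, G (Fintype.equivFin Ω ω) (a ω) := by
  rw [Finset.sum_range, ← Equiv.sum_comp (Fintype.equivFin Ω)]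
  simp [natExtend]

theorem norm_natExtend_le (a : Ω → ℂ) (i : ℕ) : ‖natExtend a i‖ ≤ ‖a‖ := by
  unfold natExtend
  split_ifs
  · exact norm_le_pi_norm a _
  · simp

theorem IsUnitSequence.isDisjointlySupported_natExtend (hd : IsUnitSequence E ν d) (k : ℕ)
    (a : Ω → ℂ) : IsDisjointlySupported E (Fintype.card Ω) (fun i => {ν (Nat.pair k i)})
      (fun i => natExtend a i • d (Nat.pair k i)) := by
  refine ⟨fun i _ j _ h => ?_, fun i _ => ?_⟩
  · simpa using fun e => h (Nat.pair_eq_pair.1 (hd.strictMono.injective e)).2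
  · simp [hd.supported]

theorem synthesis_eq_sum_range (d : ℕ → X) (k : ℕ) (a : Ω → ℂ) :
    synthesis d k a =
      ∑ i ∈ Finset.range (Fintype.card Ω), natExtend a i • d (Nat.pair k i) := by
  rw [sum_natExtend a fun i z => z • d (Nat.pair k i), synthesis_apply]
  rfl

namespace HasPowerType

variable {α c : ℝ}

theorem norm_synthesis_le (h : HasPowerType E α c) (hα : 0 < α) (hd : IsUnitSequence E ν d)
    (k : ℕ) (a : Ω → ℂ) : ‖synthesis d k a‖ ≤ c * ellNorm α a := by
  rw [synthesis_eq_sum_range]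
  refine (h.upper hα _ _ _ (hd.isDisjointlySupported_natExtend k a)).trans_eq ?_
  simp only [norm_smul, hd.norm_eq, mul_one]
  rw [sum_natExtend a fun i z => ‖z‖ ^ α⁻¹, ellNorm]

theorem ellNorm_le_norm_synthesis (h : HasPowerType E α c) (hα : 0 < α)
    (hd : IsUnitSequence E ν d) (k : ℕ) (a : Ω → ℂ) :
    ellNorm α a ≤ c * ‖synthesis d k a‖ := by
  rw [synthesis_eq_sum_range]
  refine le_trans (le_of_eq ?_) (h.lower hα _ _ _ (hd.isDisjointlySupported_natExtend k a))
  simp only [norm_smul, hd.norm_eq, mul_one]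
  rw [sum_natExtend a fun i z => ‖z‖ ^ α⁻¹, ellNorm]

theorem norm_synthesis_le_norm (h : HasPowerType E 0 c) (hd : IsUnitSequence E ν d)
    (k : ℕ) (a : Ω → ℂ) : ‖synthesis d k a‖ ≤ c * ‖a‖ := by
  rw [synthesis_eq_sum_range]
  refine h.upper_zero rfl _ _ _ _ (norm_nonneg a) (hd.isDisjointlySupported_natExtend k a) ?_
  intro i _
  rw [norm_smul, hd.norm_eq, mul_one]
  exact norm_natExtend_le a i

theorem ellNorm_analysis_le (h : HasPowerType E α c) (hα : 0 < α) (hE : IsUnconditionalResolution E)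
    {K : ℝ} (hK : IsMultiplierBound E K) (hν : StrictMono ν) {f : ℕ → StrongDual ℂ X}
    (hf : ∀ i x, ‖f i x‖ ≤ ‖blockProj E {ν i} x‖) (k : ℕ) (x : X) :
    ellNorm α (analysis f k x : Ω → ℂ) ≤ c * K * ‖x‖ := by
  have hs : IsDisjointlySupported E (Fintype.card Ω) (fun i => {ν (Nat.pair k i)})
      (fun i => blockProj E {ν (Nat.pair k i)} x) := by
    refine ⟨fun i _ j _ h => ?_, fun i _ => ?_⟩
    · simpa using fun e => h (Nat.pair_eq_pair.1 (hν.injective e)).2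
    · rw [hE.blockProj_blockProj, Finset.inter_self]
  have h1 := h.lower hα _ _ _ hs
  have h2 : ∑ i ∈ Finset.range (Fintype.card Ω), blockProj E {ν (Nat.pair k i)} x =
      blockProj E ((Finset.range (Fintype.card Ω)).image fun i => ν (Nat.pair k i)) x := by
    rw [blockProj_apply, Finset.sum_image]
    · simp [blockProj_apply]
    · intro i _ j _ e
      exact (Nat.pair_eq_pair.1 (hν.injective e)).2
  rw [h2] at h1
  have hc : 0 ≤ c := zero_le_one.trans h.one_le
  rw [mul_assoc]
  refine le_trans ?_ (h1.trans (mul_le_mul_of_nonneg_left (hK.norm_blockProj_le _ x) hc))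
  rw [sum_natExtend (0 : Ω → ℂ) fun i _ => ‖blockProj E {ν (Nat.pair k i)} x‖ ^ α⁻¹, ellNorm]
  refine Real.rpow_le_rpow (by positivity) (Finset.sum_le_sum fun ω _ => ?_) hα.le
  exact Real.rpow_le_rpow (norm_nonneg _) (hf _ x) (inv_nonneg.2 hα.le)

end HasPowerType

theorem norm_analysis_le {K : ℝ} (hK : IsMultiplierBound E K) (hK0 : 0 ≤ K)
    {f : ℕ → StrongDual ℂ X} (hf : ∀ i x, ‖f i x‖ ≤ ‖blockProj E {ν i} x‖) (k : ℕ) (x : X) :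
    ‖(analysis f k x : Ω → ℂ)‖ ≤ K * ‖x‖ :=
  (pi_norm_le_iff_of_nonneg (by positivity)).2 fun ω =>
    (hf _ x).trans (hK.norm_blockProj_le _ x)

end Models

/-! ### Elementary growth and integral bounds. -/

section Growth

theorem not_forall_rpow_le {s C : ℝ} (hs : 0 < s) : ¬∀ n : ℕ, 1 ≤ n → (n : ℝ) ^ s ≤ C := by
  intro h
  have h1 := ((tendsto_rpow_atTop hs).comp tendsto_natCast_atTop_atTop).eventually_gt_atTop C
  obtain ⟨n, hn, hn1⟩ := (h1.and (eventually_ge_atTop 1)).exists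
  exact absurd (h n hn1) (not_le.2 hn)

theorem mul_le_integral_of_le {g : ℝ → ℝ} (hg : Continuous g) {P r : ℝ} (hP : 0 ≤ P)
    (h : ∀ t, r ≤ g t) : P * r ≤ ∫ t in (0 : ℝ)..P, g t := by
  have := intervalIntegral.integral_mono_on hP (intervalIntegrable_const (c := r) (μ := volume))
    (hg.intervalIntegrable 0 P) fun t _ => h t
  simpa using this

theorem integral_le_mul_of_le {g : ℝ → ℝ} (hg : Continuous g) {P r : ℝ} (hP : 0 ≤ P)
    (h : ∀ t, g t ≤ r) : ∫ t in (0 : ℝ)..P, g t ≤ P * r := by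
  have := intervalIntegral.integral_mono_on hP (hg.intervalIntegrable 0 P)
    (intervalIntegrable_const (c := r) (μ := volume)) fun t _ => h t
  simpa using this

theorem IsOrthoUnimodular.continuous_synthesis_rpow {P p : ℝ} {θ : ℕ → ℝ → ℂ}
    (hθ : IsOrthoUnimodular P θ) (hp : 0 ≤ p) {Ω : Type} [Fintype Ω] (d : ℕ → X) (k n : ℕ)
    (a : ℕ → Ω → ℂ) :
    Continuous fun t => ‖synthesis d k (∑ j ∈ Finset.range n, θ j t • a j)‖ ^ p := by
  have hc := hθ.continuous
  have hs : Continuous (synthesis d k : (Ω → ℂ) →ₗ[ℂ] X) :=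
    LinearMap.continuous_of_finiteDimensional _
  exact (Continuous.norm (hs.comp (by fun_prop))).rpow_const fun _ => Or.inr hp

end Growth

/-! ### Exclusion of `ℓ_1` and `c₀`. -/

section Endpoints

variable {E : ℕ → X →L[ℂ] X} {ν : ℕ → ℕ} {d : ℕ → X} {c : ℝ}

/-- Truncation of the coordinates at level `j`. -/
def finCap (k j : ℕ) (m : Fin (k + 1)) : Fin (k + 1) := ⟨min m j, by omega⟩

theorem finCap_finCap (k i j : ℕ) (m : Fin (k + 1)) :
    finCap k i (finCap k j m) = finCap k (min i j) m := by
  ext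
  simp only [finCap]
  omega

theorem finCap_last (k : ℕ) {j : ℕ} (h : j < k + 1) : finCap k j (Fin.last k) = ⟨j, h⟩ := by
  ext
  simp only [finCap, Fin.val_last]
  omega

/-- The linear map sending the `m`-th unit vector to the one of index `finCap k j m`. -/
def pushCap (k j : ℕ) : (Fin (k + 1) → ℂ) →ₗ[ℂ] (Fin (k + 1) → ℂ) :=
  Fintype.linearCombination ℂ fun m => Pi.single (finCap k j m) 1

theorem pushCap_apply (k j : ℕ) (a : Fin (k + 1) → ℂ) :
    pushCap k j a = ∑ m, a m • Pi.single (finCap k j m) (1 : ℂ) := by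
  simp [pushCap, Fintype.linearCombination_apply]

theorem pushCap_single (k j : ℕ) (m : Fin (k + 1)) :
    pushCap k j (Pi.single m 1) = Pi.single (finCap k j m) 1 := by
  simp [pushCap]

theorem pushCap_pushCap (k i j : ℕ) (a : Fin (k + 1) → ℂ) :
    pushCap k i (pushCap k j a) = pushCap k (min i j) a := by
  rw [pushCap_apply k j, pushCap_apply k (min i j), map_sum]
  simp only [map_smul, pushCap_single, finCap_finCap]

theorem ellNorm_one {Ω : Type*} [Fintype Ω] (a : Ω → ℂ) : ellNorm 1 a = ∑ ω, ‖a ω‖ := by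
  simp [ellNorm]

theorem ellNorm_pushCap_le (k j : ℕ) (a : Fin (k + 1) → ℂ) :
    ellNorm 1 (pushCap k j a) ≤ 1 * ellNorm 1 a := by
  rw [one_mul, ellNorm_one, ellNorm_one, pushCap_apply]
  calc ∑ i, ‖(∑ m, a m • (Pi.single (finCap k j m) (1 : ℂ) : Fin (k + 1) → ℂ)) i‖
      ≤ ∑ i, ∑ m, ‖a m‖ * ‖(Pi.single (finCap k j m) (1 : ℂ) : Fin (k + 1) → ℂ) i‖ := by
        refine Finset.sum_le_sum fun i _ => ?_
        rw [Finset.sum_apply]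
        refine (norm_sum_le _ _).trans (le_of_eq ?_)
        simp only [Pi.smul_apply, norm_smul]
    _ = ∑ m, ‖a m‖ := by
        rw [Finset.sum_comm]
        refine Finset.sum_congr rfl fun m _ => ?_
        rw [← Finset.mul_sum, ← ellNorm_one, ellNorm_single one_pos, norm_one, mul_one]

theorem sum_smul_single_apply (k : ℕ) (z : ℕ → ℂ) (m : Fin (k + 1)) :
    (∑ j ∈ Finset.range (k + 1),
      z j • (Pi.single (finCap k j (Fin.last k)) (1 : ℂ) : Fin (k + 1) → ℂ)) m = z m := by
  rw [Finset.sum_apply, Finset.sum_eq_single (m : ℕ)]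
  · rw [finCap_last k m.2]
    simp
  · intro j hj hjm
    rw [finCap_last k (Finset.mem_range.1 hj)]
    simp only [Pi.smul_apply]
    rw [Pi.single_eq_of_ne (fun e => hjm (by rw [e])), smul_zero]
  · exact fun h => absurd (Finset.mem_range.2 m.2) h

theorem norm_synthesis_single (hd : IsUnitSequence E ν d) {Ω : Type} [Fintype Ω] [DecidableEq Ω]
    (k : ℕ) (ω : Ω) (z : ℂ) : ‖synthesis d k (z • Pi.single ω 1)‖ = ‖z‖ := by
  simp [synthesis, norm_smul, hd.norm_eq]

/-- The maps `e_m ↦ e_{min(m,j)}` are contractive on `ℓ_1`. They spread copies of the last unit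
vector over distinct coordinates, so `‖∑ θ_j e_j‖`, of order `k + 1`, would be controlled in `p`-th
mean by `|∑ θ_j|`, which grows more slowly. -/
theorem HasPowerType.ne_one [CompleteSpace X] (hX : HasMRP X) (hE : IsUnconditionalResolution E)
    (hd : IsUnitSequence E ν d) (h : HasPowerType E 1 c) : False := by
  obtain ⟨K, hK1, hK⟩ := hE.exists_multiplier_bound
  obtain ⟨f, hfd, hf⟩ := hd.exists_dual hE
  have hc := h.one_le
  obtain ⟨p, P, C, θ, hp, hP, hC, hθ, hest⟩ := hX.exists_matrix_estimate hE hd hfd hf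
    (fun k => Fin (k + 1)) (fun k => k + 1) (fun _ => ellNorm 1) (by linarith : 0 ≤ c) zero_le_one
    (fun k a => h.norm_synthesis_le one_pos hd k a)
    (fun k x => h.ellNorm_analysis_le one_pos hE hK hd.strictMono hf k x)
    pushCap pushCap_pushCap ellNorm_pushCap_le
  have hp0 : 0 ≤ p := by linarith
  have hs : 0 < min (p - 1) 1 := lt_min (by linarith) one_pos
  refine not_forall_rpow_le (C := c ^ p * (C * 3)) hs fun n hn => ?_
  obtain ⟨k, rfl⟩ : ∃ k, n = k + 1 := ⟨n - 1, by omega⟩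
  set m : ℝ := ((k + 1 : ℕ) : ℝ) with hm
  have hm1 : 1 ≤ m := by rw [hm]; exact_mod_cast hn
  have hm0 : 0 < m := by linarith
  have hk := hest k fun _ => Pi.single (Fin.last k) 1
  simp only [pushCap_single, ← Finset.sum_smul, norm_synthesis_single hd] at hk
  have hlow : P * (m / c) ^ p ≤ ∫ t in (0 : ℝ)..P, ‖synthesis d k (∑ j ∈ Finset.range (k + 1),
      θ k j t • (Pi.single (finCap k j (Fin.last k)) (1 : ℂ) : Fin (k + 1) → ℂ))‖ ^ p := by
    refine mul_le_integral_of_le ((hθ k).continuous_synthesis_rpow hp0 d k _ _) hP.le fun t => ?_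
    refine Real.rpow_le_rpow (by positivity) ?_ hp0
    rw [div_le_iff₀' (by linarith)]
    refine le_trans (le_of_eq ?_) (h.ellNorm_le_norm_synthesis one_pos hd k _)
    rw [ellNorm_of_unimodular]
    · simp [hm]
    · intro i
      rw [sum_smul_single_apply k fun j => θ k j t]
      exact (hθ k).norm_eq _ t
  have h1 := hlow.trans (hk.trans
    (mul_le_mul_of_nonneg_left ((hθ k).integral_rpow_le hP hp (Nat.le_add_left 1 k)) hC))
  rw [← hm] at h1
  have h2 : (m / c) ^ p ≤ C * (1 + m + m ^ (p - 1)) := by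
    refine le_of_mul_le_mul_left ?_ hP
    calc _ ≤ _ := h1
      _ = _ := by ring
  have e1 : 1 ≤ m ^ (p - min (p - 1) 1) := by
    refine Real.one_le_rpow hm1 ?_
    have := min_le_left (p - 1) 1
    linarith
  have e2 : m ≤ m ^ (p - min (p - 1) 1) := by
    conv_lhs => rw [← Real.rpow_one m]
    refine Real.rpow_le_rpow_of_exponent_le hm1 ?_
    have := min_le_left (p - 1) 1
    linarith
  have e3 : m ^ (p - 1) ≤ m ^ (p - min (p - 1) 1) := by
    refine Real.rpow_le_rpow_of_exponent_le hm1 ?_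
    have := min_le_right (p - 1) 1
    linarith
  rw [Real.div_rpow hm0.le (by linarith), div_le_iff₀' (by positivity)] at h2
  have h3 : m ^ p ≤ c ^ p * (C * 3) * m ^ (p - min (p - 1) 1) := by
    rw [mul_assoc, mul_assoc]
    refine h2.trans ?_
    gcongr
    linarith
  refine le_of_mul_le_mul_right ?_ (by positivity : 0 < m ^ (p - min (p - 1) 1))
  rwa [← Real.rpow_add hm0, add_sub_cancel]

/-- Composition with `finCap k j`, the transpose of the `ℓ_1` chain, is contractive for the supremum
norm. Applied to `e_j` it has last coordinate 1, so a bounded sum `∑ θ_j e_j` would control `|∑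
θ_j|`, whose `p`-th mean is unbounded. -/
theorem HasPowerType.ne_zero [CompleteSpace X] (hX : HasMRP X) (hE : IsUnconditionalResolution E)
    (hd : IsUnitSequence E ν d) (h : HasPowerType E 0 c) : False := by
  obtain ⟨K, hK1, hK⟩ := hE.exists_multiplier_bound
  obtain ⟨f, hfd, hf⟩ := hd.exists_dual hE
  have hc := h.one_le
  obtain ⟨p, P, C, θ, hp, hP, hC, hθ, hest⟩ := hX.exists_matrix_estimate hE hd hfd hf
    (fun k => Fin (k + 1)) (fun k => k + 1) (fun _ a => ‖a‖) (by linarith : 0 ≤ c) zero_le_one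
    (fun k a => h.norm_synthesis_le_norm hd k a)
    (fun k x => norm_analysis_le hK (by linarith) hf k x)
    (fun k j => LinearMap.funLeft ℂ ℂ (finCap k j))
    (fun k i j a => by
      ext m
      simp only [LinearMap.funLeft_apply, finCap_finCap, min_comm])
    (fun k j a => by
      rw [one_mul]
      exact (pi_norm_le_iff_of_nonneg (norm_nonneg a)).2 fun m => norm_le_pi_norm a _)
  have hp0 : 0 ≤ p := by linarith
  have hs : 0 < min (p - 1) 1 := lt_min (by linarith) one_pos
  refine not_forall_rpow_le (C := K ^ p * (C * c ^ p) + 1) hs fun n hn => ?_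
  obtain ⟨k, rfl⟩ : ∃ k, n = k + 1 := ⟨n - 1, by omega⟩
  set m : ℝ := ((k + 1 : ℕ) : ℝ) with hm
  have hm1 : 1 ≤ m := by rw [hm]; exact_mod_cast hn
  have hk := hest k fun j => Pi.single (finCap k j (Fin.last k)) 1
  have hup : ∫ t in (0 : ℝ)..P, ‖synthesis d k (∑ j ∈ Finset.range (k + 1),
      θ k j t • (Pi.single (finCap k j (Fin.last k)) (1 : ℂ) : Fin (k + 1) → ℂ))‖ ^ p ≤
        P * c ^ p := by
    refine integral_le_mul_of_le ((hθ k).continuous_synthesis_rpow hp0 d k _ _) hP.le fun t => ?_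
    refine Real.rpow_le_rpow (norm_nonneg _) ?_ hp0
    refine (h.norm_synthesis_le_norm hd k _).trans (mul_le_of_le_one_right (by linarith) ?_)
    refine (pi_norm_le_iff_of_nonneg zero_le_one).2 fun i => ?_
    rw [sum_smul_single_apply k fun j => θ k j t]
    exact ((hθ k).norm_eq _ t).le
  have hlow : ∫ t in (0 : ℝ)..P, ‖∑ j ∈ Finset.range (k + 1), θ k j t‖ ^ p ≤
      ∫ t in (0 : ℝ)..P, K ^ p * ‖synthesis d k (∑ j ∈ Finset.range (k + 1),
        θ k j t • LinearMap.funLeft ℂ ℂ (finCap k j)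
          (Pi.single (finCap k j (Fin.last k)) (1 : ℂ) : Fin (k + 1) → ℂ))‖ ^ p := by
    refine intervalIntegral.integral_mono_on hP.le
      (((hθ k).continuous_rpow hp0 _).intervalIntegrable _ _)
      ((((hθ k).continuous_synthesis_rpow hp0 d k _ _).const_mul _).intervalIntegrable _ _)
      fun t _ => ?_
    rw [← Real.mul_rpow (by linarith) (norm_nonneg _)]
    refine Real.rpow_le_rpow (norm_nonneg _) ?_ hp0
    set v := ∑ j ∈ Finset.range (k + 1), θ k j t • LinearMap.funLeft ℂ ℂ (finCap k j)
      (Pi.single (finCap k j (Fin.last k)) (1 : ℂ) : Fin (k + 1) → ℂ) with hv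
    have h1 := norm_analysis_le (Ω := Fin (k + 1)) hK (by linarith) hf k (synthesis d k v)
    rw [analysis_synthesis hfd] at h1
    refine le_trans ?_ ((norm_le_pi_norm v (Fin.last k)).trans h1)
    rw [hv, Finset.sum_apply]
    simp [LinearMap.funLeft_apply]
  rw [intervalIntegral.integral_const_mul] at hlow
  have h1 := ((hθ k).le_integral_rpow hP hp (Nat.le_add_left 1 k)).trans (hlow.trans
    (mul_le_mul_of_nonneg_left (hk.trans (mul_le_mul_of_nonneg_left hup hC))
      (Real.rpow_nonneg (by linarith : 0 ≤ K) p)))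
  rw [← hm] at h1
  have h2 : min (m ^ (p - 1)) (m - 1) ≤ K ^ p * (C * c ^ p) := by
    refine le_of_mul_le_mul_left ?_ hP
    calc _ ≤ _ := h1
      _ = _ := by ring
  rw [← sub_le_iff_le_add]
  refine le_trans (le_min ?_ ?_) h2
  · have := Real.rpow_le_rpow_of_exponent_le hm1 (min_le_left (p - 1) 1)
    linarith
  · have := Real.rpow_le_rpow_of_exponent_le hm1 (min_le_right (p - 1) 1)
    rw [Real.rpow_one] at this
    linarith

end Endpoints

/-! ### Shears between complemented copies of different sequence spaces. -/

section Interior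

/-- Complementary copies `u`, `w` of `ℓ_{1/s}^k` and `ℓ_{1/s'}^k` in `ℓ_{1/α}(Ω)`, with their
coordinate maps `u'` and `w'`. -/
structure IsComplementedPair {Ω : Type} [Fintype Ω] {k : ℕ} (α s s' κ : ℝ)
    (u w : (Fin k → ℂ) →ₗ[ℂ] (Ω → ℂ)) (u' w' : (Ω → ℂ) →ₗ[ℂ] (Fin k → ℂ)) : Prop where
  left_u : ∀ v, u' (u v) = v
  left_w : ∀ v, w' (w v) = v
  left_uw : ∀ v, u' (w v) = 0
  left_wu : ∀ v, w' (u v) = 0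
  norm_u : ∀ v, ellNorm α (u v) ≤ κ * ellNorm s v
  norm_w : ∀ v, ellNorm α (w v) ≤ κ * ellNorm s' v
  norm_u' : ∀ a, ellNorm s (u' a) ≤ κ * ellNorm α a
  norm_w' : ∀ a, ellNorm s' (w' a) ≤ κ * ellNorm α a

theorem IsComplementedPair.symm {Ω : Type} [Fintype Ω] {k : ℕ} {α s s' κ : ℝ}
    {u w : (Fin k → ℂ) →ₗ[ℂ] (Ω → ℂ)} {u' w' : (Ω → ℂ) →ₗ[ℂ] (Fin k → ℂ)}
    (h : IsComplementedPair α s s' κ u w u' w') : IsComplementedPair α s' s κ w u w' u' :=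
  ⟨h.left_w, h.left_u, h.left_wu, h.left_uw, h.norm_w, h.norm_u, h.norm_w', h.norm_u'⟩

/-- The projection onto the coordinates satisfying `q`. -/
def coordCut {k : ℕ} (q : Fin k → Prop) [DecidablePred q] : (Fin k → ℂ) →ₗ[ℂ] (Fin k → ℂ) where
  toFun v i := if q i then v i else 0
  map_add' v v' := by ext i; by_cases h : q i <;> simp [h]
  map_smul' z v := by ext i; by_cases h : q i <;> simp [h]

theorem coordCut_apply {k : ℕ} (q : Fin k → Prop) [DecidablePred q] (v : Fin k → ℂ) (i : Fin k) :
    coordCut q v i = if q i then v i else 0 := rfl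

theorem ellNorm_coordCut_le {k : ℕ} {s : ℝ} (hs : 0 < s) (q : Fin k → Prop) [DecidablePred q]
    (v : Fin k → ℂ) : ellNorm s (coordCut q v) ≤ ellNorm s v := by
  refine ellNorm_mono hs fun i => ?_
  rw [coordCut_apply]
  split_ifs <;> simp

/-- A single coordinate has the same norm in every `ℓ_p`. This is why a shear acting on one
coordinate stays bounded although the two copies carry different norms. -/
theorem ellNorm_coordCut_eq_le {k : ℕ} {s s' : ℝ} (hs : 0 < s) (hs' : 0 < s') (j : ℕ)
    (v : Fin k → ℂ) : ellNorm s' (coordCut (fun i => (i : ℕ) = j) v) ≤ ellNorm s v := by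
  by_cases h : j < k
  · have : coordCut (fun i => (i : ℕ) = j) v = Pi.single (⟨j, h⟩ : Fin k) (v ⟨j, h⟩) := by
      ext i
      rw [coordCut_apply, Pi.single_apply]
      split_ifs with h1 h2 h2
      · rw [h2]
      · exact absurd (Fin.ext h1) h2
      · exact absurd (by rw [h2]) h1
      · rfl
    rw [this, ellNorm_single hs']
    exact norm_apply_le_ellNorm hs v _
  · have : coordCut (fun i => (i : ℕ) = j) v = 0 := by
      ext i
      rw [coordCut_apply, if_neg (by have := i.2; omega), Pi.zero_apply]
    rw [this]
    refine le_trans (le_of_eq ?_) (ellNorm_nonneg s v)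
    simp [ellNorm, Real.zero_rpow (inv_ne_zero hs'.ne'), Real.zero_rpow hs'.ne']

/-- The projection that keeps the first coordinates of both copies and adds, at the last
coordinate kept, the first copy to the second one. -/
def shearStep {Ω : Type} [Fintype Ω] {k : ℕ} (u w : (Fin k → ℂ) →ₗ[ℂ] (Ω → ℂ))
    (u' w' : (Ω → ℂ) →ₗ[ℂ] (Fin k → ℂ)) (j : ℕ) : (Ω → ℂ) →ₗ[ℂ] (Ω → ℂ) :=
  u ∘ₗ coordCut (fun i => (i : ℕ) ≤ j) ∘ₗ u' + w ∘ₗ (coordCut (fun i => (i : ℕ) < j) ∘ₗ w' +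
    coordCut (fun i => (i : ℕ) = j) ∘ₗ u')

namespace IsComplementedPair

variable {Ω : Type} [Fintype Ω] {k : ℕ} {α s s' κ : ℝ}
  {u w : (Fin k → ℂ) →ₗ[ℂ] (Ω → ℂ)} {u' w' : (Ω → ℂ) →ₗ[ℂ] (Fin k → ℂ)}

theorem coord_shearStep (h : IsComplementedPair α s s' κ u w u' w') (j : ℕ) (a : Ω → ℂ) :
    u' (shearStep u w u' w' j a) = coordCut (fun i => (i : ℕ) ≤ j) (u' a) := by
  simp [shearStep, h.left_u, h.left_uw]

theorem coord_shearStep' (h : IsComplementedPair α s s' κ u w u' w') (j : ℕ) (a : Ω → ℂ) :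
    w' (shearStep u w u' w' j a) = coordCut (fun i => (i : ℕ) < j) (w' a) +
      coordCut (fun i => (i : ℕ) = j) (u' a) := by
  simp [shearStep, h.left_w, h.left_wu]

/-- On the coordinate pairs given by `u'` and `w'`, the step at `j` keeps the pairs below `j`,
replaces `(p, q)` by `(p, p)` at `j` and kills the pairs above. -/
theorem shearStep_shearStep (h : IsComplementedPair α s s' κ u w u' w') (i j : ℕ) (a : Ω → ℂ) :
    shearStep u w u' w' i (shearStep u w u' w' j a) = shearStep u w u' w' (min i j) a := by
  have e : ∀ j a, shearStep u w u' w' j a = u (coordCut (fun i => (i : ℕ) ≤ j) (u' a)) +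
      w (coordCut (fun i => (i : ℕ) < j) (w' a) + coordCut (fun i => (i : ℕ) = j) (u' a)) :=
    fun _ _ => rfl
  rw [e i, e (min i j), h.coord_shearStep, h.coord_shearStep']
  congr 2
  · ext m
    simp only [coordCut_apply]
    split_ifs <;> first | rfl | omega
  · ext m
    simp only [coordCut_apply, Pi.add_apply]
    split_ifs <;> first | omega | simp

theorem shearStep_apply_single (h : IsComplementedPair α s s' κ u w u' w') (j : Fin k) :
    shearStep u w u' w' j (u (Pi.single j 1)) = u (Pi.single j 1) + w (Pi.single j 1) := by
  have e : shearStep u w u' w' j (u (Pi.single j 1)) =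
      u (coordCut (fun i => (i : ℕ) ≤ j) (u' (u (Pi.single j 1)))) +
      w (coordCut (fun i => (i : ℕ) < j) (w' (u (Pi.single j 1))) +
        coordCut (fun i => (i : ℕ) = j) (u' (u (Pi.single j 1)))) := rfl
  rw [e, h.left_u, h.left_wu, map_zero, zero_add]
  congr 2
  · ext m
    rw [coordCut_apply, Pi.single_apply]
    split_ifs with h1 h2 h2
    · rfl
    · rfl
    · exact absurd (le_of_eq (by rw [h2])) h1
    · rfl
  · ext m
    rw [coordCut_apply, Pi.single_apply]
    split_ifs with h1 h2 h2
    · rfl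
    · rfl
    · exact absurd (by rw [h2]) h1
    · rfl

/-- Each of the three terms (two cuts and one shear) enters and leaves through the coordinate maps
at cost `κ ^ 2`. -/
theorem ellNorm_shearStep_le (h : IsComplementedPair α s s' κ u w u' w') (hα : 0 < α)
    (hα1 : α ≤ 1) (hs : 0 < s) (hs' : 0 < s') (hs1' : s' ≤ 1) (hκ : 0 ≤ κ) (j : ℕ) (a : Ω → ℂ) :
    ellNorm α (shearStep u w u' w' j a) ≤ 3 * κ ^ 2 * ellNorm α a := by
  have h1 := (h.norm_u (coordCut (fun i => (i : ℕ) ≤ j) (u' a))).trans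
    (mul_le_mul_of_nonneg_left ((ellNorm_coordCut_le hs _ _).trans (h.norm_u' a)) hκ)
  have h2 : ellNorm s' (coordCut (fun i => (i : ℕ) < j) (w' a) +
      coordCut (fun i => (i : ℕ) = j) (u' a)) ≤ κ * ellNorm α a + κ * ellNorm α a :=
    (ellNorm_add_le hs' hs1' _ _).trans (add_le_add
      ((ellNorm_coordCut_le hs' _ _).trans (h.norm_w' a))
      ((ellNorm_coordCut_eq_le hs hs' j _).trans (h.norm_u' a)))
  have h3 := (h.norm_w (coordCut (fun i => (i : ℕ) < j) (w' a) +
      coordCut (fun i => (i : ℕ) = j) (u' a))).trans (mul_le_mul_of_nonneg_left h2 hκ)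
  calc ellNorm α (shearStep u w u' w' j a) ≤ _ := ellNorm_add_le hα hα1 _ _
    _ ≤ _ := add_le_add h1 h3
    _ = 3 * κ ^ 2 * ellNorm α a := by ring

end IsComplementedPair

variable {E : ℕ → X →L[ℂ] X} {ν : ℕ → ℕ} {d : ℕ → X} {c : ℝ}

theorem sum_smul_single {k : ℕ} (z : ℕ → ℂ) :
    ∑ j ∈ Finset.range k, z j • (fun i : Fin k => if (i : ℕ) = j then (1 : ℂ) else 0) =
      fun i : Fin k => z i := by
  ext i
  rw [Finset.sum_apply, Finset.sum_eq_single (i : ℕ)]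
  · simp
  · intro j _ hj
    simp [hj.symm]
  · exact fun h => absurd (Finset.mem_range.2 i.2) h

/-- Maximal regularity forbids complementary copies of spaces with different growth. -/
theorem HasPowerType.le_of_complementedPair [CompleteSpace X] (hX : HasMRP X)
    (hE : IsUnconditionalResolution E) (hd : IsUnitSequence E ν d) {α s s' κ : ℝ}
    (h : HasPowerType E α c) (hα : 0 < α) (hs : 0 < s) (hs' : 0 < s') (hs1' : s' ≤ 1) (hκ : 0 < κ)
    (Ω : ℕ → Type) [∀ k, Fintype (Ω k)] {u w : ∀ k, (Fin k → ℂ) →ₗ[ℂ] (Ω k → ℂ)}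
    {u' w' : ∀ k, (Ω k → ℂ) →ₗ[ℂ] (Fin k → ℂ)}
    (huw : ∀ k, IsComplementedPair α s s' κ (u k) (w k) (u' k) (w' k)) : s' ≤ s := by
  by_contra! hss
  obtain ⟨K, hK1, hK⟩ := hE.exists_multiplier_bound
  obtain ⟨f, hfd, hf⟩ := hd.exists_dual hE
  have hc := h.one_le
  obtain ⟨p, P, C, θ, hp, hP, hC, hθ, hest⟩ := hX.exists_matrix_estimate hE hd hfd hf
    Ω (fun k => k) (fun _ => ellNorm α) (by linarith : 0 ≤ c)
    (by positivity : 0 ≤ 3 * κ ^ 2) (fun k a => h.norm_synthesis_le hα hd k a)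
    (fun k x => h.ellNorm_analysis_le hα hE hK hd.strictMono hf k x)
    (fun k j => shearStep (u k) (w k) (u' k) (w' k) j)
    (fun k i j a => (huw k).shearStep_shearStep i j a)
    (fun k j a => (huw k).ellNorm_shearStep_le hα h.le_one hs hs' hs1' hκ.le j a)
  have hp0 : 0 < p := by linarith
  have hc0 : 0 < c := by linarith
  refine not_forall_rpow_le (s := s' - s) (C := κ * c * (C ^ p⁻¹ * (c * κ))) (by linarith)
    fun k hk1 => ?_
  have hk0 : (0 : ℝ) < k := by exact_mod_cast hk1
  let e : ℕ → Fin k → ℂ := fun j i => if (i : ℕ) = j then 1 else 0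
  have he : ∀ j, ∀ hj : j < k, e j = Pi.single ⟨j, hj⟩ 1 := by
    intro j hj
    ext i
    simp only [e, Pi.single_apply, Fin.ext_iff]
  have hsum : ∀ t, ∑ j ∈ Finset.range k, θ k j t • e j = fun i : Fin k => θ k i t := fun t =>
    sum_smul_single fun j => θ k j t
  -- The `j`-th step sends `u e_j` to `u e_j + w e_j`. Unimodular sums of the former have norm at
  -- most of order `k ^ s`, and those of the latter at least of order `k ^ s'`, read off by `w'`; so
  -- `k ^ (s' - s)` would stay bounded.
  have hk := hest k fun j => u k (e j)
  have hA : ∀ t, ∑ j ∈ Finset.range k,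
      θ k j t • shearStep (u k) (w k) (u' k) (w' k) j (u k (e j)) =
        u k (fun i => θ k i t) + w k (fun i => θ k i t) := by
    intro t
    rw [← hsum, map_sum, map_sum, ← Finset.sum_add_distrib]
    refine Finset.sum_congr rfl fun j hj => ?_
    have hj' := Finset.mem_range.1 hj
    have := (huw k).shearStep_apply_single ⟨j, hj'⟩
    rw [← he] at this
    rw [this, map_smul, map_smul, smul_add]
  have hlow : P * ((k : ℝ) ^ s' / (κ * c)) ^ p ≤ ∫ t in (0 : ℝ)..P,
      ‖synthesis d k (∑ j ∈ Finset.range k,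
        θ k j t • shearStep (u k) (w k) (u' k) (w' k) j (u k (e j)))‖ ^ p := by
    refine mul_le_integral_of_le ((hθ k).continuous_synthesis_rpow hp0.le d k _ _) hP.le
      fun t => ?_
    refine Real.rpow_le_rpow (by positivity) ?_ hp0.le
    rw [div_le_iff₀' (by positivity), hA]
    set v := u k (fun i => θ k i t) + w k (fun i => θ k i t) with hv
    have h1 : ellNorm s' (w' k v) = (k : ℝ) ^ s' := by
      rw [hv, map_add, (huw k).left_w, (huw k).left_wu, zero_add, ellNorm_of_unimodular]
      · simp
      · exact fun i => (hθ k).norm_eq _ t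
    rw [← h1, mul_assoc]
    exact ((huw k).norm_w' v).trans
      (mul_le_mul_of_nonneg_left (h.ellNorm_le_norm_synthesis hα hd k v) hκ.le)
  have hup : ∫ t in (0 : ℝ)..P, ‖synthesis d k (∑ j ∈ Finset.range k, θ k j t • u k (e j))‖ ^ p ≤
      P * (c * (κ * (k : ℝ) ^ s)) ^ p := by
    refine integral_le_mul_of_le ((hθ k).continuous_synthesis_rpow hp0.le d k _ _) hP.le
      fun t => ?_
    refine Real.rpow_le_rpow (norm_nonneg _) ?_ hp0.le
    simp only [← map_smul, ← map_sum, hsum]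
    refine (h.norm_synthesis_le hα hd k _).trans (mul_le_mul_of_nonneg_left ?_ hc0.le)
    refine ((huw k).norm_u _).trans_eq ?_
    rw [ellNorm_of_unimodular]
    · simp
    · exact fun i => (hθ k).norm_eq _ t
  have h1 := hlow.trans (hk.trans (mul_le_mul_of_nonneg_left hup hC))
  have h2 : ((k : ℝ) ^ s' / (κ * c)) ^ p ≤ (C ^ p⁻¹ * (c * (κ * (k : ℝ) ^ s))) ^ p := by
    rw [Real.mul_rpow (by positivity) (by positivity), Real.rpow_inv_rpow hC hp0.ne']
    refine le_of_mul_le_mul_left ?_ hP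
    calc _ ≤ _ := h1
      _ = _ := by ring
  have h3 := (Real.rpow_le_rpow_iff (by positivity) (by positivity) hp0).1 h2
  rw [div_le_iff₀' (by positivity)] at h3
  rw [Real.rpow_sub hk0, div_le_iff₀ (by positivity)]
  calc _ ≤ _ := h3
    _ = _ := by ring

end Interior

/-! ### The Rademacher copy of `ℓ_2` beside a coordinate copy of `ℓ_{1/α}`. -/

section Rademacher

/-- The normalising factor on the cube of dimension `k`. -/
def cubeScale (k : ℕ) (α : ℝ) : ℂ := (((((2 : ℝ) ^ k) ^ α)⁻¹ : ℝ) : ℂ)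

theorem norm_cubeScale_mul (k : ℕ) (α : ℝ) : ‖cubeScale k α‖ * ((2 : ℝ) ^ k) ^ α = 1 := by
  have : (0 : ℝ) < ((2 : ℝ) ^ k) ^ α := by positivity
  rw [cubeScale, Complex.norm_real, Real.norm_of_nonneg (by positivity),
    inv_mul_cancel₀ this.ne']

theorem cubeScale_mul_cubeScale (k : ℕ) (α : ℝ) :
    cubeScale k (1 - α) * cubeScale k α * 2 ^ k = 1 := by
  have hq : (0 : ℝ) < 2 ^ k := by positivity
  have h : ((((2 : ℝ) ^ k) ^ (1 - α))⁻¹ * (((2 : ℝ) ^ k) ^ α)⁻¹ * 2 ^ k : ℝ) = 1 := by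
    rw [← mul_inv, ← Real.rpow_add hq, sub_add_cancel, Real.rpow_one, inv_mul_cancel₀ hq.ne']
  unfold cubeScale
  exact_mod_cast h

/-- The span of the coordinates outside the cube. -/
def coordEmbed (k : ℕ) : (Fin k → ℂ) →ₗ[ℂ] ((Fin k → Bool) ⊕ Fin k → ℂ) where
  toFun v := Sum.elim 0 v
  map_add' v v' := by ext (i | i) <;> simp
  map_smul' z v := by ext (i | i) <;> simp

/-- The coordinates outside the cube. -/
def coordRestrict (k : ℕ) : ((Fin k → Bool) ⊕ Fin k → ℂ) →ₗ[ℂ] (Fin k → ℂ) :=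
  LinearMap.funLeft ℂ ℂ Sum.inr

/-- The span of the normalised Rademacher functions on the cube. -/
def radEmbed (α : ℝ) (k : ℕ) : (Fin k → ℂ) →ₗ[ℂ] ((Fin k → Bool) ⊕ Fin k → ℂ) where
  toFun v := Sum.elim (cubeScale k α • radSum v) 0
  map_add' v v' := by
    ext (i | i)
    · simp [radSum, add_mul, Finset.sum_add_distrib, mul_add]
    · simp
  map_smul' z v := by
    ext (i | i)
    · simp only [radSum, Sum.elim_inl, Pi.smul_apply, smul_eq_mul, RingHom.id_apply,
        Finset.mul_sum]
      exact Finset.sum_congr rfl fun _ _ => by ring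
    · simp

/-- The coefficients along the normalised Rademacher functions. -/
def radRestrict (α : ℝ) (k : ℕ) : ((Fin k → Bool) ⊕ Fin k → ℂ) →ₗ[ℂ] (Fin k → ℂ) where
  toFun a := cubeScale k (1 - α) • radCoeff fun ω => a (Sum.inl ω)
  map_add' a a' := by
    ext i
    simp [radCoeff, mul_add, Finset.sum_add_distrib]
  map_smul' z a := by
    ext i
    simp only [radCoeff, Pi.smul_apply, smul_eq_mul, RingHom.id_apply, Finset.mul_sum]
    exact Finset.sum_congr rfl fun _ _ => by ring

/-- Khinchine's inequality bounds the Rademacher embedding and its dual bounds the coefficient map.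
The factors `2 ^ (-kα)` and `2 ^ (-k(1-α))` normalise them and together undo the `2 ^ k` of
orthogonality. -/
theorem exists_isComplementedPair {α : ℝ} (hα : 0 < α) (hα1 : α < 1) :
    ∃ κ : ℝ, 0 < κ ∧ ∀ k, IsComplementedPair α α (1 / 2) κ (coordEmbed k) (radEmbed α k)
      (coordRestrict k) (radRestrict α k) := by
  obtain ⟨κ, hκ, h⟩ := exists_khinchine hα hα1.le
  obtain ⟨κ', hκ', h'⟩ := exists_khinchine_dual hα hα1
  have hzero : ∀ {Ω : Type} [Fintype Ω], ellNorm α (0 : Ω → ℂ) = 0 := by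
    intro Ω _
    simp [ellNorm, Real.zero_rpow (inv_ne_zero hα.ne'), Real.zero_rpow hα.ne']
  refine ⟨1 + κ + κ', by positivity, fun k => ?_⟩
  refine ⟨fun v => ?_, fun v => ?_, fun v => ?_, fun v => ?_, fun v => ?_, fun v => ?_,
    fun a => ?_, fun a => ?_⟩
  · rfl
  · ext i
    have h1 : radRestrict α k (radEmbed α k v) i = cubeScale k (1 - α) *
        ∑ ω, boolSign (ω i) * (cubeScale k α * radSum v ω) := rfl
    have h2 : ∑ ω, boolSign (ω i) * (cubeScale k α * radSum v ω) =
        cubeScale k α * (2 ^ k * v i) := by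
      rw [← radCoeff_radSum, radCoeff, Finset.mul_sum]
      exact Finset.sum_congr rfl fun _ _ => by ring
    rw [h1, h2, ← mul_assoc, ← mul_assoc, cubeScale_mul_cubeScale, one_mul]
  · rfl
  · ext i
    simp [radRestrict, coordEmbed, radCoeff]
  · refine (ellNorm_sum_le hα hα1.le _).trans ?_
    have h1 : ellNorm α (fun i => coordEmbed k v (Sum.inl i)) = 0 := hzero
    have h2 : ellNorm α (fun i => coordEmbed k v (Sum.inr i)) = ellNorm α v := rfl
    rw [h1, h2, zero_add]
    exact le_mul_of_one_le_left (ellNorm_nonneg _ _) (by linarith)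
  · refine (ellNorm_sum_le hα hα1.le _).trans ?_
    have h1 : ellNorm α (fun i => radEmbed α k v (Sum.inr i)) = 0 := hzero
    have h2 : ellNorm α (fun i => radEmbed α k v (Sum.inl i)) =
      ellNorm α (cubeScale k α • radSum v) := rfl
    rw [h1, h2, add_zero, ellNorm_smul hα]
    calc _ ≤ ‖cubeScale k α‖ * (κ * ((2 : ℝ) ^ k) ^ α * ellNorm (1 / 2) v) :=
          mul_le_mul_of_nonneg_left (h k v) (norm_nonneg _)
      _ = ‖cubeScale k α‖ * ((2 : ℝ) ^ k) ^ α * (κ * ellNorm (1 / 2) v) := by ring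
      _ ≤ _ := by
          rw [norm_cubeScale_mul, one_mul]
          exact mul_le_mul_of_nonneg_right (by linarith) (ellNorm_nonneg _ _)
  · refine (ellNorm_comp_inr_le hα a).trans ?_
    exact le_mul_of_one_le_left (ellNorm_nonneg _ _) (by linarith)
  · have h2 : ellNorm (1 / 2) (radRestrict α k a) = ellNorm (1 / 2)
        (cubeScale k (1 - α) • radCoeff fun ω => a (Sum.inl ω)) := rfl
    rw [h2, ellNorm_smul (by norm_num)]
    calc _ ≤ ‖cubeScale k (1 - α)‖ * (κ' * ((2 : ℝ) ^ k) ^ (1 - α) *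
            ellNorm α fun ω => a (Sum.inl ω)) :=
          mul_le_mul_of_nonneg_left (h' k _) (norm_nonneg _)
      _ = ‖cubeScale k (1 - α)‖ * ((2 : ℝ) ^ k) ^ (1 - α) *
            (κ' * ellNorm α fun ω => a (Sum.inl ω)) := by ring
      _ ≤ _ := by
          rw [norm_cubeScale_mul, one_mul]
          exact mul_le_mul (by linarith) (ellNorm_comp_inl_le hα a) (ellNorm_nonneg _ _)
            (by linarith)

end Rademacher

/-- Shearing the coordinate copy onto the Rademacher copy gives `1 / 2 ≤ α`; exchanging their roles
gives the reverse inequality. -/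
theorem HasPowerType.eq_half [CompleteSpace X] {E : ℕ → X →L[ℂ] X} {ν : ℕ → ℕ} {d : ℕ → X}
    {α c : ℝ} (hX : HasMRP X) (hE : IsUnconditionalResolution E) (hd : IsUnitSequence E ν d)
    (h : HasPowerType E α c) : α = 1 / 2 := by
  rcases h.nonneg.eq_or_lt with rfl | hα
  · exact (h.ne_zero hX hE hd).elim
  rcases h.le_one.eq_or_lt with rfl | hα1
  · exact (h.ne_one hX hE hd).elim
  obtain ⟨κ, hκ, hp⟩ := exists_isComplementedPair hα hα1
  refine le_antisymm ?_ ?_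
  · exact h.le_of_complementedPair hX hE hd hα (by norm_num) hα hα1.le hκ _ fun k => (hp k).symm
  · exact h.le_of_complementedPair hX hE hd hα hα (by norm_num) (by norm_num) hκ _ hp

/-! ### Square estimates, with infinitely or finitely many nonzero components. -/

section SquareEstimate

/-- Norms of finite sums of components are equivalent, with constant `c`, to the square sums of the
norms of the components. -/
structure HasSquareEstimate (E : ℕ → X →L[ℂ] X) (c : ℝ) : Prop where
  one_le : 1 ≤ c
  sum_sq_le : ∀ (s : Finset ℕ) (y : ℕ → X), (∀ n, E n (y n) = y n) →
    ∑ n ∈ s, ‖y n‖ ^ 2 ≤ (c * ‖∑ n ∈ s, y n‖) ^ 2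
  norm_sum_sq_le : ∀ (s : Finset ℕ) (y : ℕ → X), (∀ n, E n (y n) = y n) →
    ‖∑ n ∈ s, y n‖ ^ 2 ≤ c ^ 2 * ∑ n ∈ s, ‖y n‖ ^ 2

variable {E : ℕ → X →L[ℂ] X}

theorem HasPowerType.hasSquareEstimate {c : ℝ} (h : HasPowerType E (1 / 2) c) :
    HasSquareEstimate E c := by
  have key : ∀ (s : Finset ℕ) (y : ℕ → X), (∀ n, E n (y n) = y n) →
      √(∑ n ∈ s, ‖y n‖ ^ 2) ≤ c * ‖∑ n ∈ s, y n‖ ∧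
        ‖∑ n ∈ s, y n‖ ≤ c * √(∑ n ∈ s, ‖y n‖ ^ 2) := by
    intro s y hy
    obtain ⟨N, hN⟩ := s.exists_nat_subset_range
    have hsum : ∑ n ∈ Finset.range N, (if n ∈ s then y n else 0) = ∑ n ∈ s, y n := by
      rw [Finset.sum_ite_mem, Finset.inter_eq_right.2 hN]
    have hsq : ∑ n ∈ Finset.range N, ‖if n ∈ s then y n else 0‖ ^ ((1 / 2 : ℝ)⁻¹) =
        ∑ n ∈ s, ‖y n‖ ^ 2 := by
      rw [← Finset.inter_eq_right.2 hN, ← Finset.sum_ite_mem, Finset.inter_eq_right.2 hN]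
      refine Finset.sum_congr rfl fun n _ => ?_
      split_ifs <;> simp
    have hx : IsDisjointlySupported E N (fun n => {n}) fun n => if n ∈ s then y n else 0 := by
      refine ⟨fun i _ j _ hij => by simpa using hij, fun i _ => ?_⟩
      rw [blockProj_apply, Finset.sum_singleton]
      split_ifs
      · exact hy i
      · exact map_zero _
    have h1 := h.upper (by norm_num) N _ _ hx
    have h2 := h.lower (by norm_num) N _ _ hx
    rw [hsum, hsq, ← Real.sqrt_eq_rpow] at h1 h2
    exact ⟨h2, h1⟩
  refine ⟨h.one_le, fun s y hy => ?_, fun s y hy => ?_⟩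
  · rw [← Real.sqrt_le_left (by have := h.one_le; positivity)]
    exact (key s y hy).1
  · have h0 : 0 ≤ ∑ n ∈ s, ‖y n‖ ^ 2 := by positivity
    calc _ ≤ (c * √(∑ n ∈ s, ‖y n‖ ^ 2)) ^ 2 := pow_le_pow_left₀ (norm_nonneg _) (key s y hy).2 2
      _ = _ := by rw [mul_pow, Real.sq_sqrt h0]

theorem IsUnconditionalResolution.apply_sum (hE : IsUnconditionalResolution E) {s : Finset ℕ}
    {y : ℕ → X} (hy : ∀ n, E n (y n) = y n) {m : ℕ} (hm : m ∈ s) : E m (∑ n ∈ s, y n) = y m := by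
  rw [map_sum, Finset.sum_eq_single m]
  · exact hy m
  · intro n _ hn
    rw [← hy n, hE.apply_apply, if_neg hn.symm]
  · exact fun h => absurd hm h

/-- The square estimate for a decomposition with finitely many components. -/
theorem IsUnconditionalResolution.exists_hasSquareEstimate_of_finite [CompleteSpace X]
    (hE : IsUnconditionalResolution E) {M : ℕ} (hM : ∀ n, M ≤ n → ∀ x, E n x = 0) :
    ∃ c, HasSquareEstimate E c := by
  obtain ⟨K, hK1, hK⟩ := hE.exists_multiplier_bound
  have hsum : ∀ (s : Finset ℕ) (g : ℕ → ℝ) (R : ℝ), (∀ n ∈ s, g n ≤ R) →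
      (∀ n, M ≤ n → g n = 0) → 0 ≤ R → ∑ n ∈ s, g n ≤ (M + 1) * R := by
    intro s g R hgR hg0 hR
    calc ∑ n ∈ s, g n = ∑ n ∈ s with n < M, g n := by
          rw [Finset.sum_filter]
          refine Finset.sum_congr rfl fun n _ => ?_
          split_ifs with h
          · rfl
          · exact hg0 n (not_lt.1 h)
      _ ≤ ∑ n ∈ s with n < M, R := Finset.sum_le_sum fun n hn => hgR n (Finset.mem_filter.1 hn).1
      _ = (s.filter (· < M)).card * R := by simp
      _ ≤ (M + 1) * R := by
          refine mul_le_mul_of_nonneg_right ?_ hR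
          have : (s.filter (· < M)).card ≤ (Finset.range M).card :=
            Finset.card_le_card fun n hn => Finset.mem_range.2 (Finset.mem_filter.1 hn).2
          rw [Finset.card_range] at this
          have : ((s.filter (· < M)).card : ℝ) ≤ M := by exact_mod_cast this
          linarith
  have hM1 : (1 : ℝ) ≤ M + 1 := by have := Nat.cast_nonneg (α := ℝ) M; linarith
  have hy0 : ∀ {y : ℕ → X}, (∀ n, E n (y n) = y n) → ∀ n, M ≤ n → y n = 0 := fun hy n hn => by
    rw [← hy n, hM n hn]
  -- At most `M` components are nonzero, and each is a projection of the sum of norm at most `K`.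
  refine ⟨(M + 1) * K, by nlinarith, fun s y hy => ?_, fun s y hy => ?_⟩
  · have h1 : ∀ n ∈ s, ‖y n‖ ≤ K * ‖∑ n ∈ s, y n‖ := fun n hn => by
      have := hK {n} (fun _ => 1) (by simp) (∑ n ∈ s, y n)
      rwa [Finset.sum_singleton, one_smul, hE.apply_sum hy hn] at this
    refine (hsum s (fun n => ‖y n‖ ^ 2) ((K * ‖∑ n ∈ s, y n‖) ^ 2)
      (fun n hn => pow_le_pow_left₀ (norm_nonneg _) (h1 n hn) 2)
      (fun n hn => by simp [hy0 hy n hn]) (sq_nonneg _)).trans ?_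
    rw [mul_assoc, mul_pow ((M : ℝ) + 1)]
    refine mul_le_mul_of_nonneg_right ?_ (sq_nonneg _)
    nlinarith
  · set S := ∑ n ∈ s, ‖y n‖ ^ 2 with hS
    have hS0 : 0 ≤ S := by positivity
    have h1 : ∀ n ∈ s, ‖y n‖ ≤ √S := fun n hn => by
      refine Real.le_sqrt_of_sq_le ?_
      exact Finset.single_le_sum (f := fun n => ‖y n‖ ^ 2) (fun _ _ => by positivity) hn
    have h2 := (norm_sum_le s y).trans (hsum s (fun n => ‖y n‖) _ h1
      (fun n hn => by simp [hy0 hy n hn]) (Real.sqrt_nonneg S))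
    calc _ ≤ ((M + 1) * √S) ^ 2 := pow_le_pow_left₀ (norm_nonneg _) h2 2
      _ = (M + 1) ^ 2 * S := by rw [mul_pow, Real.sq_sqrt hS0]
      _ ≤ _ := by
          refine mul_le_mul_of_nonneg_right (pow_le_pow_left₀ (by linarith) ?_ 2) hS0
          exact le_mul_of_one_le_right (by linarith) hK1

theorem IsUnconditionalResolution.exists_isUnitSequence (hE : IsUnconditionalResolution E)
    (h : {n | ∃ x, E n x ≠ 0}.Infinite) : ∃ ν d, IsUnitSequence E ν d := by
  have hν : ∀ i, ∃ x, E (Nat.nth (fun n => ∃ x, E n x ≠ 0) i) x ≠ 0 := fun i =>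
    Nat.nth_mem_of_infinite h i
  choose x hx using hν
  refine ⟨Nat.nth fun n => ∃ x, E n x ≠ 0,
    fun i => ((‖E (Nat.nth (fun n => ∃ x, E n x ≠ 0) i) (x i)‖ : ℂ)⁻¹) •
      E (Nat.nth (fun n => ∃ x, E n x ≠ 0) i) (x i), Nat.nth_strictMono h, fun i => ?_,
    fun i => ?_⟩
  · rw [norm_smul, norm_inv, Complex.norm_real, norm_norm,
      inv_mul_cancel₀ (norm_ne_zero_iff.2 (hx i))]
  · rw [blockProj_apply, Finset.sum_singleton, map_smul, hE.apply_apply, if_pos rfl]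

/-- A unit sequence, on which the determination of `α` rests, needs infinitely many nonzero
components; otherwise the estimate holds for counting reasons, without regularity. -/
theorem HasMRP.exists_hasSquareEstimate [CompleteSpace X] (hX : HasMRP X)
    (hE : IsUnconditionalResolution E) : ∃ c, HasSquareEstimate E c := by
  by_cases h : {n | ∃ x, E n x ≠ 0}.Infinite
  · obtain ⟨ν, d, hd⟩ := hE.exists_isUnitSequence h
    obtain ⟨C, hC1, hC⟩ := hX.exists_domination hE hd
    obtain ⟨α, c, hp⟩ := hC.exists_hasPowerType hC1 hE hd
    obtain rfl := hp.eq_half hX hE hd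
    exact ⟨c, hp.hasSquareEstimate⟩
  · obtain ⟨M, hM⟩ := (Set.not_infinite.1 h).bddAbove
    refine hE.exists_hasSquareEstimate_of_finite (M := M + 1) fun n hn x => ?_
    by_contra hx
    have := hM (show n ∈ {n | ∃ x, E n x ≠ 0} from ⟨x, hx⟩)
    omega

end SquareEstimate

/-! ### The isomorphism with the `ℓ_2`-sum. -/

section Isomorphism

variable {E : ℕ → X →L[ℂ] X} {F : ℕ → Submodule ℂ X} {c : ℝ}

theorem HasSquareEstimate.exists_sum_sq_le [CompleteSpace X] (h : HasSquareEstimate E c)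
    (hE : IsUnconditionalResolution E) :
    ∃ b, 0 ≤ b ∧ ∀ x (s : Finset ℕ), ∑ n ∈ s, ‖E n x‖ ^ 2 ≤ (b * ‖x‖) ^ 2 := by
  obtain ⟨K, hK1, hK⟩ := hE.exists_multiplier_bound
  have hc := h.one_le
  refine ⟨c * K, by positivity, fun x s => ?_⟩
  refine (h.sum_sq_le s (fun n => E n x) fun n => by rw [hE.apply_apply, if_pos rfl]).trans ?_
  refine pow_le_pow_left₀ (by positivity) ?_ 2
  rw [mul_assoc]
  refine mul_le_mul_of_nonneg_left ?_ (by linarith)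
  simpa using hK s (fun _ => 1) (by simp) x

/-- A resolution with a square estimate identifies the space with the `ℓ²`-sum of its components. -/
theorem HasSquareEstimate.nonempty_equiv [CompleteSpace X] (h : HasSquareEstimate E c)
    (hE : IsUnconditionalResolution E) (hEF : ∀ n x, E n x ∈ F n)
    (hFE : ∀ n, ∀ x ∈ F n, E n x = x) : Nonempty (X ≃L[ℂ] lp (fun n : ℕ => F n) 2) := by
  obtain ⟨b, hb0, hb⟩ := h.exists_sum_sq_le hE
  have hc := h.one_le
  have h2 : (2 : ENNReal).toReal = 2 := by simp
  have hb' : ∀ x (s : Finset ℕ), ∑ n ∈ s, ‖(⟨E n x, hEF n x⟩ : F n)‖ ^ (2 : ENNReal).toReal ≤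
      (b * ‖x‖) ^ (2 : ENNReal).toReal := fun x s => by
    rw [h2]
    simpa using hb x s
  let Φ : X →ₗ[ℂ] lp (fun n : ℕ => F n) 2 :=
    { toFun := fun x => ⟨fun n => ⟨E n x, hEF n x⟩, memℓp_gen' (hb' x)⟩
      map_add' := fun x y => by
        ext n
        exact map_add (E n) x y
      map_smul' := fun z x => by
        ext n
        exact map_smul (E n) z x }
  have hΦ : ∀ x n, ((Φ x n : F n) : X) = E n x := fun _ _ => rfl
  have hpart : ∀ (y : lp (fun n : ℕ => F n) 2) (s : Finset ℕ),
      ‖∑ n ∈ s, (y n : X)‖ ^ 2 ≤ c ^ 2 * ∑ n ∈ s, ‖y n‖ ^ 2 := fun y s =>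
    h.norm_sum_sq_le s (fun n => (y n : X)) fun n => hFE n _ (y n).2
  have hnorm : ∀ (y : lp (fun n : ℕ => F n) 2) (s : Finset ℕ), ∑ n ∈ s, ‖y n‖ ^ 2 ≤ ‖y‖ ^ 2 :=
    fun y s => by
      have := lp.sum_rpow_le_norm_rpow (p := 2) (by simp) y s
      rw [h2] at this
      simpa using this
  have hinj : Function.Injective Φ := by
    rw [← LinearMap.ker_eq_bot, LinearMap.ker_eq_bot']
    intro x hx
    have h0 : ∀ n, E n x = 0 := fun n => by rw [← hΦ, hx]; rfl
    have := hE.hasSum x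
    simp only [h0] at this
    exact this.unique hasSum_zero
  have hsurj : Function.Surjective Φ := by
    intro y
    have hsq : Summable fun n => ‖y n‖ ^ 2 :=
      summable_of_sum_le (fun _ => by positivity) (hnorm y)
    -- The upper square estimate turns the Cauchy criterion for `∑ ‖y n‖ ^ 2` into the one for `∑ y
    -- n`; its sum is the preimage of `y`.
    have hs : Summable fun n => (y n : X) := by
      rw [summable_iff_vanishing_norm]
      intro ε hε
      obtain ⟨s, hs⟩ := summable_iff_vanishing_norm.1 hsq ((ε / c) ^ 2) (by positivity)
      refine ⟨s, fun t ht => ?_⟩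
      have h1 := hs t ht
      rw [Real.norm_of_nonneg (by positivity)] at h1
      refine lt_of_pow_lt_pow_left₀ 2 hε.le ((hpart y t).trans_lt ?_)
      calc c ^ 2 * ∑ n ∈ t, ‖y n‖ ^ 2 < c ^ 2 * (ε / c) ^ 2 := by gcongr
        _ = ε ^ 2 := by field_simp
    refine ⟨∑' n, (y n : X), ?_⟩
    ext m
    rw [hΦ, (E m).map_tsum hs, tsum_eq_single m]
    · exact hFE m _ (y m).2
    · intro n hn
      rw [← hFE n _ (y n).2, hE.apply_apply, if_neg hn.symm]
  let e := LinearEquiv.ofBijective Φ ⟨hinj, hsurj⟩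
  have he : ∀ x, e x = Φ x := fun _ => rfl
  refine ⟨e.toContinuousLinearEquivOfBounds b c (fun x => ?_) fun y => ?_⟩
  · exact lp.norm_le_of_forall_sum_le (by simp) (by positivity) (hb' x)
  · obtain ⟨x, rfl⟩ := e.surjective y
    rw [e.symm_apply_apply]
    refine le_of_tendsto (hE.hasSum x).norm (Eventually.of_forall fun s => ?_)
    refine le_of_sq_le_sq ?_ (by positivity)
    calc ‖∑ n ∈ s, E n x‖ ^ 2 ≤ c ^ 2 * ∑ n ∈ s, ‖e x n‖ ^ 2 := hpart (e x) s
      _ ≤ c ^ 2 * ‖e x‖ ^ 2 := mul_le_mul_of_nonneg_left (hnorm _ s) (sq_nonneg c)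
      _ = _ := by rw [mul_pow]

end Isomorphism

end MaxReg

end

theorem theorem3p5 {X : Type*} [NormedAddCommGroup X] [NormedSpace ℂ X] [CompleteSpace X]
    (F : ℕ → Submodule ℂ X) (hF : MaxReg.IsUnconditionalSchauderDecomposition F)
    (hX : MaxReg.HasMRP X) :
    Nonempty (X ≃L[ℂ] lp (fun n : ℕ => F n) 2) := by
  obtain ⟨E, hE, hEF, hFE⟩ := hF.exists_resolution
  obtain ⟨c, hc⟩ := hX.exists_hasSquareEstimate hE
  exact hc.nonempty_equiv hE hEF hFE
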